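/- Theorem 3.1 (uniformb). Let $d\ge 1$, $m>1$ and $d<p\le\infty$, and let $B_r=\{x\in\mathbb{R}^d:|x|<r\}$. For $\epsilon>0$ put $\varphi_\epsilon(s)=s^m+\epsilon s$. For all $K_1,K_2,L_1,L_2\ge 0$ there is a constant $M$, depending only on $d,m,p,K_1,K_2,L_1,L_2$, such that the following holds. Let $\epsilon>0$, $r>0$, $0<T\le\infty$; let $V^\epsilon=V_1^\epsilon+V_2^\epsilon$ with $C^\infty$ vector fields $V_1^\epsilon,V_2^\epsilon:\mathbb{R}^d\to\mathbb{R}^d$ satisfying $\|V_1^\epsilon\|_{L^\infty(\mathbb{R}^d)}\le K_1$ and $\|V_2^\epsilon\|_{L^p(\mathbb{R}^d)}\le K_2$; and let $u_0\in L^1(\mathbb{R}^d)\cap L^\infty(\mathbb{R}^d)$ with $u_0\ge 0$ a.e., $\|u_0\|_1\le L_1$ and $\|u_0\|_\infty\le L_2$. Let $u\ge 0$ be a smooth solution of the regularized no-flux problem $$\begin{cases}\partial_t u=\Delta\varphi_\epsilon(u)+\nabla\cdot(uV^\epsilon) & \text{in } B_r\times(0,T),\\ (\nabla\varphi_\epsilon(u)+uV^\epsilon)\cdot\nu=0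 & \text{on }\partial B_r\times(0,T),\\ u(\cdot,0)=u_0 & \text{on } B_r,\end{cases}$$ where $\nu$ is the outward unit normal; that is, $u$ is $C^\infty$ on $\overline{B_r}\times(0,T)$, satisfies the first two lines pointwise, $u(\cdot,0)=u_0$ a.e. on $B_r$, and $u(\cdot,t)\to u_0$ in $L^1(B_r)$ as $t\to0^+$. Then $|u(x,t)|\le M$ for all $x\in\overline{B_r}$ and $0<t<T$, and $|u(x,0)|\le M$ for a.e. $x\in B_r$. In particular the bound is uniform in time and independent of $\epsilon$, $r$ and $T$. -/

import Mathlib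

open Set Filter Topology MeasureTheory Metric
open scoped NNReal ENNReal ContDiff Laplacian

noncomputable section

namespace DriftDiffusion

/-- The divergence `∑ i, ∂ᵢ Fᵢ` of a vector field on `ℝᵈ`. -/
def divergence {d : ℕ} (F : EuclideanSpace ℝ (Fin d) → EuclideanSpace ℝ (Fin d))
    (x : EuclideanSpace ℝ (Fin d)) : ℝ :=
  ∑ i, (fderiv ℝ F x (EuclideanSpace.single i 1)) i

/-- The regularized nonlinearity `φ_ε(s) = s ^ m + ε s`. -/
def phi (m ε s : ℝ) : ℝ := s ^ m + ε * s

/-- `u` is a nonnegative smooth solution, for times in `[0, T)` with `0 < T ≤ ∞`, of the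
regularized no-flux problem on the ball `B_r` of `ℝᵈ` with drift `V` and initial datum `u₀`:
`∂ₜ u = Δ φ_ε(u) + ∇ · (u V)` in `B_r × (0, T)`,
`(∇ φ_ε(u) + u V) · ν = 0` on `∂B_r × (0, T)` and `u(·, 0) = u₀` on `B_r`.
Since `u₀` is only in `L¹ ∩ L^∞`, smoothness (up to the lateral boundary) is asked at positive
times, and the initial datum is attained in `L¹(B_r)`. -/
structure IsSmoothNoFluxSolution {d : ℕ} (m ε r : ℝ) (T : EReal)
    (V : EuclideanSpace ℝ (Fin d) → EuclideanSpace ℝ (Fin d))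
    (u₀ : EuclideanSpace ℝ (Fin d) → ℝ) (u : EuclideanSpace ℝ (Fin d) → ℝ → ℝ) : Prop where
  /-- `u` is smooth on the closed ball times the open time interval. -/
  smooth : ContDiffOn ℝ ∞ (fun z : EuclideanSpace ℝ (Fin d) × ℝ => u z.1 z.2)
    (closedBall 0 r ×ˢ {t : ℝ | 0 < t ∧ (t : EReal) < T})
  /-- `u` is nonnegative. -/
  nonneg : ∀ x ∈ closedBall 0 r, ∀ t : ℝ, 0 < t → (t : EReal) < T → 0 ≤ u x t
  /-- The equation in the open ball. -/
  equation : ∀ x ∈ ball 0 r, ∀ t : ℝ, 0 < t → (t : EReal) < T →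
    deriv (fun s => u x s) t =
      Δ (fun y => phi m ε (u y t)) x + divergence (fun y => u y t • V y) x
  /-- The no-flux condition; the outward unit normal at `x ∈ ∂B_r` is `x / r`, and the gradient
  at boundary points is taken from inside the ball. -/
  noFlux : ∀ x ∈ sphere 0 r, ∀ t : ℝ, 0 < t → (t : EReal) < T →
    inner ℝ (gradientWithin (fun y => phi m ε (u y t)) (closedBall 0 r) x + u x t • V x)
      (r⁻¹ • x) = 0
  /-- The value at time `0` is `u₀`. -/
  initial : ∀ᵐ x ∂(volume.restrict (ball 0 r)), u x 0 = u₀ x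
  /-- `u(·, t)` converges to `u₀` in `L¹(B_r)` as `t` decreases to `0`. -/
  initial_tendsto : Tendsto
    (fun t : ℝ => eLpNorm (fun x => u x t - u₀ x) 1 (volume.restrict (ball 0 r)))
    (𝓝[>] 0) (𝓝 0)

end DriftDiffusion

end

/-!
The bound is proved by a De Giorgi iteration whose constants see neither `ε`, nor the radius, nor
the time interval.

The drift is written as `V = b + ∇W` with a bounded potential `W` and a remainder `b` which is
bounded in `L ^ q`, on sets of measure at most one, for some finite `q > max d 2`
(`exists_isDriftDecomposition`). If `p > 2` then `W = 0` is possible. If `p ≤ 2` the dimension is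
one; every field is then a gradient, and the large values of `V₂` are moved into `∇W`, where
`|W| ≤ ∫ |V₂| ^ p`.

With `Ψ(y) = m / (m - 1) * exp ((m - 1) y) + ε y` the flux is `u (∇ Ψ(log u) + V)`. In terms of the
shifted logarithm `τ`, defined by `Ψ(τ) = Ψ(log u) + W` (`logShift`, `levelTau`), it is
`u (Ψ'(τ) ∇τ + b)`, so the potential disappears from the equation. At the levels in use `τ` and
`log u` differ by at most `sup |W|`. Testing the equation with a truncation `Γ(τ)` above a level
`κ` gives (`IsSmoothNoFluxSolution.energyDeriv_le`)
`E' ≤ - c ∫ |∇w| ^ 2 + C ∫_Z (w ^ 2 + exp κ) |b| ^ 2`,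
where `E` is the integral of the antiderivative of the test function in the density, `w` is
`exp (τ / 2)` cut off at the level, and `Z = {τ > κ}`. The slope of `Γ` decays like `exp (-α τ)`
with `α = min (m - 1) 1`, just as fast as the growth of `Ψ'` permits; hence, far above the
level, the density of `E` and `w ^ 2` are both of the order of `u`. The constants do not involve `ε`, as `ε` only helps in
the lower bound `Ψ'(τ) ≥ exp (α τ)`, and otherwise `Ψ'` enters through its ratios at points at
bounded distance.

Since `w` vanishes on at least half of the ball, it is bounded by a Riesz potential of `1_Z |∇w|`.
This gives the Poincaré inequality
`∫_Z w ^ 2 g ^ 2 ≤ C |Z| ^ (2 / d - 2 / q) ‖g‖_{L ^ q(Z)} ^ 2 ∫ |∇w| ^ 2`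
with a constant that does not depend on the ball (`exists_weighted_poincare`). If `|Z| ≤ a` at all
times, with `a` small, then the term with `w ^ 2 |b| ^ 2` is absorbed, `E` satisfies
`E' ≤ - k E + R`, and, as `E` starts from zero, `E ≤ R / k` at all times. By Markov's inequality
`|{τ > κ + θ}| ≤ C θ ^ (-4) a ^ (1 + β)` with `β = 2 / d - 2 / q > 0` (`exists_level_step`). The
iteration over the levels then shows that `τ` is bounded
(`exists_bound_of_isDriftDecomposition`); it starts because the mass of `u` does not exceed that of
`u₀` (`IsSmoothNoFluxSolution.integral_le`).
-/

/-! ### The divergence theorem on a ball -/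

namespace DriftDiffusion

open Real (smoothTransition)

/-- Integration by parts of a vector field against a cutoff supported in an open set. -/
theorem integral_mul_divergence_eq_neg {d : ℕ} {U : Set (EuclideanSpace ℝ (Fin d))}
    (hU : IsOpen U) {X : EuclideanSpace ℝ (Fin d) → EuclideanSpace ℝ (Fin d)}
    {η : EuclideanSpace ℝ (Fin d) → ℝ} (hX : ContDiffOn ℝ 1 X U) (hη : ContDiff ℝ 1 η)
    (hηc : HasCompactSupport η) (hηU : tsupport η ⊆ U) :
    ∫ x, η x * divergence X x = - ∫ x, fderiv ℝ η x (X x) := by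
  have hXat : ∀ x ∈ U, ContDiffAt ℝ 1 X x := fun x hx => hX.contDiffAt (hU.mem_nhds hx)
  have hcoord : ∀ i, ∀ x ∈ U, ContDiffAt ℝ 1 (fun y => X y i) x := fun i x hx =>
    (EuclideanSpace.proj (𝕜 := ℝ) i).contDiff.contDiffAt.comp x (hXat x hx)
  have hfd : ∀ i, ∀ x ∈ U, ∀ v, fderiv ℝ (fun y => X y i) x v = (fderiv ℝ X x v) i := by
    intro i x hx v
    have h := ((EuclideanSpace.proj (𝕜 := ℝ) i).hasFDerivAt (x := X x)).comp x
      ((hXat x hx).differentiableAt one_ne_zero).hasFDerivAt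
    have h2 : HasFDerivAt (fun y => X y i) _ x := h
    rw [h2.fderiv]; rfl
  have hηz : ∀ x, x ∉ tsupport η → η x = 0 := fun x hx => image_eq_zero_of_notMem_tsupport hx
  have hηfz : ∀ x, x ∉ tsupport η → fderiv ℝ η x = 0 := fun x hx =>
    Function.notMem_support.1 fun h => hx (support_fderiv_subset ℝ h)
  have hηf : Continuous (fderiv ℝ η) := hη.continuous_fderiv one_ne_zero
  -- Continuity on `U` suffices, because everything vanishes off the support of `η`.
  have hint : ∀ F : EuclideanSpace ℝ (Fin d) → ℝ, (∀ x ∈ U, ContinuousAt F x) →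
      (∀ x, x ∉ tsupport η → F x = 0) → Integrable F := by
    intro F h1 h2
    have hs : tsupport F ⊆ tsupport η := closure_minimal
      (fun x hx => by by_contra h; exact hx (h2 x h)) (isClosed_tsupport _)
    have hc : Continuous F := continuous_of_tsupport fun x hx => h1 x (hηU (hs hx))
    exact hc.integrable_of_hasCompactSupport (hηc.of_isClosed_subset (isClosed_tsupport _) hs)
  have hfdc : ∀ i, ∀ x ∈ U, ContinuousAt
      (fun y => fderiv ℝ (fun z => X z i) y (EuclideanSpace.single i (1 : ℝ))) x := by
    intro i x hx
    exact ((hcoord i x hx).fderiv_right (m := 0) le_rfl).continuousAt.clm_apply continuousAt_const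
  have hi1 : ∀ i, Integrable (fun x => fderiv ℝ η x (EuclideanSpace.single i 1) * X x i) := by
    intro i
    refine hint _ (fun x hx => ?_) (fun x hx => by simp [hηfz x hx])
    exact (hηf.continuousAt.clm_apply continuousAt_const).mul (hcoord i x hx).continuousAt
  have hi2 : ∀ i, Integrable (fun x => η x *
      fderiv ℝ (fun z => X z i) x (EuclideanSpace.single i 1)) := by
    intro i
    refine hint _ (fun x hx => ?_) (fun x hx => by simp [hηz x hx])
    exact hη.continuous.continuousAt.mul (hfdc i x hx)
  have hi3 : ∀ i, Integrable (fun x => η x * X x i) := by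
    intro i
    refine hint _ (fun x hx => ?_) (fun x hx => by simp [hηz x hx])
    exact hη.continuous.continuousAt.mul (hcoord i x hx).continuousAt
  have e1 : ∀ x, η x * divergence X x =
      ∑ i, η x * fderiv ℝ (fun z => X z i) x (EuclideanSpace.single i 1) := by
    intro x
    by_cases hx : x ∈ tsupport η
    · simp only [divergence, Finset.mul_sum]
      exact Finset.sum_congr rfl fun i _ => by rw [hfd i x (hηU hx)]
    · simp [hηz x hx]
  have e2 : ∀ x, fderiv ℝ η x (X x) = ∑ i, fderiv ℝ η x (EuclideanSpace.single i 1) * X x i := by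
    intro x
    have : X x = ∑ i, X x i • EuclideanSpace.single i (1 : ℝ) := by
      have := (EuclideanSpace.basisFun (Fin d) ℝ).sum_repr (X x)
      simpa using this.symm
    conv_lhs => rw [this]
    simp [mul_comm]
  simp only [e1, e2]
  rw [integral_finsetSum _ fun i _ => hi2 i, integral_finsetSum _ fun i _ => hi1 i,
    ← Finset.sum_neg_distrib]
  refine Finset.sum_congr rfl fun i _ => ?_
  exact integral_mul_fderiv_eq_neg_fderiv_mul_of_integrable (hi1 i) (hi2 i) (hi3 i)
    (fun x _ => hη.differentiable one_ne_zero x)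
    (fun x hx => (hcoord i x (hηU hx)).differentiableAt one_ne_zero)

/-- The radial cutoff of the ball of radius `r` at depth of order `r / j`: it vanishes for
`|x|² / r² ≥ 1 - 1 / j` and equals one for `|x|² / r² ≤ 1 - 2 / j`. -/
noncomputable def ballCutoff {d : ℕ} (r j : ℝ) (x : EuclideanSpace ℝ (Fin d)) : ℝ :=
  smoothTransition (j * (1 - ‖x‖ ^ 2 / r ^ 2) - 1)

theorem contDiff_ballCutoff {d : ℕ} (r j : ℝ) :
    ContDiff ℝ 1 (ballCutoff (d := d) r j) := by
  unfold ballCutoff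
  exact Real.smoothTransition.contDiff.comp
    ((contDiff_const.mul (contDiff_const.sub ((contDiff_norm_sq ℝ).div_const _))).sub
      contDiff_const)

theorem tsupport_ballCutoff_subset {d : ℕ} {r j : ℝ} (hr : 0 < r) (hj : 0 < j) :
    tsupport (ballCutoff (d := d) r j) ⊆ ball 0 r := by
  have hsub : Function.support (ballCutoff (d := d) r j) ⊆
      {x | ‖x‖ ^ 2 ≤ r ^ 2 * (1 - 1 / j)} := by
    intro x hx
    have h1 : ¬ (j * (1 - ‖x‖ ^ 2 / r ^ 2) - 1 ≤ 0) := fun h =>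
      hx (Real.smoothTransition.zero_of_nonpos h)
    push Not at h1
    have h2 : 1 / j < 1 - ‖x‖ ^ 2 / r ^ 2 := by
      rw [div_lt_iff₀ hj]; linarith
    have h3 : ‖x‖ ^ 2 / r ^ 2 < 1 - 1 / j := by linarith
    rw [div_lt_iff₀ (by positivity)] at h3
    simp only [mem_ofPred_eq]; linarith
  have hcl : IsClosed {x : EuclideanSpace ℝ (Fin d) | ‖x‖ ^ 2 ≤ r ^ 2 * (1 - 1 / j)} :=
    isClosed_le (by fun_prop) continuous_const
  refine (closure_minimal hsub hcl).trans fun x hx => ?_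
  simp only [mem_ofPred_eq] at hx
  rw [mem_ball_zero_iff]
  refine lt_of_pow_lt_pow_left₀ 2 hr.le (hx.trans_lt ?_)
  have : 0 < r ^ 2 * (1 / j) := by positivity
  linarith

/-- The cutoff decreases radially, and only in a thin shell. -/
theorem fderiv_ballCutoff {d : ℕ} (r j : ℝ) (hr : 0 < r) (hj : 0 < j)
    (x : EuclideanSpace ℝ (Fin d)) : ∃ c : ℝ, 0 ≤ c ∧
      (∀ v, fderiv ℝ (ballCutoff r j) x v = - (c * inner ℝ x v)) ∧
      (c ≠ 0 → r ^ 2 * (1 - 2 / j) ≤ ‖x‖ ^ 2) := by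
  have h1 : HasFDerivAt (fun y : EuclideanSpace ℝ (Fin d) => j * (1 - ‖y‖ ^ 2 / r ^ 2) - 1)
      ((-(2 * j / r ^ 2)) • (innerSL ℝ x)) x := by
    have h := (((hasStrictFDerivAt_norm_sq x).hasFDerivAt.mul_const ((r ^ 2)⁻¹)).const_sub
      1).const_mul j |>.sub_const 1
    simp only [div_eq_mul_inv]
    refine h.congr_fderiv ?_
    ext v
    simp
    ring
  have h2 := (Real.smoothTransition.contDiffAt (n := 1)
    (x := j * (1 - ‖x‖ ^ 2 / r ^ 2) - 1)).differentiableAt (by simp) |>.hasDerivAt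
  have h3 := h2.comp_hasFDerivAt x h1
  have h4 : HasFDerivAt (ballCutoff (d := d) r j) _ x := h3
  have hm : 0 ≤ deriv smoothTransition (j * (1 - ‖x‖ ^ 2 / r ^ 2) - 1) :=
    Real.smoothTransition.monotone.deriv_nonneg
  refine ⟨deriv smoothTransition (j * (1 - ‖x‖ ^ 2 / r ^ 2) - 1) * (2 * j / r ^ 2),
    by positivity, fun v => ?_, fun hc => ?_⟩
  · rw [h4.fderiv]; simp; ring
  · by_contra hlt
    push Not at hlt
    apply hc
    have h5 : 1 < j * (1 - ‖x‖ ^ 2 / r ^ 2) - 1 := by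
      have : ‖x‖ ^ 2 / r ^ 2 < 1 - 2 / j := by
        rw [div_lt_iff₀ (by positivity)]; linarith
      have h6 : 2 / j < 1 - ‖x‖ ^ 2 / r ^ 2 := by linarith
      rw [div_lt_iff₀ hj] at h6; linarith
    have h7 : smoothTransition =ᶠ[𝓝 (j * (1 - ‖x‖ ^ 2 / r ^ 2) - 1)] fun _ => 1 := by
      filter_upwards [lt_mem_nhds h5] with y hy using Real.smoothTransition.one_of_one_le hy.le
    rw [h7.deriv_eq]; simp

theorem integral_ballCutoff_mul_divergence {d : ℕ} {r j : ℝ} (hr : 0 < r) (hj : 0 < j)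
    {X : EuclideanSpace ℝ (Fin d) → EuclideanSpace ℝ (Fin d)}
    (hX : ContDiffOn ℝ 1 X (ball 0 r)) :
    ∫ x in ball 0 r, ballCutoff r j x * divergence X x =
      - ∫ x in ball 0 r, fderiv ℝ (ballCutoff r j) x (X x) := by
  have hs := tsupport_ballCutoff_subset (d := d) hr hj
  have hc : HasCompactSupport (ballCutoff (d := d) r j) :=
    (isCompact_closedBall 0 r).of_isClosed_subset (isClosed_tsupport _)
      (hs.trans ball_subset_closedBall)
  rw [setIntegral_eq_integral_of_forall_compl_eq_zero, setIntegral_eq_integral_of_forall_compl_eq_zero]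
  · exact integral_mul_divergence_eq_neg isOpen_ball hX (contDiff_ballCutoff r j) hc hs
  · intro x hx
    have : fderiv ℝ (ballCutoff (d := d) r j) x = 0 :=
      Function.notMem_support.1 fun h => hx (hs (support_fderiv_subset ℝ h))
    simp [this]
  · intro x hx
    rw [image_eq_zero_of_notMem_tsupport fun h => hx (hs h), zero_mul]

/-- The divergence theorem on a ball for a vector field without normal component on the sphere,
which is only continuous up to the boundary. -/
theorem integral_divergence_ball_eq_zero {d : ℕ} {r : ℝ} (hr : 0 < r)
    {X : EuclideanSpace ℝ (Fin d) → EuclideanSpace ℝ (Fin d)}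
    (hc : ContinuousOn X (closedBall 0 r)) (hX : ContDiffOn ℝ 1 X (ball 0 r))
    (hν : ∀ x ∈ sphere (0 : EuclideanSpace ℝ (Fin d)) r, inner ℝ x (X x) = 0)
    (hi : IntegrableOn (divergence X) (ball 0 r)) :
    ∫ x in ball 0 r, divergence X x = 0 := by
  have hlim : Tendsto (fun n : ℕ => ∫ x in ball 0 r, ballCutoff r (n + 1) x * divergence X x) atTop
      (𝓝 (∫ x in ball 0 r, divergence X x)) := by
    refine tendsto_integral_of_dominated_convergence (fun x => ‖divergence X x‖)
      (fun n => ?_) hi.norm (fun n => ?_) ?_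
    · exact (contDiff_ballCutoff r _).continuous.aestronglyMeasurable.mul hi.aestronglyMeasurable
    · refine ae_of_all _ fun x => ?_
      rw [norm_mul]
      refine mul_le_of_le_one_left (norm_nonneg _) ?_
      rw [ballCutoff, Real.norm_of_nonneg (Real.smoothTransition.nonneg _)]
      exact Real.smoothTransition.le_one _
    · filter_upwards [ae_restrict_mem measurableSet_ball] with x hx
      refine tendsto_const_nhds.congr' ?_
      have hx' : 0 < 1 - ‖x‖ ^ 2 / r ^ 2 := by
        rw [mem_ball_zero_iff] at hx
        have : ‖x‖ ^ 2 < r ^ 2 := pow_lt_pow_left₀ hx (norm_nonneg _) two_ne_zero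
        rw [sub_pos, div_lt_one (by positivity)]; exact this
      have ht : Tendsto (fun n : ℕ => ((n : ℝ) + 1) * (1 - ‖x‖ ^ 2 / r ^ 2)) atTop atTop :=
        (tendsto_atTop_add_const_right _ _ tendsto_natCast_atTop_atTop).atTop_mul_const hx'
      filter_upwards [ht.eventually_ge_atTop 2] with n hn
      rw [ballCutoff, Real.smoothTransition.one_of_one_le (by linarith), one_mul]
  refine tendsto_nhds_unique hlim ?_
  -- The cutoff tested against the identity field bounds the total mass of its radial slope.
  have hdivid : ∀ x : EuclideanSpace ℝ (Fin d), divergence (fun y => y) x = d := by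
    intro x; simp [divergence]
  have hfi : ∀ n : ℕ, ∀ Y : EuclideanSpace ℝ (Fin d) → EuclideanSpace ℝ (Fin d),
      ContinuousOn Y (closedBall 0 r) →
      IntegrableOn (fun x => fderiv ℝ (ballCutoff r (n + 1)) x (Y x)) (ball 0 r) := by
    intro n Y hY
    have : ContinuousOn (fun x => fderiv ℝ (ballCutoff r ((n : ℝ) + 1)) x (Y x))
        (closedBall 0 r) :=
      ((contDiff_ballCutoff r _).continuous_fderiv one_ne_zero).continuousOn.clm_apply hY
    exact (this.integrableOn_compact (isCompact_closedBall _ _)).mono_set ball_subset_closedBall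
  have hid : ∀ n : ℕ, - ∫ x in ball 0 r,
      fderiv ℝ (ballCutoff (d := d) r (n + 1)) x x ≤ d * volume.real (ball (0 : EuclideanSpace ℝ (Fin d)) r) := by
    intro n
    rw [← integral_ballCutoff_mul_divergence hr (by positivity) contDiff_fun_id.contDiffOn]
    simp only [hdivid]
    have : ∫ x in ball (0 : EuclideanSpace ℝ (Fin d)) r, ballCutoff r ((n : ℝ) + 1) x * (d : ℝ) ≤
        ∫ x in ball (0 : EuclideanSpace ℝ (Fin d)) r, (d : ℝ) := by
      refine setIntegral_mono_on ?_ (integrableOn_const (measure_ball_lt_top.ne)) measurableSet_ball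
        fun x _ => mul_le_of_le_one_left (by positivity) (Real.smoothTransition.le_one _)
      exact (((contDiff_ballCutoff r _).continuous.mul continuous_const).continuousOn.integrableOn_compact
        (isCompact_closedBall 0 r)).mono_set ball_subset_closedBall
    refine this.trans (le_of_eq ?_)
    simp [mul_comm]
  rw [Metric.tendsto_atTop]
  intro ε hε
  set D : ℝ := d * volume.real (ball (0 : EuclideanSpace ℝ (Fin d)) r) with hD
  have hD0 : 0 ≤ D := by positivity
  set δ : ℝ := ε / (D + 1) with hδ
  have hδ0 : 0 < δ := by positivity
  -- Near the sphere the normal component is small.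
  have hnear : ∃ N : ℕ, ∀ n ≥ N, ∀ x ∈ ball (0 : EuclideanSpace ℝ (Fin d)) r,
      r ^ 2 * (1 - 2 / ((n : ℝ) + 1)) ≤ ‖x‖ ^ 2 → |inner ℝ x (X x)| ≤ δ * ‖x‖ ^ 2 := by
    by_contra hcon
    push Not at hcon
    choose n hn x hx h1 h2 using hcon
    have hn' : Tendsto n atTop atTop := tendsto_atTop_mono hn tendsto_id
    obtain ⟨a, ha, φ, hφ, hlim⟩ := (isCompact_closedBall (0 : EuclideanSpace ℝ (Fin d)) r).tendsto_subseq
      fun N => ball_subset_closedBall (hx N)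
    have hla : Tendsto (fun N => ‖x (φ N)‖ ^ 2) atTop (𝓝 (‖a‖ ^ 2)) :=
      ((continuous_norm.pow 2).tendsto a).comp hlim
    have hl2 : Tendsto (fun N => r ^ 2 * (1 - 2 / ((n (φ N) : ℝ) + 1))) atTop (𝓝 (r ^ 2 * (1 - 0))) := by
      have : Tendsto (fun N => ((n (φ N) : ℕ) : ℝ) + 1) atTop atTop :=
        tendsto_atTop_add_const_right _ _
          (tendsto_natCast_atTop_atTop.comp (hn'.comp hφ.tendsto_atTop))
      exact (((this.const_div_atTop 2).const_sub 1).const_mul _)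
    have ha2 : r ^ 2 * (1 - 0) ≤ ‖a‖ ^ 2 := le_of_tendsto_of_tendsto' hl2 hla fun N => h1 _
    have hra : r ≤ ‖a‖ := le_of_sq_le_sq (by linarith) (norm_nonneg _)
    have has : a ∈ sphere (0 : EuclideanSpace ℝ (Fin d)) r := by
      rw [mem_sphere_zero_iff_norm]
      exact le_antisymm (mem_closedBall_zero_iff.1 ha) hra
    have hcX : Tendsto (fun N => |inner ℝ (x (φ N)) (X (x (φ N)))|) atTop
        (𝓝 |inner ℝ a (X a)|) := by
      have h3 : Tendsto (fun N => X (x (φ N))) atTop (𝓝 (X a)) :=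
        (hc a ha).tendsto.comp (tendsto_nhdsWithin_iff.2
          ⟨hlim, Eventually.of_forall fun N => ball_subset_closedBall (hx _)⟩)
      exact (hlim.inner h3).abs
    rw [hν a has, abs_zero] at hcX
    have := le_of_tendsto_of_tendsto' (hla.const_mul δ) hcX fun N => (h2 _).le
    have hpos : 0 < δ * ‖a‖ ^ 2 := by
      have : 0 < ‖a‖ := hr.trans_le hra
      positivity
    linarith
  obtain ⟨N, hN⟩ := hnear
  refine ⟨N, fun n hn => ?_⟩
  rw [dist_zero_right, integral_ballCutoff_mul_divergence hr (by positivity) hX, norm_neg]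
  have hj : (0 : ℝ) < (n : ℝ) + 1 := by positivity
  calc ‖∫ x in ball 0 r, fderiv ℝ (ballCutoff r (n + 1)) x (X x)‖
      ≤ ∫ x in ball 0 r, ‖fderiv ℝ (ballCutoff r (n + 1)) x (X x)‖ := norm_integral_le_integral_norm _
    _ ≤ ∫ x in ball 0 r, δ * - fderiv ℝ (ballCutoff (d := d) r (n + 1)) x x := by
        refine setIntegral_mono_on (hfi n X hc).norm ((hfi n _ continuousOn_id).neg.const_mul δ)
          measurableSet_ball fun x hx => ?_
        obtain ⟨c, hc0, hc1, hc2⟩ := fderiv_ballCutoff r _ hr hj x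
        rw [hc1, hc1, real_inner_self_eq_norm_sq, neg_neg, norm_neg, norm_mul, Real.norm_eq_abs,
          Real.norm_eq_abs, abs_of_nonneg hc0]
        by_cases h0 : c = 0
        · simp [h0]
        · have := mul_le_mul_of_nonneg_left (hN n hn x hx (hc2 h0)) hc0
          linarith
    _ = δ * - ∫ x in ball 0 r, fderiv ℝ (ballCutoff (d := d) r (n + 1)) x x := by
        rw [integral_const_mul, integral_neg]
    _ ≤ δ * D := mul_le_mul_of_nonneg_left (hid n) hδ0.le
    _ < ε := by
        rw [hδ, div_mul_eq_mul_div, div_lt_iff₀ (by positivity)]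
        nlinarith

end DriftDiffusion

/-! ### Riesz potentials on a ball -/

namespace DriftDiffusion

theorem lintegral_comp_smul {d : ℕ} {t : ℝ} (ht : 0 < t)
    {F : EuclideanSpace ℝ (Fin d) → ℝ≥0∞} (hF : Measurable F) :
    ∫⁻ z, F (t • z) = ENNReal.ofReal ((t ^ d)⁻¹) * ∫⁻ z, F z := by
  have h := Measure.map_addHaar_smul (volume : Measure (EuclideanSpace ℝ (Fin d))) ht.ne'
  have h2 : ∫⁻ z, F (t • z) = ∫⁻ z, F z ∂(Measure.map (t • ·) volume) :=
    (lintegral_map hF (measurable_const_smul t)).symm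
  rw [h2, h, lintegral_smul_measure, finrank_euclideanSpace_fin, smul_eq_mul,
    abs_of_pos (by positivity)]

theorem lintegral_unitBall_norm_rpow_lt_top {d : ℕ} (hd : 1 ≤ d) {γ : ℝ} (hγd : γ < d) :
    ∫⁻ y in ball (0 : EuclideanSpace ℝ (Fin d)) 1, ENNReal.ofReal (‖y‖ ^ (-γ)) < ⊤ := by
  have : Nonempty (Fin d) := ⟨⟨0, hd⟩⟩
  have h : IntegrableOn (fun y : EuclideanSpace ℝ (Fin d) => (fun s : ℝ => s ^ (-γ)) ‖y‖)
      (ball 0 1) volume := by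
    refine (integrableOn_fun_norm_addHaar (volume : Measure (EuclideanSpace ℝ (Fin d)))
      (f := fun s : ℝ => s ^ (-γ)) (r := 1)).2 ?_
    rw [finrank_euclideanSpace_fin]
    have h1 : IntegrableOn (fun s : ℝ => s ^ ((d : ℝ) - 1 - γ)) (Ioo 0 1) := by
      rw [← intervalIntegrable_iff_integrableOn_Ioo_of_le zero_le_one]
      exact intervalIntegral.intervalIntegrable_rpow' (by linarith)
    refine h1.congr_fun (fun s hs => ?_) measurableSet_Ioo
    have h2 : (s : ℝ) ^ (d - 1) = s ^ ((d : ℝ) - 1) := by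
      rw [← Real.rpow_natCast, Nat.cast_sub hd, Nat.cast_one]
    simp only [smul_eq_mul]
    rw [h2, ← Real.rpow_add hs.1]; ring_nf
  have := h.lintegral_lt_top
  exact this

theorem lintegral_ball_norm_sub_rpow {d : ℕ} {γ ρ : ℝ} (hρ : 0 < ρ)
    (x : EuclideanSpace ℝ (Fin d)) :
    ∫⁻ y in ball x ρ, ENNReal.ofReal (‖x - y‖ ^ (-γ)) =
      ENNReal.ofReal (ρ ^ ((d : ℝ) - γ)) *
        ∫⁻ y in ball (0 : EuclideanSpace ℝ (Fin d)) 1, ENNReal.ofReal (‖y‖ ^ (-γ)) := by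
  set G : EuclideanSpace ℝ (Fin d) → ℝ≥0∞ :=
    (ball 0 ρ).indicator fun y => ENNReal.ofReal (‖y‖ ^ (-γ)) with hG
  have hGm : Measurable G := by
    refine Measurable.indicator ?_ measurableSet_ball
    fun_prop
  have e1 : ∫⁻ y in ball x ρ, ENNReal.ofReal (‖x - y‖ ^ (-γ)) = ∫⁻ y, G y := by
    rw [← lintegral_sub_right_eq_self G x, ← lintegral_indicator measurableSet_ball]
    refine lintegral_congr fun y => ?_
    simp only [hG, indicator, mem_ball, dist_eq_norm, sub_zero, norm_sub_rev x y]
  have e2 := lintegral_comp_smul hρ hGm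
  have e3 : ∫⁻ z, G (ρ • z) = ENNReal.ofReal (ρ ^ (-γ)) *
      ∫⁻ y in ball (0 : EuclideanSpace ℝ (Fin d)) 1, ENNReal.ofReal (‖y‖ ^ (-γ)) := by
    rw [← lintegral_indicator measurableSet_ball, ← lintegral_const_mul]
    · refine lintegral_congr fun y => ?_
      have hiff : ‖ρ • y‖ < ρ ↔ ‖y‖ < 1 := by
        rw [norm_smul, Real.norm_of_nonneg hρ.le]
        constructor <;> intro h <;> nlinarith
      simp only [hG, indicator, mem_ball_zero_iff, hiff]
      split_ifs
      · rw [norm_smul, Real.norm_of_nonneg hρ.le, Real.mul_rpow hρ.le (norm_nonneg _),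
          ENNReal.ofReal_mul (by positivity)]
      · simp
    · exact Measurable.indicator (by fun_prop) measurableSet_ball
  rw [e1]
  have e4 : ∫⁻ z, G z = ENNReal.ofReal (ρ ^ d) * ∫⁻ z, G (ρ • z) := by
    rw [e2, ← mul_assoc, ← ENNReal.ofReal_mul (by positivity), mul_inv_cancel₀ (by positivity)]
    simp
  rw [e4, e3, ← mul_assoc, ← ENNReal.ofReal_mul (by positivity), ← Real.rpow_natCast,
    ← Real.rpow_add hρ, sub_eq_add_neg]

/-- Among sets of given measure, the integral of a power of the distance to a point is controlled by
the one on a ball. -/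
theorem exists_lintegral_norm_sub_rpow_le {d : ℕ} (hd : 1 ≤ d) {γ : ℝ} (hγ : 0 ≤ γ) (hγd : γ < d) :
    ∃ C : ℝ≥0, 0 < C ∧ ∀ (Z : Set (EuclideanSpace ℝ (Fin d))) (x : EuclideanSpace ℝ (Fin d)),
      ∫⁻ y in Z, ENNReal.ofReal (‖x - y‖ ^ (-γ)) ≤ C * volume Z ^ (1 - γ / d) := by
  have hfin := lintegral_unitBall_norm_rpow_lt_top hd hγd
  set I := ∫⁻ y in ball (0 : EuclideanSpace ℝ (Fin d)) 1, ENNReal.ofReal (‖y‖ ^ (-γ)) with hI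
  have hd0 : (0 : ℝ) < d := by exact_mod_cast hd
  have hexp : 0 < 1 - γ / d := by
    rw [sub_pos, div_lt_one hd0]; exact hγd
  refine ⟨I.toNNReal + 1, by positivity, fun Z x => ?_⟩
  rcases eq_or_ne (volume Z) ⊤ with hZ | hZ
  · rw [hZ, ENNReal.top_rpow_of_pos hexp, ENNReal.mul_top (by simp)]; exact le_top
  rcases eq_or_ne (volume Z) 0 with hZ0 | hZ0
  · rw [Measure.restrict_eq_zero.2 hZ0]; simp
  set v := (volume Z).toReal with hv
  have hv0 : 0 < v := ENNReal.toReal_pos hZ0 hZ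
  have hvZ : volume Z = ENNReal.ofReal v := (ENNReal.ofReal_toReal hZ).symm
  set ρ : ℝ := v ^ (1 / (d : ℝ)) with hρ
  have hρ0 : 0 < ρ := by positivity
  have h1 : ∫⁻ y in Z, ENNReal.ofReal (‖x - y‖ ^ (-γ)) ≤
      ∫⁻ y in Z, ((ball x ρ).indicator (fun y => ENNReal.ofReal (‖x - y‖ ^ (-γ))) y +
        ENNReal.ofReal (ρ ^ (-γ))) := by
    refine lintegral_mono fun y => ?_
    by_cases hy : y ∈ ball x ρ
    · simp [indicator_of_mem hy]
    · rw [indicator_of_notMem hy, zero_add]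
      refine ENNReal.ofReal_le_ofReal ?_
      rw [mem_ball, not_lt, dist_comm, dist_eq_norm] at hy
      exact Real.rpow_le_rpow_of_nonpos hρ0 hy (by linarith)
  have h2 : ∫⁻ y in Z, (ball x ρ).indicator (fun y => ENNReal.ofReal (‖x - y‖ ^ (-γ))) y ≤
      ENNReal.ofReal (ρ ^ ((d : ℝ) - γ)) * I := by
    rw [hI, ← lintegral_ball_norm_sub_rpow hρ0 x, ← lintegral_indicator measurableSet_ball]
    exact setLIntegral_le_lintegral _ _
  have hm : Measurable ((ball x ρ).indicator (fun y => ENNReal.ofReal (‖x - y‖ ^ (-γ)))) :=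
    Measurable.indicator (by fun_prop) measurableSet_ball
  have h3 : ρ ^ ((d : ℝ) - γ) = v ^ (1 - γ / d) := by
    rw [hρ, ← Real.rpow_mul hv0.le]; congr 1; field_simp
  have h4 : ρ ^ (-γ) * v = v ^ (1 - γ / d) := by
    rw [hρ, ← Real.rpow_mul hv0.le]
    conv_lhs => rw [← Real.rpow_one v, ← Real.rpow_mul hv0.le, ← Real.rpow_add hv0]
    congr 1; field_simp; ring
  calc _ ≤ _ := h1
    _ = (∫⁻ y in Z, (ball x ρ).indicator (fun y => ENNReal.ofReal (‖x - y‖ ^ (-γ))) y) +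
        ENNReal.ofReal (ρ ^ (-γ)) * volume Z := by
        rw [lintegral_add_left hm, setLIntegral_const]
    _ ≤ ENNReal.ofReal (ρ ^ ((d : ℝ) - γ)) * I + ENNReal.ofReal (ρ ^ (-γ)) * volume Z := by gcongr
    _ = (I.toNNReal + 1 : ℝ≥0) * volume Z ^ (1 - γ / d) := by
        rw [hvZ, ← ENNReal.ofReal_mul (by positivity), h3, h4, ENNReal.ofReal_rpow_of_pos hv0,
          ENNReal.coe_add, ENNReal.coe_toNNReal hfin.ne, ENNReal.coe_one]
        ring

/-- Along a segment of a ball, the increment of a `C¹` function is at most the integral of its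
slope. -/
theorem enorm_sub_le_lintegral_segment {d : ℕ} {r : ℝ} {w : EuclideanSpace ℝ (Fin d) → ℝ}
    (hw : ContDiffOn ℝ 1 w (ball 0 r)) {x z : EuclideanSpace ℝ (Fin d)} (hx : x ∈ ball 0 r)
    (hz : z ∈ ball 0 r) :
    ‖w z - w x‖ₑ ≤ ∫⁻ t in Ioo (0 : ℝ) 1, ‖fderiv ℝ w (x + t • (z - x))‖ₑ * ‖z - x‖ₑ := by
  have hmem : ∀ t ∈ Icc (0 : ℝ) 1, x + t • (z - x) ∈ ball (0 : EuclideanSpace ℝ (Fin d)) r :=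
    fun t ht => (convex_ball 0 r).add_smul_sub_mem hx hz ht
  have hder : ∀ t ∈ uIcc (0 : ℝ) 1, HasDerivAt (fun t : ℝ => w (x + t • (z - x)))
      (fderiv ℝ w (x + t • (z - x)) (z - x)) t := by
    intro t ht
    rw [uIcc_of_le zero_le_one] at ht
    have h1 : HasDerivAt (fun t : ℝ => x + t • (z - x)) (z - x) t := by
      simpa using ((hasDerivAt_id t).smul_const (z - x)).const_add x
    have h2 := ((hw.contDiffAt (isOpen_ball.mem_nhds (hmem t ht))).differentiableAt
      one_ne_zero).hasFDerivAt
    exact h2.comp_hasDerivAt t h1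
  have hcont : ContinuousOn (fun t : ℝ => fderiv ℝ w (x + t • (z - x)) (z - x)) (Icc 0 1) := by
    have h1 : ContinuousOn (fderiv ℝ w) (ball 0 r) := hw.continuousOn_fderiv_of_isOpen isOpen_ball le_rfl
    exact (h1.comp (by fun_prop) hmem).clm_apply continuousOn_const
  have hint : IntervalIntegrable (fun t : ℝ => fderiv ℝ w (x + t • (z - x)) (z - x)) volume 0 1 :=
    (hcont.mono (by rw [uIcc_of_le zero_le_one])).intervalIntegrable
  have h := intervalIntegral.integral_eq_sub_of_hasDerivAt hder hint
  simp only [one_smul, zero_smul, add_zero, add_sub_cancel] at h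
  rw [← h, intervalIntegral.integral_of_le zero_le_one, ← integral_Ioc_eq_integral_Ioo.symm]
  refine (enorm_integral_le_lintegral_enorm _).trans ?_
  refine lintegral_mono fun t => ?_
  exact ContinuousLinearMap.le_opENorm _ _

theorem lintegral_Ioo_indicator_rpow_le {d : ℕ} (hd : 1 ≤ d) {c : ℝ} (hc : 0 < c) :
    ∫⁻ t in Ioo (0 : ℝ) 1, (Ioi c).indicator (fun t => ENNReal.ofReal (t ^ (-(d : ℝ) - 1))) t ≤
      ENNReal.ofReal (c ^ (-(d : ℝ)) / d) := by
  have hd0 : (0 : ℝ) < d := by exact_mod_cast hd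
  refine (setLIntegral_le_lintegral _ _).trans ?_
  rw [lintegral_indicator measurableSet_Ioi, ← ofReal_integral_eq_lintegral_ofReal,
    integral_Ioi_rpow_of_lt (by linarith) hc]
  · refine ENNReal.ofReal_le_ofReal (le_of_eq ?_)
    rw [sub_add_cancel, neg_div_neg_eq]
  · exact integrableOn_Ioi_rpow_of_lt (by linarith) hc
  · filter_upwards [ae_restrict_mem measurableSet_Ioi] with t ht
    have : 0 < t := hc.trans ht
    positivity

end DriftDiffusion

namespace DriftDiffusion

/-- A `C¹` function vanishing on a subset `S` of a ball is dominated by the Riesz potential of its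
gradient, with a constant that depends on the relative measure of `S` only. -/
theorem enorm_mul_volume_le_rieszPotential {d : ℕ} (hd : 1 ≤ d) {r : ℝ} (hr : 0 < r)
    {w : EuclideanSpace ℝ (Fin d) → ℝ} (hw : ContDiffOn ℝ 1 w (ball 0 r))
    {S : Set (EuclideanSpace ℝ (Fin d))} (hSr : S ⊆ ball 0 r) (hSm : MeasurableSet S)
    (hS : ∀ z ∈ S, w z = 0) {x : EuclideanSpace ℝ (Fin d)} (hx : x ∈ ball 0 r) :
    ‖w x‖ₑ * volume S ≤ ENNReal.ofReal ((2 * r) ^ d / d) *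
      ∫⁻ y in ball 0 r, ‖fderiv ℝ w y‖ₑ * ENNReal.ofReal (‖x - y‖ ^ (1 - (d : ℝ))) := by
  have hd0 : (0 : ℝ) < d := by exact_mod_cast hd
  set f : EuclideanSpace ℝ (Fin d) → ℝ≥0∞ := (ball 0 r).indicator fun y => ‖fderiv ℝ w y‖ₑ with hf
  have hfm : Measurable f := (measurable_fderiv ℝ w).enorm.indicator measurableSet_ball
  -- `P (t, ζ)` is the integrand at `z = x + ζ`.
  set P : ℝ → EuclideanSpace ℝ (Fin d) → ℝ≥0∞ := fun t ζ =>
    f (x + t • ζ) * (‖ζ‖ₑ * (Iio (2 * r)).indicator 1 ‖ζ‖) with hP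
  have hPm : Measurable (Function.uncurry P) := by
    have h1 : Measurable fun q : ℝ × EuclideanSpace ℝ (Fin d) => f (x + q.1 • q.2) :=
      hfm.comp (by fun_prop)
    have h2 : Measurable fun s : ℝ => (Iio (2 * r)).indicator (1 : ℝ → ℝ≥0∞) s :=
      measurable_one.indicator measurableSet_Iio
    have h3 : Measurable fun q : ℝ × EuclideanSpace ℝ (Fin d) =>
        (Iio (2 * r)).indicator (1 : ℝ → ℝ≥0∞) ‖q.2‖ := h2.comp (by fun_prop)
    exact h1.mul (measurable_snd.enorm.mul h3)
  have hpolar : ‖w x‖ₑ * volume S ≤ ∫⁻ ζ, ∫⁻ t in Ioo (0 : ℝ) 1, P t ζ := by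
    calc ‖w x‖ₑ * volume S = ∫⁻ z in S, ‖w x‖ₑ := by rw [setLIntegral_const]
      _ ≤ ∫⁻ z in S, ∫⁻ t in Ioo (0 : ℝ) 1, P t (z - x) := by
          refine setLIntegral_mono' hSm fun z hz => ?_
          have h := enorm_sub_le_lintegral_segment hw hx (hSr hz)
          rw [hS z hz, zero_sub, enorm_neg] at h
          refine h.trans (setLIntegral_mono' measurableSet_Ioo fun t ht => ?_)
          have hmem : x + t • (z - x) ∈ ball (0 : EuclideanSpace ℝ (Fin d)) r :=
            (convex_ball 0 r).add_smul_sub_mem hx (hSr hz) ⟨ht.1.le, ht.2.le⟩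
          have hlt : ‖z - x‖ < 2 * r := by
            have h1 := mem_ball_zero_iff.1 hx
            have h2 := mem_ball_zero_iff.1 (hSr hz)
            linarith [norm_sub_le z x]
          simp only [hP, hf, indicator_of_mem hmem, indicator_of_mem (mem_Iio.2 hlt), Pi.one_apply,
            mul_one]
          exact le_rfl
      _ ≤ ∫⁻ z, ∫⁻ t in Ioo (0 : ℝ) 1, P t (z - x) := setLIntegral_le_lintegral _ _
      _ = ∫⁻ ζ, ∫⁻ t in Ioo (0 : ℝ) 1, P t ζ :=
          lintegral_sub_right_eq_self (fun ζ => ∫⁻ t in Ioo (0 : ℝ) 1, P t ζ) x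
  -- The substitution `ξ = t ζ` at fixed `t`.
  have hsubst : ∀ t ∈ Ioo (0 : ℝ) 1, ∫⁻ ζ, P t ζ = ∫⁻ ξ, f (x + ξ) * ‖ξ‖ₑ *
      (Ioi (‖ξ‖ / (2 * r))).indicator (fun t => ENNReal.ofReal (t ^ (-(d : ℝ) - 1))) t := by
    intro t ht
    have ht0 : 0 < t := ht.1
    have h2 : Measurable fun s : ℝ => (Iio (2 * r)).indicator (1 : ℝ → ℝ≥0∞) s :=
      measurable_one.indicator measurableSet_Iio
    have h3 : Measurable fun ξ : EuclideanSpace ℝ (Fin d) =>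
        (Iio (2 * r)).indicator (1 : ℝ → ℝ≥0∞) ‖t⁻¹ • ξ‖ := h2.comp (by fun_prop)
    have h4 : Measurable fun ξ : EuclideanSpace ℝ (Fin d) => f (x + ξ) :=
      hfm.comp (by fun_prop)
    have hm : Measurable fun ξ : EuclideanSpace ℝ (Fin d) =>
        f (x + ξ) * (‖t⁻¹ • ξ‖ₑ * (Iio (2 * r)).indicator 1 ‖t⁻¹ • ξ‖) :=
      h4.mul ((by fun_prop : Measurable fun ξ : EuclideanSpace ℝ (Fin d) => ‖t⁻¹ • ξ‖ₑ).mul h3)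
    have h5 := lintegral_comp_smul ht0 hm
    have h6 : ∫⁻ ζ, P t ζ = ∫⁻ ζ, f (x + t • ζ) * (‖t⁻¹ • t • ζ‖ₑ *
        (Iio (2 * r)).indicator 1 ‖t⁻¹ • t • ζ‖) := by
      simp only [inv_smul_smul₀ ht0.ne', hP]
    rw [h6, h5, ← lintegral_const_mul _ hm]
    refine lintegral_congr fun ξ => ?_
    have hn : ‖t⁻¹ • ξ‖ = ‖ξ‖ / t := by
      rw [norm_smul, norm_inv, Real.norm_of_nonneg ht0.le, inv_mul_eq_div]
    have hiff : ‖ξ‖ / t < 2 * r ↔ ‖ξ‖ / (2 * r) < t := by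
      rw [div_lt_iff₀ ht0, div_lt_iff₀ (by positivity), mul_comm]
    have he : ‖t⁻¹ • ξ‖ₑ = ENNReal.ofReal t⁻¹ * ‖ξ‖ₑ := by
      rw [enorm_smul, Real.enorm_of_nonneg (by positivity)]
    rw [he]
    simp only [indicator, mem_Iio, mem_Ioi, hn, hiff, Pi.one_apply]
    split_ifs
    · have : t ^ (-(d : ℝ) - 1) = (t ^ d)⁻¹ * t⁻¹ := by
        rw [Real.rpow_sub ht0, Real.rpow_neg ht0.le, Real.rpow_natCast, Real.rpow_one,
          div_eq_mul_inv]
      rw [this, ENNReal.ofReal_mul (by positivity)]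
      ring
    · simp
  have hQm : Measurable fun q : ℝ × EuclideanSpace ℝ (Fin d) => f (x + q.2) * ‖q.2‖ₑ *
      (Ioi (‖q.2‖ / (2 * r))).indicator (fun t => ENNReal.ofReal (t ^ (-(d : ℝ) - 1))) q.1 := by
    have h1 : Measurable fun q : ℝ × EuclideanSpace ℝ (Fin d) => f (x + q.2) :=
      hfm.comp (by fun_prop)
    have h2 : Measurable fun q : ℝ × EuclideanSpace ℝ (Fin d) =>
        {q : ℝ × EuclideanSpace ℝ (Fin d) | ‖q.2‖ / (2 * r) < q.1}.indicator
          (fun q => ENNReal.ofReal (q.1 ^ (-(d : ℝ) - 1))) q :=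
      Measurable.indicator (by fun_prop) (measurableSet_lt (by fun_prop) (by fun_prop))
    exact (h1.mul measurable_snd.enorm).mul h2
  calc ‖w x‖ₑ * volume S ≤ ∫⁻ ζ, ∫⁻ t in Ioo (0 : ℝ) 1, P t ζ := hpolar
    _ = ∫⁻ t in Ioo (0 : ℝ) 1, ∫⁻ ζ, P t ζ := (lintegral_lintegral_swap hPm.aemeasurable).symm
    _ = ∫⁻ t in Ioo (0 : ℝ) 1, ∫⁻ ξ, f (x + ξ) * ‖ξ‖ₑ * (Ioi (‖ξ‖ / (2 * r))).indicator
          (fun t => ENNReal.ofReal (t ^ (-(d : ℝ) - 1))) t :=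
        setLIntegral_congr_fun measurableSet_Ioo hsubst
    _ = ∫⁻ ξ, ∫⁻ t in Ioo (0 : ℝ) 1, f (x + ξ) * ‖ξ‖ₑ * (Ioi (‖ξ‖ / (2 * r))).indicator
          (fun t => ENNReal.ofReal (t ^ (-(d : ℝ) - 1))) t :=
        lintegral_lintegral_swap hQm.aemeasurable
    _ ≤ ∫⁻ ξ, ENNReal.ofReal ((2 * r) ^ d / d) *
          (f (x + ξ) * ENNReal.ofReal (‖ξ‖ ^ (1 - (d : ℝ)))) := by
        refine lintegral_mono fun ξ => ?_
        rw [lintegral_const_mul _ (Measurable.indicator (by fun_prop) measurableSet_Ioi)]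
        rcases eq_or_ne ξ 0 with h0 | h0
        · simp [h0]
        have hn : 0 < ‖ξ‖ := norm_pos_iff.2 h0
        refine (mul_le_mul_right (lintegral_Ioo_indicator_rpow_le hd
          (by positivity : 0 < ‖ξ‖ / (2 * r))) _).trans (le_of_eq ?_)
        rw [← ofReal_norm, mul_assoc, ← ENNReal.ofReal_mul hn.le, mul_left_comm,
          ← ENNReal.ofReal_mul (by positivity)]
        congr 2
        rw [Real.div_rpow hn.le (by positivity), Real.rpow_neg (by positivity : 0 ≤ 2 * r),
          Real.rpow_natCast, Real.rpow_sub hn, Real.rpow_neg hn.le, Real.rpow_one]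
        field_simp
    _ = ENNReal.ofReal ((2 * r) ^ d / d) * ∫⁻ y, f y * ENNReal.ofReal (‖x - y‖ ^ (1 - (d : ℝ))) := by
        rw [lintegral_const_mul]
        · congr 1
          rw [← lintegral_add_left_eq_self
            (fun y => f y * ENNReal.ofReal (‖x - y‖ ^ (1 - (d : ℝ)))) x]
          refine lintegral_congr fun ξ => ?_
          rw [sub_add_cancel_left, norm_neg]
        · exact (hfm.comp (by fun_prop : Measurable fun ξ : EuclideanSpace ℝ (Fin d) => x + ξ)).mul
            (by fun_prop)
    _ = _ := by
        congr 1
        rw [← lintegral_indicator measurableSet_ball]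
        refine lintegral_congr fun y => ?_
        simp only [hf, indicator]
        split_ifs <;> simp

end DriftDiffusion

/-! ### The weighted Poincaré inequality -/

namespace DriftDiffusion

/-- Exponents splitting the Riesz kernel `|x - y| ^ (1 - d)` for the Cauchy-Schwarz inequality. -/
theorem exists_kernel_exponents {d : ℕ} (hd : 1 ≤ d) {q : ℝ} (hdq : d < q) (h2q : 2 < q) :
    ∃ a b : ℝ, 0 ≤ a ∧ a < d ∧ 0 ≤ b ∧ b * (q / (q - 2)) < d ∧ a + b = 2 * d - 2 := by
  have hq0 : 0 < q := by linarith
  have hq2 : 0 < q - 2 := by linarith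
  rcases eq_or_lt_of_le hd with h1 | h1
  · refine ⟨0, 0, le_rfl, ?_, le_rfl, ?_, ?_⟩ <;> simp [← h1]
  have hd2 : (2 : ℝ) ≤ d := by exact_mod_cast h1
  have hdq' : (d : ℝ) / q < 1 := by rw [div_lt_one hq0]; exact hdq
  have hdq0 : 0 < (d : ℝ) / q := by positivity
  refine ⟨d - 1 + d / q, d - 1 - d / q, by linarith, by linarith, by linarith, ?_, by ring⟩
  rw [← mul_div_assoc, div_lt_iff₀ hq2]
  have : ((d : ℝ) - 1 - d / q) * q = d * q - q - d := by field_simp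
  rw [this]; linarith

theorem ofReal_norm_rpow_le_mul {d : ℕ} (hd : 1 ≤ d) {a b : ℝ} (hab : a + b = 2 * d - 2)
    (ha : 0 ≤ a) (hb : 0 ≤ b) (x : EuclideanSpace ℝ (Fin d)) :
    ENNReal.ofReal (‖x‖ ^ (1 - (d : ℝ))) ≤
      ENNReal.ofReal (‖x‖ ^ (-(a / 2))) * ENNReal.ofReal (‖x‖ ^ (-(b / 2))) := by
  rw [← ENNReal.ofReal_mul (by positivity)]
  refine ENNReal.ofReal_le_ofReal ?_
  have he : -(a / 2) + -(b / 2) = 1 - (d : ℝ) := by linarith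
  rcases eq_or_lt_of_le (norm_nonneg x) with h | h
  · rw [← h]
    rcases eq_or_lt_of_le hd with h1 | h1
    · have hd1 : (d : ℝ) = 1 := by exact_mod_cast h1.symm
      have ha0 : a = 0 := by linarith
      have hb0 : b = 0 := by linarith
      simp [hd1, ha0, hb0]
    · have : (1 : ℝ) < d := by exact_mod_cast h1
      rw [Real.zero_rpow (by linarith : 1 - (d : ℝ) ≠ 0)]
      positivity
  · rw [← Real.rpow_add h, he]

theorem ofReal_rpow_rpow {s γ c : ℝ} (hs : 0 ≤ s) (hc : 0 ≤ c) :
    ENNReal.ofReal (s ^ (-γ)) ^ c = ENNReal.ofReal (s ^ (-(γ * c))) := by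
  rw [ENNReal.ofReal_rpow_of_nonneg (by positivity) hc, ← Real.rpow_mul hs, neg_mul]

/-- A weighted Poincaré inequality: for nonnegative functions whose support `Z` fills at most half of
a ball, the square norm with a weight in `L ^ q`, `q > d`, is controlled by the gradient, with a gain
of a power of the measure of `Z` and a constant independent of the ball. -/
theorem exists_weighted_poincare {d : ℕ} (hd : 1 ≤ d) {q : ℝ} (hdq : d < q) (h2q : 2 < q) :
    ∃ C : ℝ≥0, ∀ (r : ℝ) (w : EuclideanSpace ℝ (Fin d) → ℝ) (Z : Set (EuclideanSpace ℝ (Fin d)))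
      (g : EuclideanSpace ℝ (Fin d) → ℝ≥0∞), 0 < r → ContDiffOn ℝ 1 w (ball 0 r) →
      (∀ x ∈ ball 0 r, 0 ≤ w x) → MeasurableSet Z → Z ⊆ ball 0 r →
      (∀ x ∈ ball 0 r, x ∉ Z → w x = 0) →
      2 * volume Z ≤ volume (ball (0 : EuclideanSpace ℝ (Fin d)) r) → Measurable g →
      ∫⁻ x in Z, ‖w x‖ₑ ^ (2 : ℝ) * g x ^ (2 : ℝ) ≤
        C * volume Z ^ (2 / d - 2 / q) * (∫⁻ x in Z, g x ^ q) ^ (2 / q) *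
          ∫⁻ x in ball 0 r, ‖fderiv ℝ w x‖ₑ ^ (2 : ℝ) := by
  obtain ⟨a, b, ha0, had, hb0, hbd, hab⟩ := exists_kernel_exponents hd hdq h2q
  have hd0 : (0 : ℝ) < d := by exact_mod_cast hd
  have hq0 : 0 < q := by linarith
  have hq2 : 0 < q - 2 := by linarith
  set b' := b * (q / (q - 2)) with hb'
  have hb'0 : 0 ≤ b' := by positivity
  obtain ⟨Ca, hCa0, hCa⟩ := exists_lintegral_norm_sub_rpow_le hd ha0 had
  obtain ⟨Cb, hCb0, hCb⟩ := exists_lintegral_norm_sub_rpow_le hd hb'0 hbd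
  set κ := volume (ball (0 : EuclideanSpace ℝ (Fin d)) 1) with hκ
  have hκ0 : κ ≠ 0 := (measure_ball_pos _ _ one_pos).ne'
  have hκt : κ ≠ ⊤ := measure_ball_lt_top.ne
  set C₁ : ℝ≥0∞ := ENNReal.ofReal (2 ^ d / d) / (κ / 2) with hC₁
  have hκ20 : κ / 2 ≠ 0 := ENNReal.div_ne_zero.2 ⟨hκ0, by simp⟩
  have hκ2t : κ / 2 ≠ ⊤ := ENNReal.div_ne_top hκt (by simp)
  have hC₁t : C₁ ≠ ⊤ := ENNReal.div_ne_top ENNReal.ofReal_ne_top hκ20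
  set C : ℝ≥0∞ := C₁ ^ (2 : ℝ) * Ca * Cb ^ (1 - 2 / q) with hC
  have hexq : 0 ≤ 1 - 2 / q := by
    rw [sub_nonneg, div_le_one hq0]; exact h2q.le
  have hCt : C ≠ ⊤ := by
    refine ENNReal.mul_ne_top (ENNReal.mul_ne_top ?_ (by simp)) ?_
    · exact ENNReal.rpow_ne_top_of_nonneg (by norm_num) hC₁t
    · exact ENNReal.rpow_ne_top_of_nonneg hexq (by simp)
  refine ⟨C.toNNReal, fun r w Z g hr hw hwn hZm hZr hwZ hZ hg => ?_⟩
  rw [ENNReal.coe_toNNReal hCt]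
  have hZt : volume Z ≠ ⊤ := ((measure_mono hZr).trans_lt measure_ball_lt_top).ne
  set f : EuclideanSpace ℝ (Fin d) → ℝ≥0∞ := fun y => ‖fderiv ℝ w y‖ₑ with hf
  have hfm : Measurable f := (measurable_fderiv ℝ w).enorm
  -- The gradient vanishes where the nonnegative function `w` does.
  have hfz : ∀ x ∈ ball (0 : EuclideanSpace ℝ (Fin d)) r, x ∉ Z → f x = 0 := by
    intro x hx hxZ
    have : IsLocalMin w x := by
      filter_upwards [isOpen_ball.mem_nhds hx] with y hy
      rw [hwZ x hx hxZ]; exact hwn y hy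
    change ‖fderiv ℝ w x‖ₑ = 0
    rw [← ofReal_norm, this.fderiv_eq_zero, norm_zero, ENNReal.ofReal_zero]
  -- `w` vanishes on at least half of the ball, so the powers of `r` in the Riesz potential bound
  -- cancel.
  have hpt : ∀ x ∈ ball (0 : EuclideanSpace ℝ (Fin d)) r, ‖w x‖ₑ ≤ C₁ *
      ∫⁻ y in Z, f y * ENNReal.ofReal (‖x - y‖ ^ (1 - (d : ℝ))) := by
    intro x hx
    have h1 := enorm_mul_volume_le_rieszPotential hd hr hw (S := ball 0 r \ Z) sdiff_subset
      (measurableSet_ball.diff hZm) (fun z hz => hwZ z hz.1 hz.2) hx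
    have h2 : ∫⁻ y in ball 0 r, f y * ENNReal.ofReal (‖x - y‖ ^ (1 - (d : ℝ))) =
        ∫⁻ y in Z, f y * ENNReal.ofReal (‖x - y‖ ^ (1 - (d : ℝ))) := by
      rw [← lintegral_indicator measurableSet_ball, ← lintegral_indicator hZm]
      refine lintegral_congr fun y => ?_
      by_cases hy : y ∈ Z
      · rw [indicator_of_mem hy, indicator_of_mem (hZr hy)]
      · rw [indicator_of_notMem hy]
        by_cases hyb : y ∈ ball (0 : EuclideanSpace ℝ (Fin d)) r
        · rw [indicator_of_mem hyb, hfz y hyb hy, zero_mul]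
        · rw [indicator_of_notMem hyb]
    rw [h2] at h1
    set I := ∫⁻ y in Z, f y * ENNReal.ofReal (‖x - y‖ ^ (1 - (d : ℝ)))
    have h3 : volume (ball (0 : EuclideanSpace ℝ (Fin d)) r) = ENNReal.ofReal (r ^ d) * κ := by
      rw [Measure.addHaar_ball_of_pos _ _ hr, finrank_euclideanSpace_fin]
    have h4 : ENNReal.ofReal (r ^ d) * (κ / 2) ≤ volume (ball (0 : EuclideanSpace ℝ (Fin d)) r \ Z) := by
      rw [measure_sdiff hZr hZm.nullMeasurableSet hZt, ← mul_div_assoc, ← h3]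
      refine ENNReal.le_sub_of_add_le_right hZt ?_
      have : volume Z ≤ volume (ball (0 : EuclideanSpace ℝ (Fin d)) r) / 2 := by
        rw [ENNReal.le_div_iff_mul_le (by simp) (by simp), mul_comm]; exact hZ
      calc _ ≤ volume (ball (0 : EuclideanSpace ℝ (Fin d)) r) / 2 +
            volume (ball (0 : EuclideanSpace ℝ (Fin d)) r) / 2 := by gcongr
        _ = _ := ENNReal.add_halves _
    have hrd0 : ENNReal.ofReal (r ^ d) ≠ 0 := by
      rw [Ne, ENNReal.ofReal_eq_zero, not_le]; positivity
    have h5 : ENNReal.ofReal (r ^ d) * (‖w x‖ₑ * (κ / 2)) ≤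
        ENNReal.ofReal (r ^ d) * (ENNReal.ofReal (2 ^ d / d) * I) := by
      calc _ = ‖w x‖ₑ * (ENNReal.ofReal (r ^ d) * (κ / 2)) := by ring
        _ ≤ _ := by gcongr
        _ ≤ _ := h1
        _ = _ := by
          rw [← mul_assoc, ← ENNReal.ofReal_mul (by positivity), mul_pow]
          congr 2; ring
    have h6 := (ENNReal.mul_le_mul_iff_right hrd0 ENNReal.ofReal_ne_top).1 h5
    rw [hC₁, ENNReal.mul_comm_div, ← mul_div_assoc, ENNReal.le_div_iff_mul_le (Or.inl hκ20) (Or.inl hκ2t)]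
    exact h6
  have hkm : ∀ (x : EuclideanSpace ℝ (Fin d)) (c : ℝ),
      Measurable fun y => ENNReal.ofReal (‖x - y‖ ^ c) := fun x c => by fun_prop
  -- Cauchy-Schwarz, with the kernel split into its powers `a / 2` and `b / 2`.
  have hsq : ∀ x ∈ ball (0 : EuclideanSpace ℝ (Fin d)) r, ‖w x‖ₑ ^ (2 : ℝ) ≤
      C₁ ^ (2 : ℝ) * Ca * volume Z ^ (1 - a / d) *
        ∫⁻ y in Z, f y ^ (2 : ℝ) * ENNReal.ofReal (‖x - y‖ ^ (-b)) := by
    intro x hx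
    have h1 : ∫⁻ y in Z, f y * ENNReal.ofReal (‖x - y‖ ^ (1 - (d : ℝ))) ≤
        (∫⁻ y in Z, ENNReal.ofReal (‖x - y‖ ^ (-a))) ^ (1 / (2 : ℝ)) *
        (∫⁻ y in Z, f y ^ (2 : ℝ) * ENNReal.ofReal (‖x - y‖ ^ (-b))) ^ (1 / (2 : ℝ)) := by
      have h := ENNReal.lintegral_mul_le_Lp_mul_Lq (volume.restrict Z) Real.HolderConjugate.two_two
        (f := fun y => ENNReal.ofReal (‖x - y‖ ^ (-(a / 2))))
        (g := fun y => f y * ENNReal.ofReal (‖x - y‖ ^ (-(b / 2))))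
        (hkm x _).aemeasurable (hfm.mul (hkm x _)).aemeasurable
      refine (lintegral_mono fun y => ?_).trans (h.trans (le_of_eq ?_))
      · simp only [Pi.mul_apply]
        calc _ ≤ f y * (ENNReal.ofReal (‖x - y‖ ^ (-(a / 2))) *
              ENNReal.ofReal (‖x - y‖ ^ (-(b / 2)))) := by
              gcongr; exact ofReal_norm_rpow_le_mul hd hab ha0 hb0 _
          _ = _ := by ring
      · simp only [ENNReal.mul_rpow_of_nonneg _ _ (zero_le_two : (0 : ℝ) ≤ 2),
          ofReal_rpow_rpow (norm_nonneg _) (zero_le_two : (0 : ℝ) ≤ 2),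
          div_mul_cancel₀ _ (two_ne_zero : (2 : ℝ) ≠ 0)]
    have h2 : ∀ A : ℝ≥0∞, (A ^ (1 / (2 : ℝ))) ^ (2 : ℝ) = A := fun A => by
      rw [← ENNReal.rpow_mul]; norm_num
    calc ‖w x‖ₑ ^ (2 : ℝ) ≤ (C₁ * ((∫⁻ y in Z, ENNReal.ofReal (‖x - y‖ ^ (-a))) ^ (1 / (2 : ℝ)) *
        (∫⁻ y in Z, f y ^ (2 : ℝ) * ENNReal.ofReal (‖x - y‖ ^ (-b))) ^ (1 / (2 : ℝ)))) ^ (2 : ℝ) := by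
          refine ENNReal.rpow_le_rpow ((hpt x hx).trans ?_) zero_le_two
          gcongr
      _ = C₁ ^ (2 : ℝ) * ((∫⁻ y in Z, ENNReal.ofReal (‖x - y‖ ^ (-a))) *
        (∫⁻ y in Z, f y ^ (2 : ℝ) * ENNReal.ofReal (‖x - y‖ ^ (-b)))) := by
          rw [ENNReal.mul_rpow_of_nonneg _ _ zero_le_two, ENNReal.mul_rpow_of_nonneg _ _ zero_le_two,
            h2, h2]
      _ ≤ C₁ ^ (2 : ℝ) * ((Ca * volume Z ^ (1 - a / d)) *
        (∫⁻ y in Z, f y ^ (2 : ℝ) * ENNReal.ofReal (‖x - y‖ ^ (-b)))) := by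
          gcongr; exact hCa Z x
      _ = _ := by ring
  set N := (∫⁻ x in Z, g x ^ q) ^ (2 / q) with hN
  -- Hölder's inequality for the integral in `x` that is left after interchanging the integrals.
  have hin : ∀ y, ∫⁻ x in Z, g x ^ (2 : ℝ) * ENNReal.ofReal (‖x - y‖ ^ (-b)) ≤
      N * (Cb ^ (1 - 2 / q) * volume Z ^ (1 - 2 / q - b / d)) := by
    intro y
    have hconj : (q / 2).HolderConjugate (q / (q - 2)) := by
      rw [Real.holderConjugate_iff]
      refine ⟨by linarith, ?_⟩
      field_simp; ring
    have h := ENNReal.lintegral_mul_le_Lp_mul_Lq (volume.restrict Z) hconj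
        (f := fun x => g x ^ (2 : ℝ))
        (g := fun x => ENNReal.ofReal (‖x - y‖ ^ (-b)))
        (hg.pow_const _).aemeasurable (by fun_prop)
    refine h.trans ?_
    have e1 : ∀ x, (g x ^ (2 : ℝ)) ^ (q / 2) = g x ^ q := fun x => by
      rw [← ENNReal.rpow_mul]; congr 1; ring
    have e2 : ∀ x : EuclideanSpace ℝ (Fin d), ENNReal.ofReal (‖x - y‖ ^ (-b)) ^ (q / (q - 2)) =
        ENNReal.ofReal (‖y - x‖ ^ (-b')) := fun x => by
      rw [ofReal_rpow_rpow (norm_nonneg _) (by positivity), norm_sub_rev]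
    have e3 : 1 / (q / 2) = 2 / q := by field_simp
    have e4 : 1 / (q / (q - 2)) = 1 - 2 / q := by field_simp
    simp only [e1, e2, e3, e4]
    gcongr
    refine (ENNReal.rpow_le_rpow (hCb Z y) hexq).trans (le_of_eq ?_)
    rw [ENNReal.mul_rpow_of_nonneg _ _ hexq, ← ENNReal.rpow_mul]
    congr 2
    rw [hb']; field_simp
  have hmono : ∫⁻ y in Z, f y ^ (2 : ℝ) ≤ ∫⁻ y in ball 0 r, f y ^ (2 : ℝ) :=
    lintegral_mono_set hZr
  calc ∫⁻ x in Z, ‖w x‖ₑ ^ (2 : ℝ) * g x ^ (2 : ℝ)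
      ≤ ∫⁻ x in Z, C₁ ^ (2 : ℝ) * Ca * volume Z ^ (1 - a / d) *
        ∫⁻ y in Z, g x ^ (2 : ℝ) * f y ^ (2 : ℝ) * ENNReal.ofReal (‖x - y‖ ^ (-b)) := by
        refine setLIntegral_mono' hZm fun x hx => ?_
        calc _ ≤ C₁ ^ (2 : ℝ) * Ca * volume Z ^ (1 - a / d) *
            (∫⁻ y in Z, f y ^ (2 : ℝ) * ENNReal.ofReal (‖x - y‖ ^ (-b))) * g x ^ (2 : ℝ) := by
              gcongr; exact hsq x (hZr hx)
          _ = _ := by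
              rw [mul_assoc, mul_comm _ (g x ^ (2 : ℝ)), ← lintegral_const_mul]
              · simp only [mul_assoc]
              · exact (hfm.pow_const _).mul (hkm x _)
    _ = C₁ ^ (2 : ℝ) * Ca * volume Z ^ (1 - a / d) * ∫⁻ x in Z,
        ∫⁻ y in Z, g x ^ (2 : ℝ) * f y ^ (2 : ℝ) * ENNReal.ofReal (‖x - y‖ ^ (-b)) := by
        rw [lintegral_const_mul]
        refine Measurable.lintegral_prod_right (f := fun x y =>
          g x ^ (2 : ℝ) * f y ^ (2 : ℝ) * ENNReal.ofReal (‖x - y‖ ^ (-b))) ?_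
        unfold Function.uncurry
        fun_prop
    _ = C₁ ^ (2 : ℝ) * Ca * volume Z ^ (1 - a / d) * ∫⁻ y in Z,
        ∫⁻ x in Z, g x ^ (2 : ℝ) * f y ^ (2 : ℝ) * ENNReal.ofReal (‖x - y‖ ^ (-b)) := by
        rw [lintegral_lintegral_swap]
        refine Measurable.aemeasurable ?_
        unfold Function.uncurry
        fun_prop
    _ = C₁ ^ (2 : ℝ) * Ca * volume Z ^ (1 - a / d) * ∫⁻ y in Z, f y ^ (2 : ℝ) *
        ∫⁻ x in Z, g x ^ (2 : ℝ) * ENNReal.ofReal (‖x - y‖ ^ (-b)) := by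
        congr 1
        refine lintegral_congr fun y => ?_
        rw [← lintegral_const_mul]
        · refine lintegral_congr fun x => ?_
          ring
        · fun_prop
    _ ≤ C₁ ^ (2 : ℝ) * Ca * volume Z ^ (1 - a / d) * ∫⁻ y in Z, f y ^ (2 : ℝ) *
        (N * (Cb ^ (1 - 2 / q) * volume Z ^ (1 - 2 / q - b / d))) := by
        gcongr with y
        exact hin y
    _ = C₁ ^ (2 : ℝ) * Ca * volume Z ^ (1 - a / d) * ((∫⁻ y in Z, f y ^ (2 : ℝ)) *
        (N * (Cb ^ (1 - 2 / q) * volume Z ^ (1 - 2 / q - b / d)))) := by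
        rw [lintegral_mul_const _ (hfm.pow_const _)]
    _ = C * (volume Z ^ (1 - a / d) * volume Z ^ (1 - 2 / q - b / d)) * N *
        ∫⁻ y in Z, f y ^ (2 : ℝ) := by rw [hC]; ring
    _ = C * volume Z ^ (2 / d - 2 / q) * N * ∫⁻ y in Z, f y ^ (2 : ℝ) := by
        rw [← ENNReal.rpow_add_of_nonneg]
        · congr 4
          rw [show a = 2 * d - 2 - b by linarith]
          field_simp
          ring
        · rw [sub_nonneg, div_le_one hd0]; exact had.le
        · have h1 : b * q < d * (q - 2) := by
            rw [hb', ← mul_div_assoc, div_lt_iff₀ hq2] at hbd; exact hbd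
          have h2 : 1 - 2 / q - b / d = (d * (q - 2) - b * q) / (q * d) := by
            field_simp
          rw [h2]
          exact div_nonneg (by linarith) (by positivity)
    _ ≤ _ := by gcongr

end DriftDiffusion

/-! ### The logarithmic pressure and its shifts -/

namespace DriftDiffusion

open Real (exp log)

/-- The pressure `∫ φ_ε'(s) / s ds = m / (m - 1) * s ^ (m - 1) + ε log s` of the regularized
nonlinearity, as a function of `y = log s`. -/
noncomputable def logPressure (m ε y : ℝ) : ℝ := m / (m - 1) * exp ((m - 1) * y) + ε * y

/-- The derivative of `logPressure`; it equals `φ_ε'(exp y)`. -/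
noncomputable def logPressureDeriv (m ε y : ℝ) : ℝ := m * exp ((m - 1) * y) + ε

/-- The inverse of `logPressure`. -/
noncomputable def logPressureInv (m ε : ℝ) : ℝ → ℝ := Function.invFun (logPressure m ε)

variable {m ε Ω κ α : ℝ}

theorem hasDerivAt_logPressure (hm : 1 < m) (y : ℝ) :
    HasDerivAt (logPressure m ε) (logPressureDeriv m ε y) y := by
  have h1 : HasDerivAt (fun y : ℝ => (m - 1) * y) (m - 1) y := by
    simpa using (hasDerivAt_id y).const_mul (m - 1)
  have h2 := (h1.exp.const_mul (m / (m - 1))).add ((hasDerivAt_id y).const_mul ε)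
  refine HasDerivAt.congr_deriv h2 ?_
  have : m - 1 ≠ 0 := by linarith
  rw [logPressureDeriv]; field_simp

theorem contDiff_logPressure : ContDiff ℝ ∞ (logPressure m ε) := by
  unfold logPressure; fun_prop

theorem logPressureDeriv_pos (hm : 1 < m) (hε : 0 < ε) (y : ℝ) : 0 < logPressureDeriv m ε y := by
  have : 0 < m := by linarith
  unfold logPressureDeriv; positivity

theorem logPressureDeriv_mul_sub_le (hm : 1 < m) (a b : ℝ) :
    logPressureDeriv m ε a * (b - a) ≤ logPressure m ε b - logPressure m ε a := by
  have h := Real.add_one_le_exp ((m - 1) * (b - a))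
  have hm1 : 0 < m - 1 := by linarith
  have e : exp ((m - 1) * b) = exp ((m - 1) * a) * exp ((m - 1) * (b - a)) := by
    rw [← Real.exp_add]; ring_nf
  unfold logPressureDeriv logPressure
  have h2 : exp ((m - 1) * a) * ((m - 1) * (b - a)) ≤ exp ((m - 1) * b) - exp ((m - 1) * a) := by
    rw [e]; nlinarith [Real.exp_pos ((m - 1) * a)]
  have h3 : m / (m - 1) * (exp ((m - 1) * a) * ((m - 1) * (b - a))) ≤
      m / (m - 1) * (exp ((m - 1) * b) - exp ((m - 1) * a)) := by gcongr
  have h4 : m / (m - 1) * (exp ((m - 1) * a) * ((m - 1) * (b - a))) =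
      m * exp ((m - 1) * a) * (b - a) := by field_simp
  linarith

theorem strictMono_logPressure (hm : 1 < m) (hε : 0 < ε) : StrictMono (logPressure m ε) := by
  intro a b h
  have h1 := logPressureDeriv_mul_sub_le (ε := ε) hm a b
  have h2 := mul_pos (logPressureDeriv_pos hm hε a) (sub_pos.2 h)
  linarith

theorem surjective_logPressure (hm : 1 < m) (hε : 0 < ε) :
    Function.Surjective (logPressure m ε) := by
  have hm1 : 0 < m - 1 := by linarith
  refine contDiff_logPressure.continuous.surjective ?_ ?_
  · refine tendsto_atTop_mono (fun y => ?_) (tendsto_id.const_mul_atTop hε)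
    unfold logPressure
    have : 0 < m / (m - 1) * exp ((m - 1) * y) := by positivity
    simp only [id]; linarith
  · have h1 : Tendsto (fun y => m / (m - 1) + ε * y) atBot atBot :=
      tendsto_atBot_add_const_left _ _ (tendsto_id.const_mul_atBot hε)
    refine tendsto_atBot_mono' _ ?_ h1
    filter_upwards [eventually_le_atBot 0] with y hy
    unfold logPressure
    have : exp ((m - 1) * y) ≤ 1 := Real.exp_le_one_iff.2 (by nlinarith)
    have h2 : m / (m - 1) * exp ((m - 1) * y) ≤ m / (m - 1) * 1 := by gcongr
    linarith

theorem logPressure_logPressureInv (hm : 1 < m) (hε : 0 < ε) (z : ℝ) :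
    logPressure m ε (logPressureInv m ε z) = z :=
  Function.rightInverse_invFun (surjective_logPressure hm hε) z

theorem logPressureInv_logPressure (hm : 1 < m) (hε : 0 < ε) (y : ℝ) :
    logPressureInv m ε (logPressure m ε y) = y :=
  Function.leftInverse_invFun (strictMono_logPressure hm hε).injective y

theorem contDiff_logPressureInv (hm : 1 < m) (hε : 0 < ε) :
    ContDiff ℝ ∞ (logPressureInv m ε) := by
  let e : ℝ ≃ₜ ℝ := ((strictMono_logPressure hm hε).orderIsoOfSurjective _
    (surjective_logPressure hm hε)).toHomeomorph
  have he : ∀ y, e y = logPressure m ε y := fun y => rfl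
  have h := e.contDiff_symm_deriv (n := ∞) (f' := logPressureDeriv m ε)
    (fun y => (logPressureDeriv_pos hm hε y).ne') (fun y => hasDerivAt_logPressure hm y)
    contDiff_logPressure
  have h2 : logPressureInv m ε = e.symm := by
    funext z
    have := e.apply_symm_apply z
    rw [he] at this
    conv_lhs => rw [← this]
    exact logPressureInv_logPressure hm hε _
  rw [h2]; exact h

theorem hasDerivAt_logPressureInv (hm : 1 < m) (hε : 0 < ε) (z : ℝ) :
    HasDerivAt (logPressureInv m ε) (logPressureDeriv m ε (logPressureInv m ε z))⁻¹ z :=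
  HasDerivAt.of_local_left_inverse (contDiff_logPressureInv hm hε).continuous.continuousAt
    (hasDerivAt_logPressure hm _) (logPressureDeriv_pos hm hε _).ne'
    (Eventually.of_forall (logPressure_logPressureInv hm hε))

theorem strictMono_logPressureInv (hm : 1 < m) (hε : 0 < ε) : StrictMono (logPressureInv m ε) := by
  intro a b h
  by_contra hc
  have := (strictMono_logPressure hm hε).monotone (not_lt.1 hc)
  rw [logPressure_logPressureInv hm hε, logPressure_logPressureInv hm hε] at this
  linarith

/-- The logarithm of the density whose pressure exceeds by `c` that of `exp y`. -/
noncomputable def logShift (m ε c y : ℝ) : ℝ := logPressureInv m ε (logPressure m ε y + c)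

theorem logPressure_logShift (hm : 1 < m) (hε : 0 < ε) (c y : ℝ) :
    logPressure m ε (logShift m ε c y) = logPressure m ε y + c :=
  logPressure_logPressureInv hm hε _

theorem logShift_logShift_neg (hm : 1 < m) (hε : 0 < ε) (c y : ℝ) :
    logShift m ε c (logShift m ε (-c) y) = y := by
  rw [logShift, logPressure_logShift hm hε, neg_add_cancel_right, logPressureInv_logPressure hm hε]

theorem strictMono_logShift (hm : 1 < m) (hε : 0 < ε) (c : ℝ) : StrictMono (logShift m ε c) :=
  fun _ _ h => strictMono_logPressureInv hm hε
    (by simpa using strictMono_logPressure hm hε h)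

theorem sub_le_logPressure_sub (hm : 1 < m) (hε : 0 < ε) {a b : ℝ} (ha : 0 ≤ a) (hab : a ≤ b) :
    b - a ≤ logPressure m ε b - logPressure m ε a := by
  refine le_trans ?_ (logPressureDeriv_mul_sub_le hm a b)
  refine le_mul_of_one_le_left (by linarith) ?_
  have : 1 ≤ exp ((m - 1) * a) := Real.one_le_exp (mul_nonneg (by linarith) ha)
  unfold logPressureDeriv
  nlinarith

/-- The derivative of the pressure is at least one at nonnegative logarithms, whatever `ε`; a shift
of the pressure therefore moves these logarithms by no more than its own size. -/
theorem lt_logShift_of_add_lt (hm : 1 < m) (hε : 0 < ε) {c y : ℝ} (hc : |c| ≤ Ω) (hκ : 0 ≤ κ)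
    (h : κ + Ω < y) : κ < logShift m ε c y := by
  have hΩ : 0 ≤ Ω := (abs_nonneg c).trans hc
  have h1 := sub_le_logPressure_sub hm hε hκ (by linarith : κ ≤ y)
  refine (strictMono_logPressure hm hε).lt_iff_lt.1 ?_
  rw [logPressure_logShift hm hε]
  linarith [(abs_le.1 hc).1]

/-- Above the level `Ω`, a shift of the pressure by at most `Ω` moves the logarithm by at most
`Ω`, whatever `ε`. -/
theorem abs_logShift_sub_le (hm : 1 < m) (hε : 0 < ε) {c y : ℝ} (hc : |c| ≤ Ω)
    (h : Ω ≤ logShift m ε c y) : |logShift m ε c y - y| ≤ Ω := by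
  have hΩ : 0 ≤ Ω := (abs_nonneg c).trans hc
  rw [abs_le]
  constructor
  · by_contra hcon
    push Not at hcon
    exact lt_irrefl _ (lt_logShift_of_add_lt hm hε hc (hΩ.trans h) (by linarith))
  · by_contra hcon
    push Not at hcon
    have h1 := sub_le_logPressure_sub hm hε (by linarith : 0 ≤ logShift m ε c y - Ω)
      (by linarith : logShift m ε c y - Ω ≤ logShift m ε c y)
    have h2 := strictMono_logPressure hm hε (by linarith : y < logShift m ε c y - Ω)
    rw [logPressure_logShift hm hε] at h1
    linarith [(abs_le.1 hc).2]

theorem logPressureDeriv_le_exp_mul (hm : 1 < m) (hε : 0 < ε) {a b δ : ℝ} (hδ : 0 ≤ δ)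
    (h : b - a ≤ δ) :
    logPressureDeriv m ε b ≤ exp ((m - 1) * δ) * logPressureDeriv m ε a := by
  have hm1 : 0 < m - 1 := by linarith
  have h1 : exp ((m - 1) * b) ≤ exp ((m - 1) * δ) * exp ((m - 1) * a) := by
    rw [← Real.exp_add, ← mul_add]; gcongr; linarith
  have h2 : 1 ≤ exp ((m - 1) * δ) := Real.one_le_exp (by positivity)
  unfold logPressureDeriv
  nlinarith

/-- Two pairs of nearby logarithms with equal pressure differences have comparable differences. -/
theorem sub_le_exp_mul_sub (hm : 1 < m) (hε : 0 < ε) {a₁ a₂ b₁ b₂ δ : ℝ}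
    (hb : b₁ ≤ b₂) (hδ : 0 ≤ δ) (h : b₂ - a₁ ≤ δ)
    (he : logPressure m ε a₂ - logPressure m ε a₁ = logPressure m ε b₂ - logPressure m ε b₁) :
    a₂ - a₁ ≤ exp ((m - 1) * δ) * (b₂ - b₁) := by
  have h1 := logPressureDeriv_mul_sub_le (ε := ε) hm a₁ a₂
  have h2 := logPressureDeriv_mul_sub_le (ε := ε) hm b₂ b₁
  have h3 := logPressureDeriv_le_exp_mul hm hε hδ h
  have h4 := logPressureDeriv_pos hm hε a₁
  have h5 : logPressureDeriv m ε a₁ * (a₂ - a₁) ≤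
      logPressureDeriv m ε a₁ * (exp ((m - 1) * δ) * (b₂ - b₁)) := by
    have := mul_le_mul_of_nonneg_right h3 (sub_nonneg.2 hb)
    nlinarith
  exact le_of_mul_le_mul_left h5 h4

/-! ### Truncations in the shifted logarithm -/

theorem hasDerivAt_max_zero_pow (n : ℕ) (x : ℝ) :
    HasDerivAt (fun x : ℝ => max x 0 ^ (n + 2)) ((n + 2) * max x 0 ^ (n + 1)) x := by
  rcases lt_trichotomy x 0 with h | h | h
  · have : (fun x : ℝ => max x 0 ^ (n + 2)) =ᶠ[𝓝 x] fun _ => 0 := by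
      filter_upwards [gt_mem_nhds h] with y hy
      rw [max_eq_right hy.le, zero_pow (by omega)]
    rw [max_eq_right h.le, zero_pow (by omega), mul_zero]
    exact (hasDerivAt_const x (0 : ℝ)).congr_of_eventuallyEq this
  · subst h
    rw [max_self, zero_pow (by omega), mul_zero]
    have h1 : HasDerivAt (fun x : ℝ => x ^ (n + 2)) 0 0 := by
      have := hasDerivAt_pow (n + 2) (0 : ℝ)
      simpa using this
    rw [hasDerivAt_iff_isLittleO_nhds_zero] at h1 ⊢
    simp only [zero_add, max_self, smul_zero, sub_zero, ne_eq, Nat.add_eq_zero_iff, OfNat.ofNat_ne_zero,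
      and_false, not_false_eq_true, zero_pow] at h1 ⊢
    refine (Asymptotics.IsBigO.of_bound 1 (Eventually.of_forall fun t => ?_)).trans_isLittleO h1
    rw [one_mul, norm_pow, norm_pow]
    gcongr
    rw [Real.norm_of_nonneg (le_max_right _ _), Real.norm_eq_abs]
    exact max_le (le_abs_self t) (abs_nonneg t)
  · have : (fun x : ℝ => max x 0 ^ (n + 2)) =ᶠ[𝓝 x] fun x => x ^ (n + 2) := by
      filter_upwards [lt_mem_nhds h] with y hy
      rw [max_eq_left hy.le]
    rw [max_eq_left h.le]
    refine HasDerivAt.congr_of_eventuallyEq ?_ this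
    have := hasDerivAt_pow (n + 2) x
    push_cast at this
    exact this

/-- The profile `(1 - exp (-α (τ - κ)))₊`, which is linear just above the level `κ` and saturates
at one. -/
noncomputable def profile (α κ τ : ℝ) : ℝ := max (1 - exp (-(α * (τ - κ)))) 0

/-- The test function at the level `κ`, in the variable `τ`. -/
noncomputable def levelTest (α κ τ : ℝ) : ℝ := profile α κ τ ^ 3

/-- The truncation at the level `κ` whose gradient is controlled by the dissipation; its square
grows like `exp τ`. -/
noncomputable def levelRoot (α κ τ : ℝ) : ℝ := exp (τ / 2) * profile α κ τ ^ 2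

/-- The derivative of `levelTest`. -/
noncomputable def levelTestDeriv (α κ τ : ℝ) : ℝ :=
  3 * profile α κ τ ^ 2 * (α * exp (-(α * (τ - κ))))

/-- The derivative of `levelRoot`. -/
noncomputable def levelRootDeriv (α κ τ : ℝ) : ℝ :=
  exp (τ / 2) * profile α κ τ * (profile α κ τ / 2 + 2 * (α * exp (-(α * (τ - κ)))))

theorem profile_nonneg (τ : ℝ) : 0 ≤ profile α κ τ := le_max_right _ _

theorem profile_le_one (τ : ℝ) : profile α κ τ ≤ 1 :=
  max_le (by linarith [Real.exp_pos (-(α * (τ - κ)))]) zero_le_one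

theorem continuous_profile : Continuous (profile α κ) := by
  unfold profile; fun_prop

theorem profile_mono (hα : 0 < α) : Monotone (profile α κ) := by
  intro a b h
  unfold profile
  gcongr

theorem profile_eq_zero (hα : 0 < α) {τ : ℝ} (h : τ ≤ κ) : profile α κ τ = 0 := by
  refine max_eq_right ?_
  have : 1 ≤ exp (-(α * (τ - κ))) := Real.one_le_exp (by nlinarith)
  linarith

theorem profile_eq_of_le (hα : 0 < α) {τ : ℝ} (h : κ ≤ τ) :
    profile α κ τ = 1 - exp (-(α * (τ - κ))) := by
  refine max_eq_left ?_
  have : exp (-(α * (τ - κ))) ≤ 1 := Real.exp_le_one_iff.2 (by nlinarith)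
  linarith

theorem profile_add_ge (hα : 0 < α) (hα1 : α ≤ 1) {θ : ℝ} (hθ : 0 ≤ θ) (hθ1 : θ ≤ 1) :
    α / 2 * θ ≤ profile α κ (κ + θ) := by
  rw [profile_eq_of_le hα (by linarith), add_sub_cancel_left, Real.exp_neg]
  have hx0 : 0 ≤ α * θ := by positivity
  have hx1 : α * θ ≤ 1 := by nlinarith
  have h1 := Real.add_one_le_exp (α * θ)
  have h2 : (exp (α * θ))⁻¹ ≤ (α * θ + 1)⁻¹ := by gcongr
  have h3 : (α * θ + 1)⁻¹ ≤ 1 - α / 2 * θ := by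
    rw [inv_le_iff_one_le_mul₀ (by positivity)]
    nlinarith
  linarith

theorem hasDerivAt_profile_arg (τ : ℝ) :
    HasDerivAt (fun τ => 1 - exp (-(α * (τ - κ)))) (α * exp (-(α * (τ - κ)))) τ := by
  have h1 : HasDerivAt (fun τ : ℝ => -(α * (τ - κ))) (-α) τ := by
    have := (((hasDerivAt_id τ).sub_const κ).const_mul α).neg
    rw [mul_one] at this
    exact this
  refine (h1.exp.const_sub 1).congr_deriv ?_
  ring

theorem hasDerivAt_levelTest (τ : ℝ) :
    HasDerivAt (levelTest α κ) (levelTestDeriv α κ τ) τ := by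
  have h := (hasDerivAt_max_zero_pow 1 _).comp τ (hasDerivAt_profile_arg (α := α) (κ := κ) τ)
  refine HasDerivAt.congr_deriv h ?_
  simp only [levelTestDeriv, profile]; push_cast; ring

theorem hasDerivAt_levelRoot (τ : ℝ) :
    HasDerivAt (levelRoot α κ) (levelRootDeriv α κ τ) τ := by
  have h := (hasDerivAt_max_zero_pow 0 _).comp τ (hasDerivAt_profile_arg (α := α) (κ := κ) τ)
  have h2 := (((hasDerivAt_id τ).div_const 2).exp).mul h
  refine HasDerivAt.congr_deriv h2 ?_
  simp only [levelRootDeriv, profile, Function.comp, id]; push_cast; ring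

theorem contDiff_levelTest : ContDiff ℝ 1 (levelTest α κ) := by
  rw [contDiff_one_iff_deriv]
  refine ⟨fun τ => (hasDerivAt_levelTest τ).differentiableAt, ?_⟩
  have : deriv (levelTest α κ) = levelTestDeriv α κ := funext fun τ => (hasDerivAt_levelTest τ).deriv
  rw [this]
  have := continuous_profile (α := α) (κ := κ)
  unfold levelTestDeriv; fun_prop

theorem contDiff_levelRoot : ContDiff ℝ 1 (levelRoot α κ) := by
  rw [contDiff_one_iff_deriv]
  refine ⟨fun τ => (hasDerivAt_levelRoot τ).differentiableAt, ?_⟩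
  have : deriv (levelRoot α κ) = levelRootDeriv α κ := funext fun τ => (hasDerivAt_levelRoot τ).deriv
  rw [this]
  have := continuous_profile (α := α) (κ := κ)
  unfold levelRootDeriv; fun_prop

/-- The pointwise energy balance at the level `κ`, with `G` and `B` for the lengths of `∇τ` and of
the remainder of the drift: the dissipation controls the slope of `levelRoot`, up to an error which
is at most the square of `levelRoot` times `B ^ 2`, except just above the level. The slope of the
test function decays like `exp (-α τ)`, and since `α ≤ m - 1` the growth of `Ψ'` makes up for it. -/
theorem levelRootDeriv_sq_le (hm : 1 < m) (hε : 0 < ε) (hΩ : 0 ≤ Ω) (hκ : Ω ≤ κ)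
    (hα : 0 < α) (hα1 : α ≤ 1) (hαm : α ≤ m - 1) {τ y G B : ℝ} (hy : |τ - y| ≤ Ω) (hτ : κ < τ) :
    3 * α / 8 * exp (-Ω) * (levelRootDeriv α κ τ * G) ^ 2 -
      6 * exp Ω * exp (1 / α) * (levelRoot α κ τ ^ 2 + exp κ) * B ^ 2 ≤
    exp y * levelTestDeriv α κ τ *
      (logPressureDeriv m ε τ / 2 * G ^ 2 - B ^ 2 / (2 * logPressureDeriv m ε τ)) := by
  have hP0 := profile_nonneg (α := α) (κ := κ) τ
  have hP1 := profile_le_one (α := α) (κ := κ) τ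
  have hPe := profile_eq_of_le hα hτ.le
  set P := profile α κ τ with hP
  set q := exp (-(α * (τ - κ))) with hq
  have hq0 : 0 < q := Real.exp_pos _
  have hPq : P + q = 1 := by rw [hPe]; ring
  have hD := logPressureDeriv_pos hm hε τ
  obtain ⟨hy1, hy2⟩ := abs_le.1 hy
  have hτ0 : 0 ≤ τ := by linarith
  have hDα : exp (α * τ) ≤ logPressureDeriv m ε τ := by
    have h1 : exp (α * τ) ≤ exp ((m - 1) * τ) := by gcongr
    unfold logPressureDeriv
    nlinarith [Real.exp_pos ((m - 1) * τ)]
  have hD1 : 1 ≤ logPressureDeriv m ε τ := le_trans (Real.one_le_exp (by positivity)) hDα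
  have hR : levelRootDeriv α κ τ ^ 2 ≤ 4 * exp τ * P ^ 2 := by
    have h1 : 0 ≤ P / 2 + 2 * (α * q) := by positivity
    have h2 : P / 2 + 2 * (α * q) ≤ 2 := by nlinarith
    have h3 : (P / 2 + 2 * (α * q)) ^ 2 ≤ 2 ^ 2 := by gcongr
    have h4 : exp (τ / 2) ^ 2 = exp τ := by rw [← Real.exp_nat_mul]; congr 1; push_cast; ring
    have h5 : levelRootDeriv α κ τ ^ 2 = exp τ * P ^ 2 * (P / 2 + 2 * (α * q)) ^ 2 := by
      rw [← h4]; simp only [levelRootDeriv, ← hP, ← hq]; ring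
    rw [h5]
    have : 0 ≤ exp τ * P ^ 2 := by positivity
    nlinarith
  have hmain : 3 * α / 8 * exp (-Ω) * (levelRootDeriv α κ τ * G) ^ 2 ≤
      exp y * levelTestDeriv α κ τ * (logPressureDeriv m ε τ / 2 * G ^ 2) := by
    have h1 : exp (-Ω) * exp τ ≤ exp y := by rw [← Real.exp_add]; gcongr; linarith
    have h2 : 1 ≤ q * logPressureDeriv m ε τ := by
      calc (1 : ℝ) ≤ exp (α * κ) := Real.one_le_exp (by have : 0 ≤ κ := by linarith
                                                        positivity)
        _ = q * exp (α * τ) := by rw [hq, ← Real.exp_add]; ring_nf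
        _ ≤ _ := by gcongr
    calc 3 * α / 8 * exp (-Ω) * (levelRootDeriv α κ τ * G) ^ 2
        = 3 * α / 8 * exp (-Ω) * G ^ 2 * levelRootDeriv α κ τ ^ 2 := by ring
      _ ≤ 3 * α / 8 * exp (-Ω) * G ^ 2 * (4 * exp τ * P ^ 2) := by gcongr
      _ = (exp (-Ω) * exp τ) * (3 * α / 2 * G ^ 2 * P ^ 2) * 1 := by ring
      _ ≤ exp y * (3 * α / 2 * G ^ 2 * P ^ 2) * (q * logPressureDeriv m ε τ) := by gcongr
      _ = _ := by simp only [levelTestDeriv, ← hP, ← hq]; ring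
  have herr : exp y * levelTestDeriv α κ τ * (B ^ 2 / (2 * logPressureDeriv m ε τ)) ≤
      6 * exp Ω * exp (1 / α) * (levelRoot α κ τ ^ 2 + exp κ) * B ^ 2 := by
    have h1 : exp y ≤ exp Ω * exp τ := by rw [← Real.exp_add]; gcongr; linarith
    have h2 : B ^ 2 / (2 * logPressureDeriv m ε τ) ≤ B ^ 2 / 2 := by
      gcongr; linarith
    have h3 : levelRoot α κ τ ^ 2 = exp τ * P ^ 4 := by
      have h4 : exp (τ / 2) ^ 2 = exp τ := by rw [← Real.exp_nat_mul]; congr 1; push_cast; ring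
      rw [← h4]; simp only [levelRoot, ← hP]; ring
    have hα' : 1 ≤ exp (1 / α) := Real.one_le_exp (by positivity)
    have h5 : exp τ * P ^ 2 * q ≤ 4 * exp (1 / α) * (exp τ * P ^ 4 + exp κ) := by
      -- If `q` is large then `τ - κ ≤ 1 / α`, so that `exp τ` is comparable with `exp κ`.
      rcases le_total q (1 / 2) with hc | hc
      · have hP2 : 1 / 2 ≤ P := by linarith
        have h6 : P ^ 2 * q ≤ 4 * P ^ 4 := by
          have h7 : (1 / 2) ^ 2 ≤ P ^ 2 := by gcongr
          nlinarith [mul_nonneg (sq_nonneg P) (sub_nonneg.2 h7), sq_nonneg P]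
        calc exp τ * P ^ 2 * q = exp τ * (P ^ 2 * q) := by ring
          _ ≤ exp τ * (4 * P ^ 4) := by gcongr
          _ = 4 * 1 * (exp τ * P ^ 4 + 0) := by ring
          _ ≤ _ := by gcongr; positivity
      · have h6 : -(α * (τ - κ)) ≥ -1 := by
          by_contra hcon
          push Not at hcon
          have : q < exp (-1) := Real.exp_lt_exp.2 hcon
          have h7 : exp (-1) < 1 / 2 := by
            rw [Real.exp_neg, one_div]
            refine inv_strictAnti₀ (by norm_num) ?_
            linarith [Real.exp_one_gt_d9]
          linarith
        have h7 : τ ≤ 1 / α + κ := by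
          have : τ - κ ≤ 1 / α := by rw [le_div_iff₀ hα]; linarith
          linarith
        have h8 : exp τ ≤ exp (1 / α) * exp κ := by rw [← Real.exp_add]; gcongr
        have hq1 : q ≤ 1 := by linarith
        calc exp τ * P ^ 2 * q ≤ exp τ * 1 ^ 2 * 1 := by gcongr
          _ ≤ exp (1 / α) * exp κ := by linarith
          _ = 1 * exp (1 / α) * (0 + exp κ) := by ring
          _ ≤ _ := by gcongr <;> first | positivity | norm_num
    calc exp y * levelTestDeriv α κ τ * (B ^ 2 / (2 * logPressureDeriv m ε τ))
        = exp y * (3 * P ^ 2 * (α * q)) * (B ^ 2 / (2 * logPressureDeriv m ε τ)) := by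
          simp only [levelTestDeriv, ← hP, ← hq]
      _ ≤ (exp Ω * exp τ) * (3 * P ^ 2 * (1 * q)) * (B ^ 2 / 2) := by gcongr
      _ = 3 / 2 * exp Ω * B ^ 2 * (exp τ * P ^ 2 * q) := by ring
      _ ≤ 3 / 2 * exp Ω * B ^ 2 * (4 * exp (1 / α) * (exp τ * P ^ 4 + exp κ)) := by gcongr
      _ = _ := by rw [h3]; ring
  have : exp y * levelTestDeriv α κ τ *
      (logPressureDeriv m ε τ / 2 * G ^ 2 - B ^ 2 / (2 * logPressureDeriv m ε τ)) =
      exp y * levelTestDeriv α κ τ * (logPressureDeriv m ε τ / 2 * G ^ 2) -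
      exp y * levelTestDeriv α κ τ * (B ^ 2 / (2 * logPressureDeriv m ε τ)) := by ring
  linarith

end DriftDiffusion

/-! ### The energy density -/

namespace DriftDiffusion

open Real (exp log)

variable {m ε Ω κ α : ℝ}

/-- The shifted logarithm of a density `s`. Densities below one are replaced by one, which changes
nothing above the levels in use. -/
noncomputable def levelTau (m ε c s : ℝ) : ℝ := logShift m ε c (log (max s 1))

/-- The antiderivative in the density of the test function at the level `κ`. -/
noncomputable def levelEnergy (m ε α κ c s : ℝ) : ℝ :=
  ∫ σ in (0 : ℝ)..s, levelTest α κ (levelTau m ε c σ)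

theorem continuous_levelTau (hm : 1 < m) (hε : 0 < ε) :
    Continuous fun q : ℝ × ℝ => levelTau m ε q.1 q.2 := by
  unfold levelTau logShift
  refine (contDiff_logPressureInv hm hε).continuous.comp ?_
  refine Continuous.add (contDiff_logPressure.continuous.comp ?_) continuous_fst
  refine Continuous.log (by fun_prop) fun q => ?_
  have : (1 : ℝ) ≤ max q.2 1 := le_max_right _ _
  positivity

theorem levelTau_mono (hm : 1 < m) (hε : 0 < ε) (c : ℝ) : Monotone (levelTau m ε c) := by
  intro a b h
  refine (strictMono_logShift hm hε c).monotone (Real.log_le_log ?_ (by gcongr))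
  exact lt_of_lt_of_le one_pos (le_max_right _ _)

theorem levelTau_exp {c y : ℝ} (hy : 0 ≤ y) :
    levelTau m ε c (exp y) = logShift m ε c y := by
  rw [levelTau, max_eq_left (Real.one_le_exp hy), Real.log_exp]

theorem exp_sub_lt_of_lt_levelTau (hm : 1 < m) (hε : 0 < ε) {c s : ℝ} (hc : |c| ≤ Ω) (hκ : Ω ≤ κ)
    (h : κ < levelTau m ε c s) : exp (κ - Ω) < s := by
  have h1 := abs_logShift_sub_le hm hε hc (hκ.trans h.le)
  have h2 : κ - Ω < log (max s 1) := by
    have := (abs_le.1 h1).2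
    unfold levelTau at h
    linarith
  rcases le_total s 1 with hs | hs
  · rw [max_eq_right hs, Real.log_one] at h2; linarith
  · rw [max_eq_left hs] at h2
    exact (Real.lt_log_iff_exp_lt (by linarith)).1 h2

theorem levelTau_le_of_le (hm : 1 < m) (hε : 0 < ε) {c s : ℝ} (hc : |c| ≤ Ω) (hκ : Ω ≤ κ)
    (h : s ≤ exp (κ - Ω)) : levelTau m ε c s ≤ κ := by
  by_contra hcon
  exact absurd (exp_sub_lt_of_lt_levelTau hm hε hc hκ (not_le.1 hcon)) (not_lt.2 h)

theorem levelTest_mono (hα : 0 < α) : Monotone (levelTest α κ) := fun _ _ h =>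
  pow_le_pow_left₀ (profile_nonneg _) (profile_mono hα h) 3

theorem levelTest_nonneg (τ : ℝ) : 0 ≤ levelTest α κ τ := pow_nonneg (profile_nonneg _) 3

theorem levelTest_le_one (τ : ℝ) : levelTest α κ τ ≤ 1 :=
  pow_le_one₀ (profile_nonneg _) (profile_le_one _)

theorem levelTest_eq_zero (hα : 0 < α) {τ : ℝ} (h : τ ≤ κ) : levelTest α κ τ = 0 := by
  rw [levelTest, profile_eq_zero hα h, zero_pow (by norm_num)]

theorem continuous_levelTest_levelTau (hm : 1 < m) (hε : 0 < ε) (c : ℝ) :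
    Continuous fun s => levelTest α κ (levelTau m ε c s) :=
  contDiff_levelTest.continuous.comp ((continuous_levelTau hm hε).comp (by fun_prop :
    Continuous fun s : ℝ => (c, s)))

theorem intervalIntegrable_levelTest (hm : 1 < m) (hε : 0 < ε) (c a b : ℝ) :
    IntervalIntegrable (fun s => levelTest α κ (levelTau m ε c s)) volume a b :=
  (continuous_levelTest_levelTau hm hε c).intervalIntegrable a b

theorem levelEnergy_eq_integral (hm : 1 < m) (hε : 0 < ε) (hα : 0 < α) {c a s : ℝ}
    (ha0 : 0 ≤ a) (ha : levelTau m ε c a ≤ κ) :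
    levelEnergy m ε α κ c s = ∫ σ in a..s, levelTest α κ (levelTau m ε c σ) := by
  rw [levelEnergy, ← intervalIntegral.integral_add_adjacent_intervals
    (intervalIntegrable_levelTest hm hε c 0 a) (intervalIntegrable_levelTest hm hε c a s)]
  have : ∫ σ in (0 : ℝ)..a, levelTest α κ (levelTau m ε c σ) = ∫ σ in (0 : ℝ)..a, (0 : ℝ) := by
    refine intervalIntegral.integral_congr fun σ hσ => ?_
    rw [uIcc_of_le ha0] at hσ
    exact levelTest_eq_zero hα ((levelTau_mono hm hε c hσ.2).trans ha)
  rw [this]; simp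

theorem levelEnergy_eq_zero (hm : 1 < m) (hε : 0 < ε) (hα : 0 < α) {c s : ℝ}
    (hs0 : 0 ≤ s) (hs : levelTau m ε c s ≤ κ) : levelEnergy m ε α κ c s = 0 := by
  rw [levelEnergy_eq_integral hm hε hα hs0 hs, intervalIntegral.integral_same]

theorem levelEnergy_nonneg {c s : ℝ} (hs0 : 0 ≤ s) : 0 ≤ levelEnergy m ε α κ c s :=
  intervalIntegral.integral_nonneg hs0 fun _ _ => levelTest_nonneg _

/-- The energy density grows at most linearly in the density, and it vanishes up to
`exp (κ - Ω)`. -/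
theorem levelEnergy_le_max_sub (hm : 1 < m) (hε : 0 < ε) (hα : 0 < α) {c s : ℝ} (hc : |c| ≤ Ω)
    (hκ : Ω ≤ κ) (hs0 : 0 ≤ s) : levelEnergy m ε α κ c s ≤ max (s - exp (κ - Ω)) 0 := by
  rcases le_total s (exp (κ - Ω)) with h | h
  · rw [levelEnergy_eq_zero hm hε hα hs0 (levelTau_le_of_le hm hε hc hκ h)]
    exact le_max_right _ _
  · rw [levelEnergy_eq_integral hm hε hα (Real.exp_pos _).le (levelTau_le_of_le hm hε hc hκ le_rfl)]
    refine le_trans ?_ (le_max_left _ _)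
    have h1 := intervalIntegral.integral_mono_on h (intervalIntegrable_levelTest hm hε c _ _)
      (intervalIntegrable_const (c := (1 : ℝ))) fun σ _ =>
        levelTest_le_one (α := α) (κ := κ) (levelTau m ε c σ)
    simpa using h1

/-- The energy density at a level is dominated by the square of the truncation, including just
above the level, where both vanish to the fourth order. -/
theorem levelEnergy_le (hm : 1 < m) (hε : 0 < ε) (hα : 0 < α) (hα1 : α ≤ 1) {c s : ℝ}
    (hc : |c| ≤ Ω) (hκ : Ω ≤ κ) (hs0 : 0 ≤ s) :
    levelEnergy m ε α κ c s ≤ exp Ω * exp ((m - 1) * (1 + Ω)) * (2 / α) *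
      levelRoot α κ (levelTau m ε c s) ^ 2 := by
  have hΩ : 0 ≤ Ω := (abs_nonneg c).trans hc
  have hm1 : 0 < m - 1 := by linarith
  rcases le_or_gt (levelTau m ε c s) κ with h | h
  · rw [levelEnergy_eq_zero hm hε hα hs0 h]; positivity
  have hs1 : 1 ≤ s := by
    have h1 := exp_sub_lt_of_lt_levelTau hm hε hc hκ h
    have h2 : 1 ≤ exp (κ - Ω) := Real.one_le_exp (by linarith)
    linarith
  set y := log s with hy
  have hsy : s = exp y := (Real.exp_log (by linarith)).symm
  have hy0 : 0 ≤ y := Real.log_nonneg hs1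
  have hτ : levelTau m ε c s = logShift m ε c y := by rw [hsy, levelTau_exp hy0]
  rw [hτ] at h ⊢
  set τ := logShift m ε c y with hτdef
  set yk := logShift m ε (-c) κ with hyk
  have hτk : logShift m ε c yk = κ := logShift_logShift_neg hm hε c κ
  obtain ⟨hyk1, hyk2⟩ := abs_le.1 (abs_logShift_sub_le hm hε hc (by rw [hτk]; exact hκ) :
    |logShift m ε c yk - yk| ≤ Ω)
  obtain ⟨hy1, hy2⟩ := abs_le.1 (abs_logShift_sub_le hm hε hc (by linarith) :
    |logShift m ε c y - y| ≤ Ω)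
  rw [hτk] at hyk1 hyk2
  rw [← hτdef] at hy1 hy2
  have hyk0 : 0 ≤ yk := by linarith
  have hyy : yk < y := (strictMono_logShift hm hε c).lt_iff_lt.1 (by rw [hτk]; exact h)
  have hP0 := profile_nonneg (α := α) (κ := κ) τ
  set C := exp ((m - 1) * (1 + Ω)) with hC
  have hC1 : 1 ≤ C := Real.one_le_exp (by positivity)
  -- The densities of `τ` and of the level are `exp y` and `exp yk`; their distance is measured by
  -- the profile, which is linear in `τ - κ` up to one and bounded below from there on.
  have hgap : exp y - exp yk ≤ exp y * (C * (2 / α) * profile α κ τ) := by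
    rcases le_total (τ - κ) 1 with h1 | h1
    · have h2 := sub_le_exp_mul_sub hm hε (a₁ := yk) (a₂ := y) (b₁ := κ) (b₂ := τ) (δ := 1 + Ω)
        h.le (by linarith) (by linarith) (by
          have e1 := logPressure_logShift hm hε c y
          have e2 := logPressure_logShift hm hε c yk
          rw [hτk] at e2
          rw [← hτdef] at e1
          linarith)
      have h3 := profile_add_ge (κ := κ) hα hα1 (sub_nonneg.2 h.le) h1
      rw [add_sub_cancel] at h3
      have h4 : exp y - exp yk ≤ exp y * (y - yk) := by
        have h5 := Real.add_one_le_exp (yk - y)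
        have h6 : exp yk = exp y * exp (yk - y) := by rw [← Real.exp_add]; ring_nf
        rw [h6]; nlinarith [Real.exp_pos y]
      refine h4.trans ?_
      gcongr
      refine h2.trans ?_
      rw [mul_assoc]
      gcongr
      rw [div_mul_eq_mul_div, le_div_iff₀ hα]
      linarith
    · have h3 := profile_add_ge (κ := κ) hα hα1 zero_le_one le_rfl
      have h4 : α / 2 * 1 ≤ profile α κ τ := h3.trans (profile_mono hα (by linarith))
      have h5 : 1 ≤ 2 / α * profile α κ τ := by
        rw [div_mul_eq_mul_div, le_div_iff₀ hα]; linarith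
      have h6 : 1 * 1 ≤ C * (2 / α * profile α κ τ) := by gcongr
      have h7 := Real.exp_pos yk
      have h8 := Real.exp_pos y
      nlinarith
  have hint : levelEnergy m ε α κ c s ≤ (exp y - exp yk) * profile α κ τ ^ 3 := by
    rw [levelEnergy_eq_integral hm hε hα (Real.exp_pos yk).le
      (by rw [levelTau_exp hyk0, hτk]), hsy]
    have h1 := intervalIntegral.integral_mono_on (Real.exp_le_exp.2 hyy.le)
      (intervalIntegrable_levelTest (α := α) (κ := κ) hm hε c (exp yk) (exp y))
      (intervalIntegrable_const (c := profile α κ τ ^ 3)) fun σ hσ => by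
        refine levelTest_mono hα (b := τ) ?_
        rw [hτdef, ← levelTau_exp (ε := ε) (m := m) hy0]
        exact levelTau_mono hm hε c hσ.2
    simpa using h1
  have hyτ : exp y ≤ exp Ω * exp τ := by rw [← Real.exp_add]; gcongr; linarith
  have hroot : levelRoot α κ τ ^ 2 = exp τ * profile α κ τ ^ 4 := by
    have h4 : exp (τ / 2) ^ 2 = exp τ := by rw [← Real.exp_nat_mul]; congr 1; push_cast; ring
    rw [← h4]; simp only [levelRoot]; ring
  calc _ ≤ (exp y - exp yk) * profile α κ τ ^ 3 := hint
    _ ≤ exp y * (C * (2 / α) * profile α κ τ) * profile α κ τ ^ 3 := by gcongr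
    _ ≤ (exp Ω * exp τ) * (C * (2 / α) * profile α κ τ) * profile α κ τ ^ 3 := by gcongr
    _ = _ := by rw [hroot]; ring

/-- Above a higher level the energy density at the level `κ` is bounded below. -/
theorem le_levelEnergy (hm : 1 < m) (hε : 0 < ε) (hα : 0 < α) (hα1 : α ≤ 1) {c s θ : ℝ}
    (hc : |c| ≤ Ω) (hκ : Ω ≤ κ) (hθ : 0 < θ) (hθ1 : θ ≤ 1)
    (h : κ + θ < levelTau m ε c s) :
    exp (-Ω) * exp (-((m - 1) * (1 + Ω))) / 2 * (α / 4) ^ 3 * exp κ * θ ^ 4 ≤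
      levelEnergy m ε α κ c s := by
  have hΩ : 0 ≤ Ω := (abs_nonneg c).trans hc
  have hm1 : 0 < m - 1 := by linarith
  -- The part of the energy density that comes from `κ + θ / 2 ≤ τ ≤ κ + θ` is enough.
  set y₁ := logShift m ε (-c) (κ + θ / 2) with hy₁
  set y₂ := logShift m ε (-c) (κ + θ) with hy₂
  have hτ₁ : logShift m ε c y₁ = κ + θ / 2 := logShift_logShift_neg hm hε c _
  have hτ₂ : logShift m ε c y₂ = κ + θ := logShift_logShift_neg hm hε c _
  obtain ⟨a1, a2⟩ := abs_le.1 (abs_logShift_sub_le hm hε hc (by rw [hτ₁]; linarith) :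
    |logShift m ε c y₁ - y₁| ≤ Ω)
  obtain ⟨b1, b2⟩ := abs_le.1 (abs_logShift_sub_le hm hε hc (by rw [hτ₂]; linarith) :
    |logShift m ε c y₂ - y₂| ≤ Ω)
  rw [hτ₁] at a1 a2
  rw [hτ₂] at b1 b2
  have hy₁0 : 0 ≤ y₁ := by linarith
  have h12 : y₁ < y₂ := (strictMono_logShift hm hε c).lt_iff_lt.1 (by rw [hτ₁, hτ₂]; linarith)
  have hs₂ : exp y₂ ≤ s := by
    by_contra hcon
    have := levelTau_mono hm hε c (not_le.1 hcon).le
    rw [levelTau_exp (by linarith), hτ₂] at this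
    linarith
  have hdiff : θ / 2 ≤ exp ((m - 1) * (1 + Ω)) * (y₂ - y₁) := by
    have := sub_le_exp_mul_sub hm hε (a₁ := κ + θ / 2) (a₂ := κ + θ) (b₁ := y₁) (b₂ := y₂)
      (δ := 1 + Ω) h12.le (by linarith) (by linarith) (by
        have e1 := logPressure_logShift hm hε c y₁
        have e2 := logPressure_logShift hm hε c y₂
        rw [hτ₁] at e1
        rw [hτ₂] at e2
        linarith)
    linarith
  have hdiff' : exp (-((m - 1) * (1 + Ω))) * (θ / 2) ≤ y₂ - y₁ := by
    rw [Real.exp_neg, inv_mul_le_iff₀ (Real.exp_pos _)]; exact hdiff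
  have hexp : exp (κ - Ω) * (exp (-((m - 1) * (1 + Ω))) * (θ / 2)) ≤ exp y₂ - exp y₁ := by
    have h1 : exp y₁ * (y₂ - y₁) ≤ exp y₂ - exp y₁ := by
      have h5 := Real.add_one_le_exp (y₂ - y₁)
      have h6 : exp y₂ = exp y₁ * exp (y₂ - y₁) := by rw [← Real.exp_add]; ring_nf
      rw [h6]; nlinarith [Real.exp_pos y₁]
    refine le_trans ?_ h1
    gcongr
    linarith
  have hP : α / 4 * θ ≤ profile α κ (κ + θ / 2) := by
    have := profile_add_ge (κ := κ) hα hα1 (by linarith : 0 ≤ θ / 2) (by linarith)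
    linarith
  have hint : (exp y₂ - exp y₁) * profile α κ (κ + θ / 2) ^ 3 ≤ levelEnergy m ε α κ c s := by
    have h1 := intervalIntegral.integral_mono_on (Real.exp_le_exp.2 h12.le)
      (intervalIntegrable_const (c := profile α κ (κ + θ / 2) ^ 3))
      (intervalIntegrable_levelTest (α := α) (κ := κ) hm hε c (exp y₁) (exp y₂)) fun σ hσ => by
        refine levelTest_mono hα (a := κ + θ / 2) ?_
        rw [← hτ₁, ← levelTau_exp (ε := ε) (m := m) hy₁0]
        exact levelTau_mono hm hε c hσ.1
    have h2 : ∫ σ in exp y₁..exp y₂, levelTest α κ (levelTau m ε c σ) ≤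
        ∫ σ in (0 : ℝ)..s, levelTest α κ (levelTau m ε c σ) :=
      intervalIntegral.integral_mono_interval (Real.exp_pos _).le (Real.exp_le_exp.2 h12.le) hs₂
        (ae_of_all _ fun σ => levelTest_nonneg _) (intervalIntegrable_levelTest hm hε c _ _)
    refine le_trans ?_ h2
    simpa using h1
  refine le_trans ?_ hint
  calc _ = exp (κ - Ω) * (exp (-((m - 1) * (1 + Ω))) * (θ / 2)) * (α / 4 * θ) ^ 3 := by
        rw [sub_eq_add_neg κ, Real.exp_add]; ring
    _ ≤ _ := by
        gcongr
        exact sub_nonneg.2 (Real.exp_le_exp.2 h12.le)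

end DriftDiffusion

/-! ### The energy identity -/

namespace DriftDiffusion

variable {d : ℕ} {m ε r t : ℝ} {T : EReal}
  {V : EuclideanSpace ℝ (Fin d) → EuclideanSpace ℝ (Fin d)}
  {u₀ : EuclideanSpace ℝ (Fin d) → ℝ} {u : EuclideanSpace ℝ (Fin d) → ℝ → ℝ}

/-- The flux `∇ φ_ε(u) + u V` at time `t`, with the gradient taken from inside the ball. -/
noncomputable def flux (m ε r : ℝ) (V : EuclideanSpace ℝ (Fin d) → EuclideanSpace ℝ (Fin d))
    (u : EuclideanSpace ℝ (Fin d) → ℝ → ℝ) (t : ℝ) (x : EuclideanSpace ℝ (Fin d)) :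
    EuclideanSpace ℝ (Fin d) :=
  gradientWithin (fun y => phi m ε (u y t)) (closedBall 0 r) x + u x t • V x

theorem uniqueDiffOn_closedBall_zero (hr : 0 < r) :
    UniqueDiffOn ℝ (closedBall (0 : EuclideanSpace ℝ (Fin d)) r) :=
  uniqueDiffOn_convex (convex_closedBall 0 r)
    ⟨0, ball_subset_interior_closedBall (mem_ball_self hr)⟩

theorem isOpen_timeInterval (T : EReal) : IsOpen {t : ℝ | 0 < t ∧ (t : EReal) < T} :=
  (isOpen_lt continuous_const continuous_id).inter
    (isOpen_lt continuous_coe_real_ereal continuous_const)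

theorem contDiff_phi (hm : 1 < m) : ContDiff ℝ 1 (phi m ε) := by
  unfold phi
  exact (Real.contDiff_rpow_const_of_le (n := 1) (by exact_mod_cast hm.le)).add
    (contDiff_const.mul contDiff_id)

theorem contDiffAt_phi {s : ℝ} (hs : s ≠ 0) : ContDiffAt ℝ ∞ (phi m ε) s := by
  unfold phi
  exact (Real.contDiffAt_rpow_const_of_ne hs).add (contDiffAt_const.mul contDiffAt_id)

theorem hasDerivAt_phi (hm : 1 < m) (s : ℝ) :
    HasDerivAt (phi m ε) (m * s ^ (m - 1) + ε) s := by
  have h1 := Real.hasDerivAt_rpow_const (x := s) (p := m) (Or.inr hm.le)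
  have h2 := h1.add ((hasDerivAt_id s).const_mul ε)
  rw [mul_one] at h2
  exact h2

namespace IsSmoothNoFluxSolution

variable (h : IsSmoothNoFluxSolution m ε r T V u₀ u)

include h

theorem contDiffOn_slice (ht : 0 < t) (htT : (t : EReal) < T) :
    ContDiffOn ℝ ∞ (fun x => u x t) (closedBall 0 r) :=
  h.smooth.comp (contDiff_id.prodMk contDiff_const).contDiffOn fun _ hx => ⟨hx, ht, htT⟩

/-- A function of `x` and the density is `C¹` up to the boundary if it vanishes for small
densities. -/
theorem contDiffOn_comp {Φ : EuclideanSpace ℝ (Fin d) → ℝ → ℝ} {s₀ : ℝ} (hs₀ : 0 < s₀)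
    (hΦ0 : ∀ x, ∀ s ≤ s₀, Φ x s = 0)
    (hΦ1 : ContDiffOn ℝ 1 (Function.uncurry Φ) (univ ×ˢ Ioi 0)) (ht : 0 < t)
    (htT : (t : EReal) < T) :
    ContDiffOn ℝ 1 (fun x => Φ x (u x t)) (closedBall 0 r) := by
  intro x hx
  have hu := (h.contDiffOn_slice ht htT).of_le (m := 1) (by simp) x hx
  rcases lt_or_ge (u x t) s₀ with hlt | hge
  · have hev : (fun x => Φ x (u x t)) =ᶠ[𝓝[closedBall 0 r] x] fun _ => 0 := by
      filter_upwards [hu.continuousWithinAt.eventually (gt_mem_nhds hlt)] with y hy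
      exact hΦ0 y _ hy.le
    exact contDiffWithinAt_const.congr_of_eventuallyEq hev (hΦ0 x _ hlt.le)
  · have hpos : 0 < u x t := hs₀.trans_le hge
    have h1 : ContDiffAt ℝ 1 (Function.uncurry Φ) (x, u x t) :=
      hΦ1.contDiffAt ((isOpen_univ.prod isOpen_Ioi).mem_nhds ⟨mem_univ _, hpos⟩)
    exact h1.comp_contDiffWithinAt x (contDiffWithinAt_id.prodMk hu)

theorem continuousOn_flux (hm : 1 < m) (hr : 0 < r) (hV : ContDiff ℝ 1 V) (ht : 0 < t)
    (htT : (t : EReal) < T) : ContinuousOn (flux m ε r V u t) (closedBall 0 r) := by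
  have h1 := (h.contDiffOn_slice ht htT).of_le (m := 1) (by simp)
  have h2 : ContDiffOn ℝ 1 (fun y => phi m ε (u y t)) (closedBall 0 r) :=
    (contDiff_phi hm).comp_contDiffOn h1
  have h3 := h2.continuousOn_fderivWithin (uniqueDiffOn_closedBall_zero hr) le_rfl
  exact ((InnerProductSpace.toDual ℝ (EuclideanSpace ℝ (Fin d))).symm.continuous.comp_continuousOn
    h3).add (h1.continuousOn.smul hV.continuous.continuousOn)

omit h in
theorem flux_eventuallyEq {x : EuclideanSpace ℝ (Fin d)} (hx : x ∈ ball 0 r) :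
    flux m ε r V u t =ᶠ[𝓝 x]
      fun y => gradient (fun y => phi m ε (u y t)) y + u y t • V y := by
  filter_upwards [isOpen_ball.mem_nhds hx] with y hy
  rw [flux, gradientWithin, gradient, fderivWithin_of_mem_nhds]
  exact mem_of_superset (isOpen_ball.mem_nhds hy) ball_subset_closedBall

theorem contDiffAt_slice {x : EuclideanSpace ℝ (Fin d)} (hx : x ∈ ball 0 r) (ht : 0 < t)
    (htT : (t : EReal) < T) : ContDiffAt ℝ ∞ (fun y => u y t) x :=
  (h.contDiffOn_slice ht htT).contDiffAt
    (mem_of_superset (isOpen_ball.mem_nhds hx) ball_subset_closedBall)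

omit h in
theorem contDiffAt_gradient {f : EuclideanSpace ℝ (Fin d) → ℝ} {x : EuclideanSpace ℝ (Fin d)}
    (hf : ContDiffAt ℝ ∞ f x) : ContDiffAt ℝ 1 (gradient f) x := by
  have h1 : ContDiffAt ℝ 1 (fderiv ℝ f) x := hf.fderiv_right (m := 1) (by norm_cast)
  exact (InnerProductSpace.toDual ℝ
    (EuclideanSpace ℝ (Fin d))).symm.toContinuousLinearEquiv.contDiff.contDiffAt.comp x h1

theorem contDiffAt_flux {x : EuclideanSpace ℝ (Fin d)} (hx : x ∈ ball 0 r)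
    (hV : ContDiff ℝ 1 V) (ht : 0 < t) (htT : (t : EReal) < T) (hpos : 0 < u x t) :
    ContDiffAt ℝ 1 (flux m ε r V u t) x := by
  refine ContDiffAt.congr_of_eventuallyEq ?_ (flux_eventuallyEq hx)
  have hu := h.contDiffAt_slice hx ht htT
  have hφ : ContDiffAt ℝ ∞ (fun y => phi m ε (u y t)) x :=
    ContDiffAt.comp x (contDiffAt_phi hpos.ne') hu
  exact (contDiffAt_gradient hφ).add ((hu.of_le (by simp)).smul hV.contDiffAt)

omit h in
theorem divergence_gradient {f : EuclideanSpace ℝ (Fin d) → ℝ} {x : EuclideanSpace ℝ (Fin d)}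
    (hf : ContDiffAt ℝ ∞ f x) : divergence (gradient f) x = Δ f x := by
  rw [InnerProductSpace.laplacian_eq_iteratedFDeriv_orthonormalBasis f
    (EuclideanSpace.basisFun (Fin d) ℝ)]
  simp only [divergence, EuclideanSpace.basisFun_apply]
  refine Finset.sum_congr rfl fun i _ => ?_
  rw [iteratedFDeriv_two_apply]
  simp only [Matrix.cons_val_zero, Matrix.cons_val_one]
  have h1 : DifferentiableAt ℝ (fderiv ℝ f) x :=
    (hf.fderiv_right (m := 1) (by norm_cast)).differentiableAt one_ne_zero
  have h2 : DifferentiableAt ℝ (gradient f) x := (contDiffAt_gradient hf).differentiableAt one_ne_zero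
  have h3 : HasFDerivAt (fun y => gradient f y i)
      ((EuclideanSpace.proj (𝕜 := ℝ) i).comp (fderiv ℝ (gradient f) x)) x :=
    (EuclideanSpace.proj (𝕜 := ℝ) i).hasFDerivAt.comp x h2.hasFDerivAt
  have h4 : (fun y => gradient f y i) = fun y => fderiv ℝ f y (EuclideanSpace.single i 1) := by
    funext y
    have := InnerProductSpace.toDual_symm_apply (𝕜 := ℝ) (x := EuclideanSpace.single i (1 : ℝ))
      (y := fderiv ℝ f y)
    rw [← this, EuclideanSpace.inner_single_right]
    simp [gradient]
  rw [h4] at h3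
  have h5 := h1.hasFDerivAt.clm_apply
    (hasFDerivAt_const (EuclideanSpace.single i (1 : ℝ)) x)
  have h6 := congrArg (fun L => L (EuclideanSpace.single i (1 : ℝ))) (h3.unique h5)
  simpa using h6

omit h in
theorem divergence_add {F G : EuclideanSpace ℝ (Fin d) → EuclideanSpace ℝ (Fin d)}
    {x : EuclideanSpace ℝ (Fin d)} (hF : DifferentiableAt ℝ F x) (hG : DifferentiableAt ℝ G x) :
    divergence (fun y => F y + G y) x = divergence F x + divergence G x := by
  simp only [divergence, fderiv_fun_add hF hG, ← Finset.sum_add_distrib]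
  rfl

omit h in
theorem divergence_smul {f : EuclideanSpace ℝ (Fin d) → ℝ}
    {F : EuclideanSpace ℝ (Fin d) → EuclideanSpace ℝ (Fin d)}
    {x : EuclideanSpace ℝ (Fin d)} (hf : DifferentiableAt ℝ f x) (hF : DifferentiableAt ℝ F x) :
    divergence (fun y => f y • F y) x = fderiv ℝ f x (F x) + f x * divergence F x := by
  have e2 : fderiv ℝ f x (F x) = ∑ i, fderiv ℝ f x (EuclideanSpace.single i 1) * F x i := by
    have : F x = ∑ i, F x i • EuclideanSpace.single i (1 : ℝ) := by
      have := (EuclideanSpace.basisFun (Fin d) ℝ).sum_repr (F x)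
      simpa using this.symm
    conv_lhs => rw [this]
    simp [mul_comm]
  rw [e2]
  simp only [divergence, fderiv_fun_smul hf hF, Finset.mul_sum, ← Finset.sum_add_distrib]
  refine Finset.sum_congr rfl fun i _ => ?_
  simp [add_comm]

/-- The equation in divergence form. It is used where the density is positive only, since the
nonlinearity need not be smooth at zero. -/
theorem divergence_flux {x : EuclideanSpace ℝ (Fin d)} (hx : x ∈ ball 0 r)
    (hV : ContDiff ℝ 1 V) (ht : 0 < t) (htT : (t : EReal) < T) (hpos : 0 < u x t) :
    divergence (flux m ε r V u t) x = deriv (fun s => u x s) t := by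
  have hu := h.contDiffAt_slice hx ht htT
  have hφ : ContDiffAt ℝ ∞ (fun y => phi m ε (u y t)) x :=
    ContDiffAt.comp x (contDiffAt_phi hpos.ne') hu
  rw [h.equation x hx t ht htT, ← divergence_gradient hφ, ← divergence_add]
  · unfold divergence
    rw [(flux_eventuallyEq hx).fderiv_eq]
  · exact (contDiffAt_gradient hφ).differentiableAt one_ne_zero
  · exact (hu.differentiableAt (by simp)).smul (hV.differentiable one_ne_zero x)

/-- The time derivative, continuous up to the boundary of the ball. -/
theorem exists_hasDerivAt_time (hr : 0 < r) : ∃ D : EuclideanSpace ℝ (Fin d) × ℝ → ℝ,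
    ContinuousOn D (closedBall 0 r ×ˢ {t : ℝ | 0 < t ∧ (t : EReal) < T}) ∧
    ∀ x ∈ closedBall 0 r, ∀ t : ℝ, 0 < t → (t : EReal) < T →
      HasDerivAt (fun s => u x s) (D (x, t)) t := by
  set I := {t : ℝ | 0 < t ∧ (t : EReal) < T} with hI
  set f := fun z : EuclideanSpace ℝ (Fin d) × ℝ => u z.1 z.2 with hf
  have hud : UniqueDiffOn ℝ (closedBall (0 : EuclideanSpace ℝ (Fin d)) r ×ˢ I) :=
    (uniqueDiffOn_closedBall_zero hr).prod (isOpen_timeInterval T).uniqueDiffOn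
  refine ⟨fun z => fderivWithin ℝ f (closedBall 0 r ×ˢ I) z (0, 1), ?_, ?_⟩
  · exact (h.smooth.continuousOn_fderivWithin hud (by simp)).clm_apply continuousOn_const
  · intro x hx t ht htT
    have h1 := (h.smooth.differentiableOn (by simp) (x, t) ⟨hx, ht, htT⟩).hasFDerivWithinAt
    have h2 : HasDerivWithinAt (fun s : ℝ => (x, s)) ((0 : EuclideanSpace ℝ (Fin d)), (1 : ℝ)) I t :=
      ((hasDerivAt_const t x).prodMk (hasDerivAt_id t)).hasDerivWithinAt
    have h3 := h1.comp_hasDerivWithinAt t h2 fun s hs => ⟨hx, hs⟩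
    exact h3.hasDerivAt ((isOpen_timeInterval T).mem_nhds ⟨ht, htT⟩)

/-- A `C¹` function on the closed ball has an integrable slope along the flux. -/
theorem integrableOn_fderiv_flux (hm : 1 < m) (hr : 0 < r) (hV : ContDiff ℝ 1 V) (ht : 0 < t)
    (htT : (t : EReal) < T) {θ : EuclideanSpace ℝ (Fin d) → ℝ}
    (hθ : ContDiffOn ℝ 1 θ (closedBall 0 r)) :
    IntegrableOn (fun x => fderiv ℝ θ x (flux m ε r V u t x)) (ball 0 r) := by
  have hc : ContinuousOn (fun x => fderivWithin ℝ θ (closedBall 0 r) x (flux m ε r V u t x))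
      (closedBall 0 r) :=
    (hθ.continuousOn_fderivWithin (uniqueDiffOn_closedBall_zero hr) le_rfl).clm_apply
      (h.continuousOn_flux hm hr hV ht htT)
  refine ((hc.integrableOn_compact (isCompact_closedBall _ _)).mono_set
    ball_subset_closedBall).congr_fun (fun x hx => ?_) measurableSet_ball
  beta_reduce
  rw [fderivWithin_of_mem_nhds (mem_of_superset (isOpen_ball.mem_nhds hx) ball_subset_closedBall)]

/-- Testing the equation with `Θ(x, u)`, where `Θ` vanishes for small densities. -/
theorem integral_test_mul_deriv (hm : 1 < m) (hr : 0 < r) (hV : ContDiff ℝ 1 V)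
    {Θ : EuclideanSpace ℝ (Fin d) → ℝ → ℝ} {s₀ : ℝ} (hs₀ : 0 < s₀)
    (hΘ0 : ∀ x, ∀ s ≤ s₀, Θ x s = 0)
    (hΘ1 : ContDiffOn ℝ 1 (Function.uncurry Θ) (univ ×ˢ Ioi 0)) (ht : 0 < t)
    (htT : (t : EReal) < T) :
    ∫ x in ball 0 r, Θ x (u x t) * deriv (fun s => u x s) t =
      - ∫ x in ball 0 r, fderiv ℝ (fun y => Θ y (u y t)) x (flux m ε r V u t x) := by
  set θ : EuclideanSpace ℝ (Fin d) → ℝ := fun y => Θ y (u y t) with hθ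
  set F := flux m ε r V u t with hF
  have hθ1 : ContDiffOn ℝ 1 θ (closedBall 0 r) := h.contDiffOn_comp hs₀ hΘ0 hΘ1 ht htT
  have hFc := h.continuousOn_flux hm hr hV ht htT
  have hsm : ∀ x ∈ ball (0 : EuclideanSpace ℝ (Fin d)) r, u x t < s₀ → θ =ᶠ[𝓝 x] fun _ => 0 := by
    intro x hx hlt
    filter_upwards [(h.contDiffAt_slice hx ht htT).continuousAt.eventually (gt_mem_nhds hlt)]
      with y hy using hΘ0 y _ hy.le
  have hθat : ∀ x ∈ ball (0 : EuclideanSpace ℝ (Fin d)) r, ContDiffAt ℝ 1 θ x := fun x hx =>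
    hθ1.contDiffAt (mem_of_superset (isOpen_ball.mem_nhds hx) ball_subset_closedBall)
  -- Where the density is small the field `θ F` vanishes identically, so that the flux, which may
  -- not be differentiable at the zeros of `u`, does no harm.
  have hX1 : ContDiffOn ℝ 1 (fun y => θ y • F y) (ball 0 r) := by
    intro x hx
    refine ContDiffAt.contDiffWithinAt ?_
    rcases lt_or_ge (u x t) s₀ with hlt | hge
    · have : (fun y => θ y • F y) =ᶠ[𝓝 x] fun _ => 0 := by
        filter_upwards [hsm x hx hlt] with y hy
        rw [hy, zero_smul]
      exact contDiffAt_const.congr_of_eventuallyEq this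
    · exact (hθat x hx).smul (h.contDiffAt_flux hx hV ht htT (hs₀.trans_le hge))
  have hdiv : ∀ x ∈ ball (0 : EuclideanSpace ℝ (Fin d)) r,
      divergence (fun y => θ y • F y) x = fderiv ℝ θ x (F x) + θ x * deriv (fun s => u x s) t := by
    intro x hx
    rcases lt_or_ge (u x t) s₀ with hlt | hge
    · have h1 : (fun y => θ y • F y) =ᶠ[𝓝 x] fun _ => 0 := by
        filter_upwards [hsm x hx hlt] with y hy
        rw [hy, zero_smul]
      have h2 : θ x = 0 := hΘ0 x _ hlt.le
      rw [divergence, h1.fderiv_eq, (hsm x hx hlt).fderiv_eq, h2]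
      simp
    · have hpos := hs₀.trans_le hge
      rw [divergence_smul ((hθat x hx).differentiableAt one_ne_zero)
        ((h.contDiffAt_flux hx hV ht htT hpos).differentiableAt one_ne_zero),
        h.divergence_flux hx hV ht htT hpos]
  obtain ⟨D, hDc, hD⟩ := h.exists_hasDerivAt_time hr
  have hDc' : ContinuousOn (fun x => D (x, t)) (closedBall 0 r) :=
    hDc.comp (by fun_prop) fun x hx => ⟨hx, ht, htT⟩
  have hi1 : IntegrableOn (fun x => fderiv ℝ θ x (F x)) (ball 0 r) :=
    h.integrableOn_fderiv_flux hm hr hV ht htT hθ1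
  have hi2 : IntegrableOn (fun x => θ x * deriv (fun s => u x s) t) (ball 0 r) := by
    refine (((hθ1.continuousOn.mul hDc').integrableOn_compact (isCompact_closedBall _ _)).mono_set
      ball_subset_closedBall).congr_fun (fun x hx => ?_) measurableSet_ball
    rw [(hD x (ball_subset_closedBall hx) t ht htT).deriv]
    rfl
  have hzero := integral_divergence_ball_eq_zero (X := fun y => θ y • F y) hr
    (hθ1.continuousOn.smul hFc) hX1 (fun x hx => by
      have := h.noFlux x hx t ht htT
      rw [inner_smul_right] at this
      have h2 := (mul_eq_zero.1 this).resolve_left (by positivity)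
      simp only [inner_smul_right]
      rw [real_inner_comm]
      exact mul_eq_zero_of_right _ h2)
    ((hi1.add hi2).congr_fun (fun x hx => (hdiv x hx).symm) measurableSet_ball)
  rw [setIntegral_congr_fun measurableSet_ball hdiv, integral_add hi1 hi2] at hzero
  linarith

/-- The energy identity: the derivative in time of the integral of an antiderivative of `Θ`. -/
theorem hasDerivAt_energy (hm : 1 < m) (hr : 0 < r) (hV : ContDiff ℝ 1 V)
    {Θ : EuclideanSpace ℝ (Fin d) → ℝ → ℝ} {s₀ : ℝ} (hs₀ : 0 < s₀)
    (hΘc : Continuous (Function.uncurry Θ)) (hΘ0 : ∀ x, ∀ s ≤ s₀, Θ x s = 0)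
    (hΘ1 : ContDiffOn ℝ 1 (Function.uncurry Θ) (univ ×ˢ Ioi 0)) (ht : 0 < t)
    (htT : (t : EReal) < T) :
    HasDerivAt (fun t => ∫ x in ball 0 r, ∫ σ in (0 : ℝ)..u x t, Θ x σ)
      (- ∫ x in ball 0 r, fderiv ℝ (fun y => Θ y (u y t)) x (flux m ε r V u t x)) t := by
  rw [← h.integral_test_mul_deriv hm hr hV hs₀ hΘ0 hΘ1 ht htT]
  obtain ⟨D, hDc, hD⟩ := h.exists_hasDerivAt_time hr
  set I := {t : ℝ | 0 < t ∧ (t : EReal) < T} with hI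
  obtain ⟨δ, hδ, hδI⟩ := Metric.isOpen_iff.1 (isOpen_timeInterval T) t ⟨ht, htT⟩
  have hsub : closedBall t (δ / 2) ⊆ I :=
    (closedBall_subset_ball (by linarith)).trans hδI
  have hHc : Continuous fun p : EuclideanSpace ℝ (Fin d) × ℝ => ∫ σ in (0 : ℝ)..p.2, Θ p.1 σ :=
    intervalIntegral.continuous_parametric_intervalIntegral_of_continuous
      (f := fun (p : EuclideanSpace ℝ (Fin d) × ℝ) (σ : ℝ) => Θ p.1 σ)
      (hΘc.comp (by fun_prop : Continuous fun q : (EuclideanSpace ℝ (Fin d) × ℝ) × ℝ =>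
        (q.1.1, q.2))) continuous_snd
  have hslice : ∀ s ∈ I, ContinuousOn (fun x => u x s) (closedBall 0 r) := fun s hs =>
    (h.contDiffOn_slice hs.1 hs.2).continuousOn
  have hHs : ∀ s ∈ I, ContinuousOn (fun x => ∫ σ in (0 : ℝ)..u x s, Θ x σ) (closedBall 0 r) :=
    fun s hs => hHc.comp_continuousOn (continuousOn_id.prodMk (hslice s hs))
  have hint : ∀ {g : EuclideanSpace ℝ (Fin d) → ℝ}, ContinuousOn g (closedBall 0 r) →
      IntegrableOn g (ball 0 r) := fun hg =>
    (hg.integrableOn_compact (isCompact_closedBall _ _)).mono_set ball_subset_closedBall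
  have hder : ∀ x ∈ closedBall (0 : EuclideanSpace ℝ (Fin d)) r, ∀ s ∈ I,
      HasDerivAt (fun s => ∫ σ in (0 : ℝ)..u x s, Θ x σ) (Θ x (u x s) * D (x, s)) s := by
    intro x hx s hs
    have hc : Continuous fun σ => Θ x σ := hΘc.comp (by fun_prop : Continuous fun σ : ℝ => (x, σ))
    have h1 := (hc.integral_hasStrictDerivAt 0 (u x s)).hasDerivAt
    exact h1.comp s (hD x hx s hs.1 hs.2)
  -- A bound for the time derivative near `t`, uniform on the ball.
  have hcont : ContinuousOn (fun z : EuclideanSpace ℝ (Fin d) × ℝ => Θ z.1 (u z.1 z.2) * D z)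
      (closedBall 0 r ×ˢ I) :=
    (hΘc.comp_continuousOn (continuousOn_fst.prodMk h.smooth.continuousOn)).mul hDc
  obtain ⟨B, hB⟩ := ((isCompact_closedBall (0 : EuclideanSpace ℝ (Fin d)) r).prod
    (isCompact_closedBall t (δ / 2))).exists_bound_of_continuousOn
    (hcont.mono (prod_mono_right hsub))
  have hD' : ContinuousOn (fun x => Θ x (u x t) * D (x, t)) (closedBall 0 r) := by
    have h1 : ContinuousOn (fun x : EuclideanSpace ℝ (Fin d) => (x, t)) (closedBall 0 r) := by
      fun_prop
    exact hcont.comp h1 fun x hx => ⟨hx, ht, htT⟩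
  have k1 : ∀ᶠ s in 𝓝 t, AEStronglyMeasurable (fun x => ∫ σ in (0 : ℝ)..u x s, Θ x σ)
      (volume.restrict (ball 0 r)) := by
    filter_upwards [(isOpen_timeInterval T).mem_nhds ⟨ht, htT⟩] with s hs
    exact (hint (hHs s hs)).aestronglyMeasurable
  have k2 : ∀ᵐ x ∂(volume.restrict (ball (0 : EuclideanSpace ℝ (Fin d)) r)),
      ∀ s ∈ ball t (δ / 2), ‖Θ x (u x s) * D (x, s)‖ ≤ B := by
    filter_upwards [ae_restrict_mem measurableSet_ball] with x hx s hs
    exact hB (x, s) ⟨ball_subset_closedBall hx, ball_subset_closedBall hs⟩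
  have k3 : ∀ᵐ x ∂(volume.restrict (ball (0 : EuclideanSpace ℝ (Fin d)) r)),
      ∀ s ∈ ball t (δ / 2), HasDerivAt (fun s => ∫ σ in (0 : ℝ)..u x s, Θ x σ)
        (Θ x (u x s) * D (x, s)) s := by
    filter_upwards [ae_restrict_mem measurableSet_ball] with x hx s hs
    exact hder x (ball_subset_closedBall hx) s (hsub (ball_subset_closedBall hs))
  have k4 : Integrable (fun _ : EuclideanSpace ℝ (Fin d) => B) (volume.restrict (ball 0 r)) :=
    integrableOn_const (measure_ball_lt_top.ne)
  have key := hasDerivAt_integral_of_dominated_loc_of_deriv_le (μ := volume.restrict (ball 0 r))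
    (F := fun s x => ∫ σ in (0 : ℝ)..u x s, Θ x σ) (F' := fun s x => Θ x (u x s) * D (x, s))
    (bound := fun _ => B) (ball_mem_nhds t (half_pos hδ)) k1
    (hint (hHs t ⟨ht, htT⟩)) (hint hD').aestronglyMeasurable k2 k4 k3
  refine key.2.congr_deriv (setIntegral_congr_fun measurableSet_ball fun x hx => ?_)
  rw [(hD x (ball_subset_closedBall hx) t ht htT).deriv]

end IsSmoothNoFluxSolution

end DriftDiffusion

/-! ### Differential inequalities and conservation of mass -/

namespace DriftDiffusion

theorem le_add_mul_of_deriv_le {T : EReal} {E E' : ℝ → ℝ} {c L : ℝ}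
    (hE : ∀ t : ℝ, 0 < t → (t : EReal) < T → HasDerivAt E (E' t) t)
    (hE' : ∀ t : ℝ, 0 < t → (t : EReal) < T → E' t ≤ c)
    (hlim : Tendsto E (𝓝[>] 0) (𝓝 L)) {t : ℝ} (ht : 0 < t) (htT : (t : EReal) < T) :
    E t ≤ L + c * t := by
  have hT : ∀ s ≤ t, (s : EReal) < T := fun s hs => (EReal.coe_le_coe_iff.2 hs).trans_lt htT
  have hg : ∀ s ∈ Ioc (0 : ℝ) t, HasDerivAt (fun s => E s - c * s) (E' s - c) s := fun s hs => by
    have := (hE s hs.1 (hT s hs.2)).sub ((hasDerivAt_id s).const_mul c)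
    rw [mul_one] at this
    exact this
  have hanti : AntitoneOn (fun s => E s - c * s) (Ioc 0 t) := by
    refine antitoneOn_of_deriv_nonpos (convex_Ioc 0 t)
      (fun s hs => (hg s hs).continuousAt.continuousWithinAt)
      (fun s hs => (hg s (interior_subset hs)).differentiableAt.differentiableWithinAt) fun s hs => ?_
    rw [(hg s (interior_subset hs)).deriv]
    have hs' := interior_subset hs
    linarith [hE' s hs'.1 (hT s hs'.2)]
  have hlim2 : Tendsto (fun s => E s - c * s) (𝓝[>] 0) (𝓝 (L - c * 0)) :=
    hlim.sub (((continuous_const.mul continuous_id).tendsto (0 : ℝ)).mono_left nhdsWithin_le_nhds)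
  have hle : E t - c * t ≤ L - c * 0 := by
    refine ge_of_tendsto hlim2 ?_
    filter_upwards [Ioc_mem_nhdsGT ht] with s hs
    exact hanti hs ⟨ht, le_rfl⟩ hs.2
  linarith

/-- A linear dissipation inequality bounds a quantity that starts from zero, uniformly in time. -/
theorem le_div_of_deriv_le_neg_mul_add {T : EReal} {E E' : ℝ → ℝ} {k R : ℝ} (hk : 0 < k)
    (hR : 0 ≤ R)
    (hE : ∀ t : ℝ, 0 < t → (t : EReal) < T → HasDerivAt E (E' t) t)
    (hE' : ∀ t : ℝ, 0 < t → (t : EReal) < T → E' t ≤ - (k * E t) + R)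
    (hlim : Tendsto E (𝓝[>] 0) (𝓝 0)) {t : ℝ} (ht : 0 < t) (htT : (t : EReal) < T) :
    E t ≤ R / k := by
  have hexp : ∀ s : ℝ, HasDerivAt (fun s => Real.exp (k * s)) (Real.exp (k * s) * k) s := fun s => by
    have := ((hasDerivAt_id s).const_mul k).exp
    rw [mul_one] at this
    exact this
  have hlim2 : Tendsto (fun s => (E s - R / k) * Real.exp (k * s)) (𝓝[>] 0)
      (𝓝 ((0 - R / k) * Real.exp (k * 0))) := by
    refine (hlim.sub_const _).mul ?_
    exact ((by fun_prop : Continuous fun s : ℝ => Real.exp (k * s)).tendsto 0).mono_left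
      nhdsWithin_le_nhds
  have h := le_add_mul_of_deriv_le (T := T) (c := 0)
    (E := fun s => (E s - R / k) * Real.exp (k * s))
    (fun s hs hsT => ((hE s hs hsT).sub_const (R / k)).mul (hexp s)) (fun s hs hsT => by
      have h1 := hE' s hs hsT
      have h2 : E' s * Real.exp (k * s) + (E s - R / k) * (Real.exp (k * s) * k) =
          (E' s + k * E s - R) * Real.exp (k * s) := by field_simp; ring
      rw [h2]
      exact mul_nonpos_of_nonpos_of_nonneg (by linarith) (Real.exp_pos _).le) hlim2 ht htT
  have h3 : 0 ≤ R / k := by positivity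
  have h4 : (E t - R / k) * Real.exp (k * t) ≤ 0 := by
    refine h.trans ?_
    simp only [mul_zero, Real.exp_zero, mul_one, zero_mul, add_zero, zero_sub]
    linarith
  have h5 : E t - R / k ≤ 0 := by
    by_contra hcon
    exact absurd h4 (not_le.2 (mul_pos (not_le.1 hcon) (Real.exp_pos _)))
  linarith

/-- The test function `(1 - η / s)₊ ^ 2`, an approximation of the constant one that vanishes for
small densities. -/
noncomputable def massTest (η s : ℝ) : ℝ := max (1 - η / max s (η / 2)) 0 ^ 2

variable {η : ℝ}

theorem massTest_eq_zero (hη : 0 < η) {s : ℝ} (hs : s ≤ η) : massTest η s = 0 := by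
  have h1 : 0 < max s (η / 2) := lt_of_lt_of_le (by linarith) (le_max_right _ _)
  have h2 : 1 ≤ η / max s (η / 2) := by
    rw [le_div_iff₀ h1, one_mul]; exact max_le hs (by linarith)
  rw [massTest, max_eq_right (by linarith), zero_pow two_ne_zero]

theorem massTest_eq (hη : 0 < η) {s : ℝ} (hs : 0 < s) : massTest η s = max (1 - η / s) 0 ^ 2 := by
  rcases le_total s η with h | h
  · rw [massTest_eq_zero hη h, max_eq_right, zero_pow two_ne_zero]
    have : 1 ≤ η / s := by rw [le_div_iff₀ hs]; linarith
    linarith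
  · rw [massTest, max_eq_left (by linarith : η / 2 ≤ s)]

theorem continuous_massTest (hη : 0 < η) : Continuous (massTest η) := by
  unfold massTest
  refine Continuous.pow (Continuous.max (continuous_const.sub (continuous_const.div (by fun_prop)
    fun s => ?_)) continuous_const) 2
  exact (lt_of_lt_of_le (by linarith) (le_max_right s (η / 2))).ne'

theorem massTest_nonneg (s : ℝ) : 0 ≤ massTest η s := sq_nonneg _

theorem massTest_le_one (hη : 0 < η) (s : ℝ) : massTest η s ≤ 1 := by
  have h1 : 0 < max s (η / 2) := lt_of_lt_of_le (by linarith) (le_max_right _ _)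
  refine pow_le_one₀ (le_max_right _ _) (max_le ?_ zero_le_one)
  have : 0 ≤ η / max s (η / 2) := by positivity
  linarith

theorem hasDerivAt_massTest (hη : 0 < η) {s : ℝ} (hs : 0 < s) :
    HasDerivAt (massTest η) (2 * max (1 - η / s) 0 * (η / s ^ 2)) s := by
  have h1 : HasDerivAt (fun s : ℝ => 1 - η / s) (η / s ^ 2) s := by
    have := ((hasDerivAt_inv hs.ne').const_mul η).const_sub 1
    simp only [div_eq_mul_inv]
    refine this.congr_deriv ?_
    ring
  have h2 := (hasDerivAt_max_zero_pow 0 _).comp s h1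
  have h3 : massTest η =ᶠ[𝓝 s] (fun x : ℝ => max x 0 ^ (0 + 2)) ∘ fun s => 1 - η / s := by
    filter_upwards [lt_mem_nhds hs] with y hy
    exact massTest_eq hη hy
  refine (h2.congr_of_eventuallyEq h3).congr_deriv ?_
  push_cast; ring

theorem contDiffOn_massTest (hη : 0 < η) : ContDiffOn ℝ 1 (massTest η) (Ioi 0) := by
  rw [contDiffOn_one_iff_derivWithin isOpen_Ioi.uniqueDiffOn]
  refine ⟨fun s hs => (hasDerivAt_massTest hη hs).differentiableAt.differentiableWithinAt, ?_⟩
  have : ContinuousOn (fun s : ℝ => 2 * max (1 - η / s) 0 * (η / s ^ 2)) (Ioi 0) := by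
    have h0 : ∀ s ∈ Ioi (0 : ℝ), s ≠ 0 := fun s hs => ne_of_gt hs
    have h1 : ContinuousOn (fun s : ℝ => η / s) (Ioi 0) :=
      continuousOn_const.div continuousOn_id h0
    have h2 : ContinuousOn (fun s : ℝ => η / s ^ 2) (Ioi 0) :=
      continuousOn_const.div (by fun_prop) fun s hs => pow_ne_zero _ (h0 s hs)
    have h3 : ContinuousOn (fun s : ℝ => max (1 - η / s) 0) (Ioi 0) :=
      (continuousOn_const.sub h1).sup continuousOn_const
    exact (continuousOn_const.mul h3).mul h2
  refine this.congr fun s hs => ?_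
  rw [(hasDerivAt_massTest hη hs).hasDerivWithinAt.derivWithin (isOpen_Ioi.uniqueDiffWithinAt hs)]

theorem abs_integral_massTest_sub_le (hη : 0 < η) (a b : ℝ) :
    |(∫ σ in (0 : ℝ)..b, massTest η σ) - ∫ σ in (0 : ℝ)..a, massTest η σ| ≤ |b - a| := by
  have hi : ∀ x y : ℝ, IntervalIntegrable (massTest η) volume x y := fun x y =>
    (continuous_massTest hη).intervalIntegrable x y
  rw [intervalIntegral.integral_interval_sub_left (hi _ _) (hi _ _)]
  have := intervalIntegral.norm_integral_le_of_norm_le_const (f := massTest η) (a := a) (b := b)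
    (C := 1) fun s _ => by
      rw [Real.norm_of_nonneg (massTest_nonneg _)]; exact massTest_le_one hη s
  simpa using this

/-- With `η = ρ ^ 2` the test function is at least `(1 - ρ) ^ 2` from `ρ` on. -/
theorem le_integral_massTest {ρ s : ℝ} (hρ : 0 < ρ) (hρ1 : ρ < 1) (hs : 0 ≤ s) :
    (s - ρ) * (1 - ρ) ^ 2 ≤ ∫ σ in (0 : ℝ)..s, massTest (ρ ^ 2) σ := by
  have hη : 0 < ρ ^ 2 := by positivity
  have hi : ∀ x y : ℝ, IntervalIntegrable (massTest (ρ ^ 2)) volume x y := fun x y =>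
    (continuous_massTest hη).intervalIntegrable x y
  rcases le_total s ρ with h | h
  · refine le_trans ?_ (intervalIntegral.integral_nonneg hs fun _ _ => massTest_nonneg _)
    exact mul_nonpos_of_nonpos_of_nonneg (by linarith) (sq_nonneg _)
  · have h2 : ∫ σ in ρ..s, massTest (ρ ^ 2) σ ≤ ∫ σ in (0 : ℝ)..s, massTest (ρ ^ 2) σ :=
      intervalIntegral.integral_mono_interval hρ.le h le_rfl
        (ae_of_all _ fun σ => massTest_nonneg _) (hi _ _)
    refine le_trans ?_ h2
    have h1 := intervalIntegral.integral_mono_on h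
      (intervalIntegrable_const (c := (1 - ρ) ^ 2)) (hi ρ s) fun σ hσ => by
        have hσ0 : 0 < σ := hρ.trans_le hσ.1
        rw [massTest_eq hη hσ0]
        refine pow_le_pow_left₀ (by linarith) (le_max_of_le_left ?_) 2
        have : ρ ^ 2 / σ ≤ ρ := by
          rw [div_le_iff₀ hσ0, sq]; exact mul_le_mul_of_nonneg_left hσ.1 hρ.le
        linarith
    simpa using h1

namespace IsSmoothNoFluxSolution

variable {d : ℕ} {m ε r t : ℝ} {T : EReal}
  {V : EuclideanSpace ℝ (Fin d) → EuclideanSpace ℝ (Fin d)}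
  {u₀ : EuclideanSpace ℝ (Fin d) → ℝ} {u : EuclideanSpace ℝ (Fin d) → ℝ → ℝ}
  (h : IsSmoothNoFluxSolution m ε r T V u₀ u)

include h

/-- The initial datum is attained in `L¹`; this is all that is known about the limit `t → 0`. -/
theorem tendsto_integral_of_abs_le {g : ℝ → EuclideanSpace ℝ (Fin d) → ℝ}
    (hg : ∀ᶠ t in 𝓝[>] 0, ∀ᵐ x ∂(volume.restrict (ball (0 : EuclideanSpace ℝ (Fin d)) r)),
      |g t x| ≤ |u x t - u₀ x|) :
    Tendsto (fun t => ∫ x in ball 0 r, g t x) (𝓝[>] 0) (𝓝 0) := by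
  rw [tendsto_zero_iff_enorm_tendsto_zero]
  refine tendsto_of_tendsto_of_tendsto_of_le_of_le' tendsto_const_nhds h.initial_tendsto
    (Eventually.of_forall fun _ => bot_le) ?_
  filter_upwards [hg] with t ht
  rw [eLpNorm_one_eq_lintegral_enorm]
  refine (enorm_integral_le_lintegral_enorm _).trans (lintegral_mono_ae ?_)
  filter_upwards [ht] with x hx
  rw [Real.enorm_eq_ofReal_abs, Real.enorm_eq_ofReal_abs]
  exact ENNReal.ofReal_le_ofReal hx

omit h in
theorem integrableOn_of_continuousOn {g : EuclideanSpace ℝ (Fin d) → ℝ}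
    (hg : ContinuousOn g (closedBall 0 r)) : IntegrableOn g (ball 0 r) :=
  (hg.integrableOn_compact (isCompact_closedBall _ _)).mono_set ball_subset_closedBall

omit h in
theorem flux_eq (hm : 1 < m) {x : EuclideanSpace ℝ (Fin d)} (hx : x ∈ ball 0 r)
    (hu : DifferentiableAt ℝ (fun y => u y t) x) :
    flux m ε r V u t x = (m * u x t ^ (m - 1) + ε) • gradient (fun y => u y t) x + u x t • V x := by
  rw [(flux_eventuallyEq hx).eq_of_nhds]
  congr 1
  refine HasGradientAt.gradient ?_
  rw [hasGradientAt_iff_hasFDerivAt, map_smul]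
  exact (hasDerivAt_phi hm (u x t)).comp_hasFDerivAt x hu.hasGradientAt.hasFDerivAt

/-- The truncation makes the drift term of the size of `η`: the slope of the test function is of
order `η / u ^ 2`, and the drift term is absorbed by the linear diffusion `ε Δu`. -/
theorem neg_fderiv_massTest_le (hm : 1 < m) (hε : 0 < ε) (hη : 0 < η) {K : ℝ}
    {x : EuclideanSpace ℝ (Fin d)} (hx : x ∈ ball 0 r) (hK : ‖V x‖ ≤ K)
    (ht : 0 < t) (htT : (t : EReal) < T) :
    - fderiv ℝ (fun y => massTest η (u y t)) x (flux m ε r V u t x) ≤ η * (K ^ 2 / (2 * ε)) := by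
  have hu := h.contDiffAt_slice hx ht htT
  have hud := hu.differentiableAt (by simp)
  have hK0 : 0 ≤ η * (K ^ 2 / (2 * ε)) := by positivity
  rcases lt_or_ge (u x t) η with hlt | hge
  · have hev : (fun y => massTest η (u y t)) =ᶠ[𝓝 x] fun _ => 0 := by
      filter_upwards [hu.continuousAt.eventually (gt_mem_nhds hlt)] with y hy
      exact massTest_eq_zero hη hy.le
    rw [hev.fderiv_eq]; simpa using hK0
  have hpos := hη.trans_le hge
  have h1 := (hasDerivAt_massTest hη hpos).comp_hasFDerivAt x hud.hasFDerivAt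
  have h2 : HasFDerivAt (fun y => massTest η (u y t)) _ x := h1
  rw [h2.fderiv, flux_eq hm hx hud]
  set G := gradient (fun y => u y t) x with hG
  set s := u x t with hs
  have hGi : ∀ v, fderiv ℝ (fun y => u y t) x v = inner ℝ G v := fun v => by
    rw [hG, gradient, InnerProductSpace.toDual_symm_apply]
  set P := max (1 - η / s) 0 with hP
  have hP0 : 0 ≤ P := le_max_right _ _
  have hP1 : P ≤ 1 := max_le (by have : 0 ≤ η / s := by positivity
                                 linarith) zero_le_one
  rw [_root_.smul_apply, hGi, inner_add_right, inner_smul_right, inner_smul_right,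
    real_inner_self_eq_norm_sq, smul_eq_mul]
  have hin : -(‖G‖ * K) ≤ inner ℝ G (V x) := by
    have := abs_real_inner_le_norm G (V x)
    have h3 := (abs_le.1 this).1
    have h4 : ‖G‖ * ‖V x‖ ≤ ‖G‖ * K := by gcongr
    linarith
  have hφ : ε ≤ m * s ^ (m - 1) + ε := by
    have : 0 ≤ m * s ^ (m - 1) := by positivity
    linarith
  have hcore : -(s ^ 2 * K ^ 2 / (4 * ε)) ≤
      (m * s ^ (m - 1) + ε) * ‖G‖ ^ 2 + s * inner ℝ G (V x) := by
    have a1 : ε * ‖G‖ ^ 2 ≤ (m * s ^ (m - 1) + ε) * ‖G‖ ^ 2 := by gcongr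
    have a2 : s * -(‖G‖ * K) ≤ s * inner ℝ G (V x) := by gcongr
    have a3 : s * ‖G‖ * K ≤ ε * ‖G‖ ^ 2 + s ^ 2 * K ^ 2 / (4 * ε) := by
      have : 0 ≤ (2 * ε * ‖G‖ - s * K) ^ 2 / (4 * ε) := by positivity
      have e : (2 * ε * ‖G‖ - s * K) ^ 2 / (4 * ε) =
          ε * ‖G‖ ^ 2 + s ^ 2 * K ^ 2 / (4 * ε) - s * ‖G‖ * K := by field_simp; ring
      linarith
    linarith
  have hcoef : 0 ≤ 2 * P * (η / s ^ 2) := by positivity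
  calc -(2 * P * (η / s ^ 2) * ((m * s ^ (m - 1) + ε) * ‖G‖ ^ 2 + s * inner ℝ G (V x)))
      ≤ 2 * P * (η / s ^ 2) * (s ^ 2 * K ^ 2 / (4 * ε)) := by
        have := mul_le_mul_of_nonneg_left hcore hcoef
        linarith
    _ = P * (η * (K ^ 2 / (2 * ε))) := by field_simp; ring
    _ ≤ 1 * (η * (K ^ 2 / (2 * ε))) := by gcongr
    _ = _ := one_mul _

/-- The mass does not increase. The truncated masses may grow, at a rate which depends on the
drift and on `ε`, but vanishes with the truncation. -/
theorem integral_le (hm : 1 < m) (hε : 0 < ε) (hr : 0 < r) (hV : ContDiff ℝ 1 V)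
    (hu₀ : IntegrableOn u₀ (ball 0 r)) (hu₀n : ∀ᵐ x, 0 ≤ u₀ x) (ht : 0 < t) (htT : (t : EReal) < T) :
    ∫ x in ball 0 r, u x t ≤ ∫ x in ball 0 r, u₀ x := by
  obtain ⟨K, hK⟩ := (isCompact_closedBall (0 : EuclideanSpace ℝ (Fin d)) r).exists_bound_of_continuousOn
    hV.continuous.continuousOn
  set b := volume.real (ball (0 : EuclideanSpace ℝ (Fin d)) r) with hb
  have hut := integrableOn_of_continuousOn (h.contDiffOn_slice ht htT).continuousOn
  -- The truncation is at `η = ρ ^ 2`, and `ρ` tends to zero at fixed `ε`.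
  have hstep : ∀ ρ ∈ Ioo (0 : ℝ) 1, ((∫ x in ball 0 r, u x t) - ρ * b) * (1 - ρ) ^ 2 ≤
      (∫ x in ball 0 r, u₀ x) + b * (ρ ^ 2 * (K ^ 2 / (2 * ε))) * t := by
    intro ρ hρ
    have hη : 0 < ρ ^ 2 := pow_pos hρ.1 2
    set H : ℝ → ℝ := fun s => ∫ σ in (0 : ℝ)..s, massTest (ρ ^ 2) σ with hH
    have hHL : ∀ a b, |H b - H a| ≤ |b - a| := abs_integral_massTest_sub_le hη
    have hH0 : H 0 = 0 := by simp [hH]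
    have hHc : Continuous H :=
      (intervalIntegral.differentiable_integral_of_continuous (continuous_massTest hη)).continuous
    have hHi : ∀ s : ℝ, 0 < s → (s : EReal) < T →
        IntegrableOn (fun x => H (u x s)) (ball 0 r) := fun s hs hsT =>
      integrableOn_of_continuousOn
        (hHc.comp_continuousOn (h.contDiffOn_slice hs hsT).continuousOn)
    have hHu₀ : IntegrableOn (fun x => H (u₀ x)) (ball 0 r) := by
      refine Integrable.mono' hu₀.norm (hHc.comp_aestronglyMeasurable hu₀.aestronglyMeasurable)
        (ae_of_all _ fun x => ?_)
      have := hHL 0 (u₀ x)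
      rw [hH0, sub_zero, sub_zero] at this
      exact this
    have hder : ∀ s : ℝ, 0 < s → (s : EReal) < T → HasDerivAt (fun s => ∫ x in ball 0 r, H (u x s))
        (- ∫ x in ball 0 r, fderiv ℝ (fun y => massTest (ρ ^ 2) (u y s)) x (flux m ε r V u s x)) s :=
      fun s hs hsT => h.hasDerivAt_energy (Θ := fun _ => massTest (ρ ^ 2)) hm hr hV hη
        ((continuous_massTest hη).comp continuous_snd) (fun _ _ => massTest_eq_zero hη)
        ((contDiffOn_massTest hη).comp contDiffOn_snd fun p hp => hp.2) hs hsT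
    have hder' : ∀ s : ℝ, 0 < s → (s : EReal) < T →
        - ∫ x in ball 0 r, fderiv ℝ (fun y => massTest (ρ ^ 2) (u y s)) x (flux m ε r V u s x) ≤
        b * (ρ ^ 2 * (K ^ 2 / (2 * ε))) := by
      intro s hs hsT
      rw [← integral_neg]
      have hc0 : 0 ≤ ρ ^ 2 * (K ^ 2 / (2 * ε)) := by positivity
      have h1 : ∫ x in ball (0 : EuclideanSpace ℝ (Fin d)) r,
          - fderiv ℝ (fun y => massTest (ρ ^ 2) (u y s)) x (flux m ε r V u s x) ≤
          ∫ x in ball (0 : EuclideanSpace ℝ (Fin d)) r, ρ ^ 2 * (K ^ 2 / (2 * ε)) := by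
        refine setIntegral_mono_on (h.integrableOn_fderiv_flux hm hr hV hs hsT ?_).neg
          (integrableOn_const measure_ball_lt_top.ne) measurableSet_ball fun x hx =>
            h.neg_fderiv_massTest_le hm hε hη hx (hK x (ball_subset_closedBall hx)) hs hsT
        exact h.contDiffOn_comp (Φ := fun _ => massTest (ρ ^ 2)) hη (fun _ _ => massTest_eq_zero hη)
          ((contDiffOn_massTest hη).comp contDiffOn_snd fun p hp => hp.2) hs hsT
      refine h1.trans (le_of_eq ?_)
      simp [hb]
    have hlim : Tendsto (fun s => ∫ x in ball 0 r, H (u x s)) (𝓝[>] 0)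
        (𝓝 (∫ x in ball 0 r, H (u₀ x))) := by
      have h1 := h.tendsto_integral_of_abs_le (g := fun s x => H (u x s) - H (u₀ x))
        (Eventually.of_forall fun s => ae_of_all _ fun x => hHL _ _)
      have h2 := h1.add_const (∫ x in ball 0 r, H (u₀ x))
      rw [zero_add] at h2
      refine h2.congr' ?_
      have hI : ∀ᶠ s in 𝓝[>] (0 : ℝ), s ∈ Ioc 0 t := Ioc_mem_nhdsGT ht
      filter_upwards [hI] with s hs
      rw [integral_sub (hHi s hs.1 ((EReal.coe_le_coe_iff.2 hs.2).trans_lt htT)) hHu₀,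
        sub_add_cancel]
    have h3 := le_add_mul_of_deriv_le hder hder' hlim ht htT
    have h4 : ((∫ x in ball 0 r, u x t) - ρ * b) * (1 - ρ) ^ 2 ≤ ∫ x in ball 0 r, H (u x t) := by
      have h5 : ∫ x in ball (0 : EuclideanSpace ℝ (Fin d)) r, (u x t - ρ) * (1 - ρ) ^ 2 ≤
          ∫ x in ball 0 r, H (u x t) := by
        refine setIntegral_mono_on ?_ (hHi t ht htT) measurableSet_ball fun x hx => ?_
        · exact (hut.sub (integrableOn_const measure_ball_lt_top.ne)).mul_const _
        · exact le_integral_massTest hρ.1 hρ.2 (h.nonneg x (ball_subset_closedBall hx) t ht htT)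
      refine le_trans (le_of_eq ?_) h5
      rw [integral_mul_const, integral_sub hut (integrableOn_const measure_ball_lt_top.ne)]
      simp [hb, mul_comm]
    have h6 : ∫ x in ball 0 r, H (u₀ x) ≤ ∫ x in ball 0 r, u₀ x := by
      refine integral_mono_ae hHu₀ hu₀ ?_
      filter_upwards [ae_restrict_of_ae hu₀n] with x hx
      have := hHL 0 (u₀ x)
      rw [hH0, sub_zero, sub_zero, abs_of_nonneg hx] at this
      exact (le_abs_self _).trans this
    linarith
  have hl1 : Tendsto (fun ρ : ℝ => ((∫ x in ball 0 r, u x t) - ρ * b) * (1 - ρ) ^ 2) (𝓝[>] 0)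
      (𝓝 (((∫ x in ball 0 r, u x t) - 0 * b) * (1 - 0) ^ 2)) :=
    (Continuous.tendsto (by fun_prop) 0).mono_left nhdsWithin_le_nhds
  have hl2 : Tendsto (fun ρ : ℝ => (∫ x in ball 0 r, u₀ x) + b * (ρ ^ 2 * (K ^ 2 / (2 * ε))) * t)
      (𝓝[>] 0) (𝓝 ((∫ x in ball 0 r, u₀ x) + b * (0 ^ 2 * (K ^ 2 / (2 * ε))) * t)) :=
    (Continuous.tendsto (by fun_prop) 0).mono_left nhdsWithin_le_nhds
  have hfin := le_of_tendsto_of_tendsto hl1 hl2 (by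
    filter_upwards [Ioo_mem_nhdsGT (zero_lt_one' ℝ)] with ρ hρ using hstep ρ hρ)
  simpa using hfin

end IsSmoothNoFluxSolution

end DriftDiffusion

/-! ### The energy inequality above a level -/

namespace DriftDiffusion

open Real (exp log)

theorem contDiffOn_comp_levelTau {d : ℕ} {m ε Ω κ : ℝ} (hm : 1 < m) (hε : 0 < ε)
    {W : EuclideanSpace ℝ (Fin d) → ℝ} (hW : ContDiff ℝ 1 W) (hWΩ : ∀ x, |W x| ≤ Ω)
    (hκ : Ω + 1 ≤ κ) {f : ℝ → ℝ} (hf : ContDiff ℝ 1 f) (hf0 : ∀ τ ≤ κ, f τ = 0) :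
    ContDiffOn ℝ 1 (Function.uncurry fun x s => f (levelTau m ε (W x) s)) (univ ×ˢ Ioi 0) := by
  rintro ⟨x, s⟩ ⟨-, hs⟩
  refine ContDiffAt.contDiffWithinAt ?_
  have h1 : 1 < exp (κ - Ω) := Real.one_lt_exp_iff.2 (by linarith)
  rcases lt_or_ge s (exp (κ - Ω)) with hlt | hge
  · have hev : (Function.uncurry fun x s => f (levelTau m ε (W x) s)) =ᶠ[𝓝 (x, s)] fun _ => 0 := by
      filter_upwards [continuous_snd.continuousAt.eventually (gt_mem_nhds hlt)] with p hp
      exact hf0 _ (levelTau_le_of_le hm hε (hWΩ _) (by linarith) (le_of_lt hp))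
    exact contDiffAt_const.congr_of_eventuallyEq hev
  · have hs1 : 1 < s := h1.trans_le hge
    have hev : (Function.uncurry fun x s => f (levelTau m ε (W x) s)) =ᶠ[𝓝 (x, s)]
        fun p => f (logPressureInv m ε (logPressure m ε (log p.2) + W p.1)) := by
      filter_upwards [continuous_snd.continuousAt.eventually (lt_mem_nhds hs1)] with p hp
      have hp' : 1 < p.2 := hp
      simp only [Function.uncurry, levelTau, logShift, max_eq_left hp'.le]
    refine ContDiffAt.congr_of_eventuallyEq ?_ hev
    have hlog : ContDiffAt ℝ 1 (fun p : EuclideanSpace ℝ (Fin d) × ℝ => log p.2) (x, s) :=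
      contDiffAt_snd.log (by simp only; linarith)
    refine hf.contDiffAt.comp _ (((contDiff_logPressureInv hm hε).of_le (by simp)).contDiffAt.comp _ ?_)
    exact ((contDiff_logPressure.of_le (by simp)).contDiffAt.comp _ hlog).add
      (hW.contDiffAt.comp _ contDiffAt_fst)

theorem levelRoot_eq_zero {α κ τ : ℝ} (hα : 0 < α) (h : τ ≤ κ) : levelRoot α κ τ = 0 := by
  rw [levelRoot, profile_eq_zero hα h]; ring

namespace IsSmoothNoFluxSolution

variable {d : ℕ} {m ε r t Ω κ α : ℝ} {T : EReal}
  {V : EuclideanSpace ℝ (Fin d) → EuclideanSpace ℝ (Fin d)} {W : EuclideanSpace ℝ (Fin d) → ℝ}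
  {u₀ : EuclideanSpace ℝ (Fin d) → ℝ} {u : EuclideanSpace ℝ (Fin d) → ℝ → ℝ}
  (h : IsSmoothNoFluxSolution m ε r T V u₀ u)

include h

/-- In terms of the shifted logarithm `τ` the flux is `u (Ψ'(τ) ∇τ + V - ∇W)`, with `Ψ` the
logarithmic pressure: the potential part of the drift has been absorbed. -/
theorem exists_hasFDerivAt_levelTau (hm : 1 < m) (hε : 0 < ε) (hW : ContDiff ℝ 1 W)
    {x : EuclideanSpace ℝ (Fin d)} (hx : x ∈ ball 0 r) (ht : 0 < t) (htT : (t : EReal) < T)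
    (hu1 : 1 < u x t) : ∃ G : EuclideanSpace ℝ (Fin d),
      HasFDerivAt (fun y => levelTau m ε (W y) (u y t)) (innerSL ℝ G) x ∧
      flux m ε r V u t x = u x t •
        (logPressureDeriv m ε (levelTau m ε (W x) (u x t)) • G + (V x - gradient W x)) := by
  have hu := h.contDiffAt_slice hx ht htT
  have hud := hu.differentiableAt (by simp)
  have hpos : 0 < u x t := by linarith
  set g := gradient (fun y => u y t) x with hg
  have hg1 : HasFDerivAt (fun y => u y t) (innerSL ℝ g) x := hud.hasGradientAt.hasFDerivAt
  have hW1 : HasFDerivAt W (innerSL ℝ (gradient W x)) x :=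
    (hW.differentiable one_ne_zero x).hasGradientAt.hasFDerivAt
  have hev : (fun y => levelTau m ε (W y) (u y t)) =ᶠ[𝓝 x]
      fun y => logPressureInv m ε (logPressure m ε (log (u y t)) + W y) := by
    filter_upwards [hu.continuousAt.eventually (lt_mem_nhds hu1)] with y hy
    simp only [levelTau, logShift, max_eq_left hy.le]
  set τ := levelTau m ε (W x) (u x t) with hτ
  have hτe : τ = logPressureInv m ε (logPressure m ε (log (u x t)) + W x) := hev.eq_of_nhds
  have hlog := hg1.log hpos.ne'
  have hz := ((hasDerivAt_logPressure (ε := ε) hm (log (u x t))).comp_hasFDerivAt x hlog).add hW1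
  have hΛ := (hasDerivAt_logPressureInv hm hε (logPressure m ε (log (u x t)) + W x)).comp_hasFDerivAt
    x hz
  rw [← hτe] at hΛ
  have hD := logPressureDeriv_pos hm hε τ
  refine ⟨(logPressureDeriv m ε τ)⁻¹ •
    ((logPressureDeriv m ε (log (u x t)) * (u x t)⁻¹) • g + gradient W x), ?_, ?_⟩
  · refine HasFDerivAt.congr_of_eventuallyEq (hΛ.congr_fderiv ?_) hev
    ext v
    simp
    left; ring
  · rw [flux_eq hm hx hud, smul_inv_smul₀ hD.ne']
    have e1 : logPressureDeriv m ε (log (u x t)) = m * u x t ^ (m - 1) + ε := by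
      rw [logPressureDeriv, Real.rpow_def_of_pos hpos, mul_comm (log (u x t))]
    rw [e1, add_assoc, add_sub_cancel, smul_add, smul_smul]
    congr 2
    field_simp

/-- The pointwise form of the energy inequality above the level `κ`. -/
theorem neg_fderiv_levelTest_le (hm : 1 < m) (hε : 0 < ε) (hW : ContDiff ℝ 1 W)
    (hWΩ : ∀ x, |W x| ≤ Ω) (hκ : Ω + 1 ≤ κ) (hα : 0 < α) (hα1 : α ≤ 1) (hαm : α ≤ m - 1)
    {x : EuclideanSpace ℝ (Fin d)} (hx : x ∈ ball 0 r) (ht : 0 < t) (htT : (t : EReal) < T) :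
    - fderiv ℝ (fun y => levelTest α κ (levelTau m ε (W y) (u y t))) x (flux m ε r V u t x) ≤
      - (3 * α / 8 * exp (-Ω) *
        ‖fderiv ℝ (fun y => levelRoot α κ (levelTau m ε (W y) (u y t))) x‖ ^ 2) +
      {y | κ < levelTau m ε (W y) (u y t)}.indicator (fun y => 6 * exp Ω * exp (1 / α) *
        (levelRoot α κ (levelTau m ε (W y) (u y t)) ^ 2 + exp κ) * ‖V y - gradient W y‖ ^ 2) x := by
  have hΩ : 0 ≤ Ω := (abs_nonneg _).trans (hWΩ x)
  have h1 : 1 < exp (κ - Ω) := Real.one_lt_exp_iff.2 (by linarith)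
  have hu := h.contDiffAt_slice hx ht htT
  have hind : 0 ≤ {y | κ < levelTau m ε (W y) (u y t)}.indicator (fun y => 6 * exp Ω * exp (1 / α) *
        (levelRoot α κ (levelTau m ε (W y) (u y t)) ^ 2 + exp κ) * ‖V y - gradient W y‖ ^ 2) x :=
    indicator_nonneg (fun y _ => by positivity) x
  rcases lt_or_ge (u x t) (exp (κ - Ω)) with hlt | hge
  · have hev : ∀ᶠ y in 𝓝 x, levelTau m ε (W y) (u y t) ≤ κ := by
      filter_upwards [hu.continuousAt.eventually (gt_mem_nhds hlt)] with y hy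
      exact levelTau_le_of_le hm hε (hWΩ _) (by linarith) (le_of_lt hy)
    have e1 : (fun y => levelTest α κ (levelTau m ε (W y) (u y t))) =ᶠ[𝓝 x] fun _ => 0 := by
      filter_upwards [hev] with y hy using levelTest_eq_zero hα hy
    have e2 : (fun y => levelRoot α κ (levelTau m ε (W y) (u y t))) =ᶠ[𝓝 x] fun _ => 0 := by
      filter_upwards [hev] with y hy using levelRoot_eq_zero hα hy
    rw [e1.fderiv_eq, e2.fderiv_eq]
    simpa using hind
  obtain ⟨G, hG, hflux⟩ := h.exists_hasFDerivAt_levelTau hm hε hW hx ht htT (h1.trans_le hge)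
  set τ := levelTau m ε (W x) (u x t) with hτ
  have d1' := (hasDerivAt_levelTest (α := α) (κ := κ) τ).comp_hasFDerivAt x hG
  have d2' := (hasDerivAt_levelRoot (α := α) (κ := κ) τ).comp_hasFDerivAt x hG
  have d1 : HasFDerivAt (fun y => levelTest α κ (levelTau m ε (W y) (u y t)))
      (levelTestDeriv α κ τ • innerSL ℝ G) x := d1'
  have d2 : HasFDerivAt (fun y => levelRoot α κ (levelTau m ε (W y) (u y t)))
      (levelRootDeriv α κ τ • innerSL ℝ G) x := d2'
  rw [d1.fderiv, d2.fderiv, norm_smul, innerSL_apply_norm, _root_.smul_apply, innerSL_apply_apply,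
    hflux, smul_eq_mul]
  rcases le_or_gt τ κ with hle | hgt
  · have p0 := profile_eq_zero (α := α) hα hle
    have z1 : levelTestDeriv α κ τ = 0 := by rw [levelTestDeriv, p0]; ring
    have z2 : levelRootDeriv α κ τ = 0 := by rw [levelRootDeriv, p0]; ring
    rw [z1, z2]
    simpa using hind
  have hux : 0 < u x t := by linarith
  have hin : {y | κ < levelTau m ε (W y) (u y t)}.indicator (fun y => 6 * exp Ω * exp (1 / α) *
        (levelRoot α κ (levelTau m ε (W y) (u y t)) ^ 2 + exp κ) * ‖V y - gradient W y‖ ^ 2) x =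
        6 * exp Ω * exp (1 / α) * (levelRoot α κ τ ^ 2 + exp κ) * ‖V x - gradient W x‖ ^ 2 :=
    indicator_of_mem (show x ∈ {y | κ < levelTau m ε (W y) (u y t)} from hgt) _
  rw [hin]
  set B := V x - gradient W x with hB
  have hτ2 : τ = logShift m ε (W x) (log (u x t)) := by
    rw [hτ, levelTau, max_eq_left (by linarith)]
  have hy : |τ - log (u x t)| ≤ Ω := by
    rw [hτ2]
    exact abs_logShift_sub_le hm hε (hWΩ x) (by rw [← hτ2]; linarith)
  have hkey := levelRootDeriv_sq_le hm hε hΩ (by linarith : Ω ≤ κ) hα hα1 hαm (G := ‖G‖) (B := ‖B‖)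
    hy hgt
  rw [Real.exp_log hux] at hkey
  have hD := logPressureDeriv_pos hm hε τ
  have hT0 : 0 ≤ levelTestDeriv α κ τ := by
    have := profile_nonneg (α := α) (κ := κ) τ
    unfold levelTestDeriv; positivity
  set Ψ' := logPressureDeriv m ε τ with hΨ
  have hyoung : Ψ' / 2 * ‖G‖ ^ 2 - ‖B‖ ^ 2 / (2 * Ψ') ≤ inner ℝ G (Ψ' • G + B) := by
    rw [inner_add_right, inner_smul_right, real_inner_self_eq_norm_sq]
    have a1 := (abs_le.1 (abs_real_inner_le_norm G B)).1
    have a2 : 0 ≤ (Ψ' * ‖G‖ - ‖B‖) ^ 2 / (2 * Ψ') := by positivity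
    have a3 : (Ψ' * ‖G‖ - ‖B‖) ^ 2 / (2 * Ψ') =
        Ψ' / 2 * ‖G‖ ^ 2 + ‖B‖ ^ 2 / (2 * Ψ') - ‖G‖ * ‖B‖ := by field_simp; ring
    linarith
  have hcoef : 0 ≤ u x t * levelTestDeriv α κ τ := by positivity
  have hmul := mul_le_mul_of_nonneg_left hyoung hcoef
  rw [inner_smul_right]
  have e3 : (‖levelRootDeriv α κ τ‖ * ‖G‖) ^ 2 = (levelRootDeriv α κ τ * ‖G‖) ^ 2 := by
    rw [mul_pow, mul_pow, Real.norm_eq_abs, sq_abs]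
  rw [e3]
  linarith

theorem continuousOn_levelTau (hm : 1 < m) (hε : 0 < ε) (hW : ContDiff ℝ 1 W) (ht : 0 < t)
    (htT : (t : EReal) < T) :
    ContinuousOn (fun x => levelTau m ε (W x) (u x t)) (closedBall 0 r) := by
  have h1 : ContinuousOn (fun x => (W x, u x t)) (closedBall 0 r) :=
    hW.continuous.continuousOn.prodMk (h.contDiffOn_slice ht htT).continuousOn
  have h2 := (continuous_levelTau hm hε).comp_continuousOn h1
  exact h2

theorem isOpen_superlevel (hm : 1 < m) (hε : 0 < ε) (hW : ContDiff ℝ 1 W) (ht : 0 < t)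
    (htT : (t : EReal) < T) (κ : ℝ) :
    IsOpen {x ∈ ball (0 : EuclideanSpace ℝ (Fin d)) r | κ < levelTau m ε (W x) (u x t)} := by
  have hc := (h.continuousOn_levelTau hm hε hW ht htT).mono ball_subset_closedBall
  have := hc.isOpen_inter_preimage isOpen_ball (isOpen_Ioi (a := κ))
  have e : {x ∈ ball (0 : EuclideanSpace ℝ (Fin d)) r | κ < levelTau m ε (W x) (u x t)} =
      ball 0 r ∩ (fun x => levelTau m ε (W x) (u x t)) ⁻¹' Ioi κ := by
    ext x; simp
  rw [e]; exact this

end IsSmoothNoFluxSolution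

end DriftDiffusion

namespace DriftDiffusion

open Real (exp log)

theorem enorm_rpow_two_eq (a : ℝ) : ‖a‖ₑ ^ (2 : ℝ) = ENNReal.ofReal (a ^ 2) := by
  rw [Real.enorm_eq_ofReal_abs, ENNReal.ofReal_rpow_of_nonneg (abs_nonneg a) zero_le_two,
    Real.rpow_two, sq_abs]

theorem integrableOn_norm_fderiv_sq {d : ℕ} {r : ℝ} (hr : 0 < r)
    {w : EuclideanSpace ℝ (Fin d) → ℝ} (hw : ContDiffOn ℝ 1 w (closedBall 0 r)) :
    IntegrableOn (fun x => ‖fderiv ℝ w x‖ ^ 2) (ball 0 r) := by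
  have hc : ContinuousOn (fun x => ‖fderivWithin ℝ w (closedBall 0 r) x‖ ^ 2) (closedBall 0 r) :=
    (hw.continuousOn_fderivWithin (uniqueDiffOn_closedBall_zero hr) le_rfl).norm.pow 2
  refine ((hc.integrableOn_compact (isCompact_closedBall _ _)).mono_set
    ball_subset_closedBall).congr_fun (fun x hx => ?_) measurableSet_ball
  beta_reduce
  rw [fderivWithin_of_mem_nhds (mem_of_superset (isOpen_ball.mem_nhds hx) ball_subset_closedBall)]

/-- The weighted Poincaré inequality in terms of real integrals. -/
theorem exists_weighted_poincare_real {d : ℕ} (hd : 1 ≤ d) {q : ℝ} (hdq : d < q) (h2q : 2 < q) :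
    ∃ C : ℝ, 0 < C ∧ ∀ (r : ℝ) (w g : EuclideanSpace ℝ (Fin d) → ℝ)
      (Z : Set (EuclideanSpace ℝ (Fin d))) (N a : ℝ), 0 < r → ContDiffOn ℝ 1 w (closedBall 0 r) →
      (∀ x ∈ ball 0 r, 0 ≤ w x) → MeasurableSet Z → Z ⊆ ball 0 r →
      (∀ x ∈ ball 0 r, x ∉ Z → w x = 0) →
      2 * volume Z ≤ volume (ball (0 : EuclideanSpace ℝ (Fin d)) r) → Continuous g →
      0 ≤ N → 0 ≤ a → volume Z ≤ ENNReal.ofReal a →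
      ∫⁻ x in Z, ‖g x‖ₑ ^ q ≤ ENNReal.ofReal (N ^ q) →
      ∫ x in Z, w x ^ 2 * g x ^ 2 ≤
        C * a ^ (2 / d - 2 / q) * N ^ 2 * ∫ x in ball 0 r, ‖fderiv ℝ w x‖ ^ 2 := by
  obtain ⟨C, hC⟩ := exists_weighted_poincare hd hdq h2q
  have hd0 : (0 : ℝ) < d := by exact_mod_cast hd
  have hq0 : 0 < q := by linarith
  have hβ : 0 ≤ 2 / d - 2 / q := by
    rw [sub_nonneg]; exact div_le_div_of_nonneg_left zero_le_two hd0 hdq.le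
  refine ⟨C + 1, by positivity, fun r w g Z N a hr hw hwn hZm hZr hwZ hZ hg hN ha hZa hgN => ?_⟩
  have h := hC r w Z (fun x => ‖g x‖ₑ) hr (hw.mono ball_subset_closedBall) hwn hZm hZr hwZ hZ
    hg.measurable.enorm
  have hi1 : IntegrableOn (fun x => w x ^ 2 * g x ^ 2) Z :=
    (((hw.continuousOn.pow 2).mul (hg.continuousOn.pow 2)).integrableOn_compact
      (isCompact_closedBall _ _)).mono_set (hZr.trans ball_subset_closedBall)
  have hi2 := integrableOn_norm_fderiv_sq hr hw
  have e1 : ∫⁻ x in Z, ‖w x‖ₑ ^ (2 : ℝ) * ‖g x‖ₑ ^ (2 : ℝ) =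
      ENNReal.ofReal (∫ x in Z, w x ^ 2 * g x ^ 2) := by
    rw [ofReal_integral_eq_lintegral_ofReal hi1 (ae_of_all _ fun x => by positivity)]
    refine lintegral_congr fun x => ?_
    rw [enorm_rpow_two_eq, enorm_rpow_two_eq, ENNReal.ofReal_mul (sq_nonneg _)]
  have e2 : ∫⁻ x in ball 0 r, ‖fderiv ℝ w x‖ₑ ^ (2 : ℝ) =
      ENNReal.ofReal (∫ x in ball 0 r, ‖fderiv ℝ w x‖ ^ 2) := by
    rw [ofReal_integral_eq_lintegral_ofReal hi2 (ae_of_all _ fun x => by positivity)]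
    refine lintegral_congr fun x => ?_
    rw [← enorm_rpow_two_eq, enorm_norm]
  have e3 : (∫⁻ x in Z, ‖g x‖ₑ ^ q) ^ (2 / q) ≤ ENNReal.ofReal (N ^ 2) := by
    refine (ENNReal.rpow_le_rpow hgN (by positivity)).trans (le_of_eq ?_)
    rw [ENNReal.ofReal_rpow_of_nonneg (by positivity) (by positivity), ← Real.rpow_mul hN,
      mul_div_cancel₀ _ hq0.ne', Real.rpow_two]
  have e4 : volume Z ^ (2 / d - 2 / q) ≤ ENNReal.ofReal (a ^ (2 / d - 2 / q)) := by
    rw [← ENNReal.ofReal_rpow_of_nonneg ha hβ]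
    exact ENNReal.rpow_le_rpow hZa hβ
  have e5 : (C : ℝ≥0∞) ≤ ENNReal.ofReal (C + 1) := by
    rw [← ENNReal.ofReal_coe_nnreal]; exact ENNReal.ofReal_le_ofReal (by linarith)
  have hD : 0 ≤ ∫ x in ball 0 r, ‖fderiv ℝ w x‖ ^ 2 := integral_nonneg fun x => by positivity
  rw [e1, e2] at h
  refine (ENNReal.ofReal_le_ofReal_iff (by positivity)).1 (h.trans ?_)
  rw [ENNReal.ofReal_mul (by positivity), ENNReal.ofReal_mul (by positivity),
    ENNReal.ofReal_mul (by positivity)]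
  gcongr

/-- Hölder's inequality for the square of a function on a set of small measure. -/
theorem integral_sq_le_of_lintegral_rpow_le {d : ℕ} {q N a : ℝ} (h2q : 2 < q)
    {Z : Set (EuclideanSpace ℝ (Fin d))} {g : EuclideanSpace ℝ (Fin d) → ℝ} (hg : Continuous g)
    (hi : IntegrableOn (fun x => g x ^ 2) Z) (hN : 0 ≤ N) (ha : 0 ≤ a)
    (hZa : volume Z ≤ ENNReal.ofReal a) (hgN : ∫⁻ x in Z, ‖g x‖ₑ ^ q ≤ ENNReal.ofReal (N ^ q)) :
    ∫ x in Z, g x ^ 2 ≤ N ^ 2 * a ^ (1 - 2 / q) := by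
  have hq0 : 0 < q := by linarith
  have hq2 : 0 < q - 2 := by linarith
  have hex : 0 ≤ 1 - 2 / q := by rw [sub_nonneg, div_le_one hq0]; exact h2q.le
  have hconj : (q / 2).HolderConjugate (q / (q - 2)) := by
    rw [Real.holderConjugate_iff]
    refine ⟨by linarith, ?_⟩
    field_simp; ring
  have h := ENNReal.lintegral_mul_le_Lp_mul_Lq (volume.restrict Z) hconj
    (f := fun x => ‖g x‖ₑ ^ (2 : ℝ)) (g := fun _ => 1)
    (hg.measurable.enorm.pow_const _).aemeasurable aemeasurable_const
  have e0 : ∀ x, (‖g x‖ₑ ^ (2 : ℝ)) ^ (q / 2) = ‖g x‖ₑ ^ q := fun x => by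
    rw [← ENNReal.rpow_mul]; congr 1; ring
  have e3 : 1 / (q / 2) = 2 / q := by field_simp
  have e4 : 1 / (q / (q - 2)) = 1 - 2 / q := by field_simp
  simp only [Pi.mul_apply, mul_one, e0, e3, e4, ENNReal.one_rpow, lintegral_const,
    Measure.restrict_apply_univ, one_mul] at h
  have e1 : ∫⁻ x in Z, ‖g x‖ₑ ^ (2 : ℝ) = ENNReal.ofReal (∫ x in Z, g x ^ 2) := by
    rw [ofReal_integral_eq_lintegral_ofReal hi (ae_of_all _ fun x => by positivity)]
    exact lintegral_congr fun x => enorm_rpow_two_eq _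
  rw [e1] at h
  refine (ENNReal.ofReal_le_ofReal_iff (by positivity)).1 (h.trans ?_)
  rw [ENNReal.ofReal_mul (by positivity)]
  gcongr
  · refine (ENNReal.rpow_le_rpow hgN (by positivity)).trans (le_of_eq ?_)
    rw [ENNReal.ofReal_rpow_of_nonneg (by positivity) (by positivity), ← Real.rpow_mul hN,
      mul_div_cancel₀ _ hq0.ne', Real.rpow_two]
  · rw [← ENNReal.ofReal_rpow_of_nonneg ha hex]
    exact ENNReal.rpow_le_rpow hZa hex

/-- A decomposition `V = b + ∇W` of the drift into a gradient with potential bounded by `Ω` and a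
remainder `b` whose `L ^ q` norm on sets of measure at most one is bounded by `K`. -/
structure IsDriftDecomposition {d : ℕ} (q K Ω : ℝ)
    (V : EuclideanSpace ℝ (Fin d) → EuclideanSpace ℝ (Fin d))
    (W : EuclideanSpace ℝ (Fin d) → ℝ) : Prop where
  contDiff_drift : ContDiff ℝ 1 V
  contDiff_potential : ContDiff ℝ 1 W
  abs_potential_le : ∀ x, |W x| ≤ Ω
  lintegral_le : ∀ A : Set (EuclideanSpace ℝ (Fin d)), MeasurableSet A → volume A ≤ 1 →
    ∫⁻ x in A, ‖V x - gradient W x‖ₑ ^ q ≤ ENNReal.ofReal (K ^ q)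

theorem IsDriftDecomposition.continuous_remainder {d : ℕ} {q K Ω : ℝ}
    {V : EuclideanSpace ℝ (Fin d) → EuclideanSpace ℝ (Fin d)}
    {W : EuclideanSpace ℝ (Fin d) → ℝ} (hVW : IsDriftDecomposition q K Ω V W) :
    Continuous fun x => V x - gradient W x :=
  hVW.contDiff_drift.continuous.sub
    ((InnerProductSpace.toDual ℝ (EuclideanSpace ℝ (Fin d))).symm.continuous.comp
      (hVW.contDiff_potential.continuous_fderiv one_ne_zero))

namespace IsSmoothNoFluxSolution

variable {d : ℕ} {m ε r t q K Ω κ α : ℝ} {T : EReal}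
  {V : EuclideanSpace ℝ (Fin d) → EuclideanSpace ℝ (Fin d)} {W : EuclideanSpace ℝ (Fin d) → ℝ}
  {u₀ : EuclideanSpace ℝ (Fin d) → ℝ} {u : EuclideanSpace ℝ (Fin d) → ℝ → ℝ}
  (h : IsSmoothNoFluxSolution m ε r T V u₀ u)

include h

theorem contDiffOn_levelRoot (hm : 1 < m) (hε : 0 < ε)
    (hVW : IsDriftDecomposition q K Ω V W) (hκ : Ω + 1 ≤ κ) (hα : 0 < α)
    (ht : 0 < t) (htT : (t : EReal) < T) :
    ContDiffOn ℝ 1 (fun y => levelRoot α κ (levelTau m ε (W y) (u y t))) (closedBall 0 r) :=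
  h.contDiffOn_comp (Φ := fun x s => levelRoot α κ (levelTau m ε (W x) s))
    (Real.exp_pos (κ - Ω))
    (fun x s hs => levelRoot_eq_zero hα
      (levelTau_le_of_le hm hε (hVW.abs_potential_le x) (by linarith) hs))
    (contDiffOn_comp_levelTau hm hε hVW.contDiff_potential hVW.abs_potential_le hκ
      contDiff_levelRoot fun τ hτ => levelRoot_eq_zero hα hτ) ht htT

/-- The energy inequality above the level `κ`. -/
theorem energyDeriv_le (hm : 1 < m) (hε : 0 < ε) (hr : 0 < r)
    (hVW : IsDriftDecomposition q K Ω V W) (hκ : Ω + 1 ≤ κ) (hα : 0 < α) (hα1 : α ≤ 1)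
    (hαm : α ≤ m - 1) (ht : 0 < t) (htT : (t : EReal) < T) :
    - ∫ x in ball 0 r,
        fderiv ℝ (fun y => levelTest α κ (levelTau m ε (W y) (u y t))) x (flux m ε r V u t x) ≤
      - (3 * α / 8 * exp (-Ω) * ∫ x in ball 0 r,
        ‖fderiv ℝ (fun y => levelRoot α κ (levelTau m ε (W y) (u y t))) x‖ ^ 2) +
      6 * exp Ω * exp (1 / α) *
        ((∫ x in {x ∈ ball 0 r | κ < levelTau m ε (W x) (u x t)},
          levelRoot α κ (levelTau m ε (W x) (u x t)) ^ 2 * ‖V x - gradient W x‖ ^ 2) +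
        exp κ * ∫ x in {x ∈ ball 0 r | κ < levelTau m ε (W x) (u x t)},
          ‖V x - gradient W x‖ ^ 2) := by
  have hW := hVW.contDiff_potential
  have hWΩ := hVW.abs_potential_le
  set Z := {x ∈ ball (0 : EuclideanSpace ℝ (Fin d)) r | κ < levelTau m ε (W x) (u x t)} with hZ
  set w := fun y => levelRoot α κ (levelTau m ε (W y) (u y t)) with hw
  set θ := fun y => levelTest α κ (levelTau m ε (W y) (u y t)) with hθ
  have hZm : MeasurableSet Z := (h.isOpen_superlevel hm hε hW ht htT κ).measurableSet
  have hZr : Z ⊆ ball 0 r := fun x hx => hx.1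
  have hs₀ : 0 < exp (κ - Ω) := Real.exp_pos _
  have hΩκ : Ω ≤ κ := by linarith
  have hθ1 : ContDiffOn ℝ 1 θ (closedBall 0 r) :=
    h.contDiffOn_comp (Φ := fun x s => levelTest α κ (levelTau m ε (W x) s)) hs₀
      (fun x s hs => levelTest_eq_zero hα (levelTau_le_of_le hm hε (hWΩ x) hΩκ hs))
      (contDiffOn_comp_levelTau hm hε hW hWΩ hκ contDiff_levelTest fun τ hτ =>
        levelTest_eq_zero hα hτ) ht htT
  have hw1 : ContDiffOn ℝ 1 w (closedBall 0 r) := h.contDiffOn_levelRoot hm hε hVW hκ hα ht htT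
  have hb : ContinuousOn (fun x => ‖V x - gradient W x‖ ^ 2) (closedBall 0 r) :=
    (hVW.continuous_remainder.norm.pow 2).continuousOn
  have hw2 : ContinuousOn (fun x => w x ^ 2 * ‖V x - gradient W x‖ ^ 2) (closedBall 0 r) :=
    (hw1.continuousOn.pow 2).mul hb
  have i1 := (integrableOn_of_continuousOn hw2).mono_set hZr
  have i2 := (integrableOn_of_continuousOn hb).mono_set hZr
  set f := fun x => 6 * exp Ω * exp (1 / α) * (w x ^ 2 + exp κ) * ‖V x - gradient W x‖ ^ 2 with hf
  have hfe : f = fun x => 6 * exp Ω * exp (1 / α) *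
      (w x ^ 2 * ‖V x - gradient W x‖ ^ 2 + exp κ * ‖V x - gradient W x‖ ^ 2) := by
    funext x; rw [hf]; ring
  have i3 : IntegrableOn f Z := by
    rw [hfe]; exact (i1.add (i2.const_mul (exp κ))).const_mul _
  have i4 : IntegrableOn (Z.indicator f) (ball 0 r) :=
    ((integrable_indicator_iff hZm).2 i3).integrableOn
  have i5 := (integrableOn_norm_fderiv_sq hr hw1).const_mul (3 * α / 8 * exp (-Ω))
  have i6 := (h.integrableOn_fderiv_flux hm hr hVW.contDiff_drift ht htT hθ1).neg
  have hmain : ∫ x in ball 0 r, - fderiv ℝ θ x (flux m ε r V u t x) ≤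
      ∫ x in ball 0 r, (- (3 * α / 8 * exp (-Ω) * ‖fderiv ℝ w x‖ ^ 2) + Z.indicator f x) := by
    refine setIntegral_mono_on i6 (i5.neg.add i4) measurableSet_ball fun x hx => ?_
    refine (h.neg_fderiv_levelTest_le hm hε hW hWΩ hκ hα hα1 hαm hx ht htT).trans (le_of_eq ?_)
    congr 1
    by_cases hc : κ < levelTau m ε (W x) (u x t)
    · rw [indicator_of_mem (show x ∈ Z from ⟨hx, hc⟩), indicator_of_mem]
      exact hc
    · rw [indicator_of_notMem (fun hxZ : x ∈ Z => hc hxZ.2), indicator_of_notMem]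
      exact hc
  have i5' : Integrable (fun x => - (3 * α / 8 * exp (-Ω) * ‖fderiv ℝ w x‖ ^ 2))
    (volume.restrict (ball 0 r)) := i5.neg
  rw [← integral_neg]
  refine hmain.trans (le_of_eq ?_)
  rw [integral_add i5' i4, integral_neg, integral_const_mul, setIntegral_indicator hZm,
    inter_eq_self_of_subset_right hZr, hfe, integral_const_mul, integral_add i1 (i2.const_mul _),
    integral_const_mul]

theorem hasDerivAt_levelEnergy (hm : 1 < m) (hε : 0 < ε) (hr : 0 < r)
    (hVW : IsDriftDecomposition q K Ω V W) (hκ : Ω + 1 ≤ κ) (hα : 0 < α)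
    (ht : 0 < t) (htT : (t : EReal) < T) :
    HasDerivAt (fun t => ∫ x in ball 0 r, levelEnergy m ε α κ (W x) (u x t))
      (- ∫ x in ball 0 r,
        fderiv ℝ (fun y => levelTest α κ (levelTau m ε (W y) (u y t))) x (flux m ε r V u t x)) t := by
  have hW := hVW.contDiff_potential
  have hWΩ := hVW.abs_potential_le
  have hΩκ : Ω ≤ κ := by linarith
  have hc1 : Continuous fun p : EuclideanSpace ℝ (Fin d) × ℝ => (W p.1, p.2) :=
    (hW.continuous.comp continuous_fst).prodMk continuous_snd
  have hc2 := contDiff_levelTest (α := α) (κ := κ) |>.continuous.comp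
    ((continuous_levelTau hm hε).comp hc1)
  exact h.hasDerivAt_energy (Θ := fun x s => levelTest α κ (levelTau m ε (W x) s)) hm hr
    hVW.contDiff_drift (Real.exp_pos (κ - Ω)) hc2
    (fun x s hs => levelTest_eq_zero hα (levelTau_le_of_le hm hε (hWΩ x) hΩκ hs))
    (contDiffOn_comp_levelTau hm hε hW hWΩ hκ contDiff_levelTest fun τ hτ =>
        levelTest_eq_zero hα hτ) ht htT

/-- The energy starts from zero if the initial datum is below the level: then it is at most
`(u - u₀)₊`. -/
theorem tendsto_levelEnergy (hT : 0 < T) (hm : 1 < m) (hε : 0 < ε)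
    (hVW : IsDriftDecomposition q K Ω V W) (hκ : Ω + 1 ≤ κ) (hα : 0 < α)
    (hu₀ : ∀ᵐ x ∂(volume.restrict (ball (0 : EuclideanSpace ℝ (Fin d)) r)), u₀ x ≤ exp (κ - Ω)) :
    Tendsto (fun t => ∫ x in ball 0 r, levelEnergy m ε α κ (W x) (u x t)) (𝓝[>] 0) (𝓝 0) := by
  refine h.tendsto_integral_of_abs_le ?_
  obtain ⟨δ, hδ, hδT⟩ : ∃ δ : ℝ, 0 < δ ∧ (δ : EReal) < T := by
    obtain ⟨δ, h1, h2⟩ := EReal.lt_iff_exists_real_btwn.1 hT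
    exact ⟨δ, by exact_mod_cast h1, h2⟩
  filter_upwards [Ioc_mem_nhdsGT hδ] with t ht
  filter_upwards [hu₀, ae_restrict_mem measurableSet_ball] with x hx hxb
  have hu := h.nonneg x (ball_subset_closedBall hxb) t ht.1
    ((EReal.coe_le_coe_iff.2 ht.2).trans_lt hδT)
  rw [abs_of_nonneg (levelEnergy_nonneg hu)]
  refine (levelEnergy_le_max_sub hm hε hα (hVW.abs_potential_le x) (by linarith) hu).trans ?_
  refine max_le ?_ (abs_nonneg _)
  exact le_trans (by linarith) (le_abs_self _)

end IsSmoothNoFluxSolution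

end DriftDiffusion

/-! ### The decay of the superlevel sets -/

namespace DriftDiffusion

open Real (exp log)

theorem continuous_levelEnergy {m ε α κ : ℝ} (hm : 1 < m) (hε : 0 < ε) :
    Continuous fun q : ℝ × ℝ => levelEnergy m ε α κ q.1 q.2 := by
  refine intervalIntegral.continuous_parametric_intervalIntegral_of_continuous
    (f := fun (q : ℝ × ℝ) σ => levelTest α κ (levelTau m ε q.1 σ)) ?_ continuous_snd
  have hc1 : Continuous fun p : (ℝ × ℝ) × ℝ => (p.1.1, p.2) := by fun_prop
  exact (contDiff_levelTest (α := α) (κ := κ)).continuous.comp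
    ((continuous_levelTau hm hε).comp hc1)

namespace IsSmoothNoFluxSolution

variable {d : ℕ} {m ε r t q K Ω κ α : ℝ} {T : EReal}
  {V : EuclideanSpace ℝ (Fin d) → EuclideanSpace ℝ (Fin d)} {W : EuclideanSpace ℝ (Fin d) → ℝ}
  {u₀ : EuclideanSpace ℝ (Fin d) → ℝ} {u : EuclideanSpace ℝ (Fin d) → ℝ → ℝ}
  (h : IsSmoothNoFluxSolution m ε r T V u₀ u)

include h

theorem integrableOn_levelEnergy (hm : 1 < m) (hε : 0 < ε) (hW : ContDiff ℝ 1 W) (ht : 0 < t)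
    (htT : (t : EReal) < T) :
    IntegrableOn (fun x => levelEnergy m ε α κ (W x) (u x t)) (ball 0 r) := by
  have h1 : ContinuousOn (fun x => (W x, u x t)) (closedBall 0 r) :=
    hW.continuous.continuousOn.prodMk (h.contDiffOn_slice ht htT).continuousOn
  have h2 := (continuous_levelEnergy (α := α) (κ := κ) hm hε).comp_continuousOn h1
  exact integrableOn_of_continuousOn h2

/-- Markov's inequality for the energy. -/
theorem volume_superlevel_add_le (hm : 1 < m) (hε : 0 < ε)
    (hVW : IsDriftDecomposition q K Ω V W) (hκ : Ω ≤ κ) (hα : 0 < α) (hα1 : α ≤ 1)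
    {θ : ℝ} (hθ : 0 < θ) (hθ1 : θ ≤ 1) (ht : 0 < t) (htT : (t : EReal) < T) :
    volume {x ∈ ball (0 : EuclideanSpace ℝ (Fin d)) r | κ + θ < levelTau m ε (W x) (u x t)} ≤
      ENNReal.ofReal ((∫ x in ball 0 r, levelEnergy m ε α κ (W x) (u x t)) /
        (exp (-Ω) * exp (-((m - 1) * (1 + Ω))) / 2 * (α / 4) ^ 3 * exp κ * θ ^ 4)) := by
  set S := {x ∈ ball (0 : EuclideanSpace ℝ (Fin d)) r | κ + θ < levelTau m ε (W x) (u x t)}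
    with hS
  set c := exp (-Ω) * exp (-((m - 1) * (1 + Ω))) / 2 * (α / 4) ^ 3 * exp κ * θ ^ 4 with hc
  have hc0 : 0 < c := by positivity
  have hSm : MeasurableSet S :=
    (h.isOpen_superlevel hm hε hVW.contDiff_potential ht htT _).measurableSet
  have hSr : S ⊆ ball 0 r := fun x hx => hx.1
  have hSf : volume S ≠ ⊤ := ((measure_mono hSr).trans_lt measure_ball_lt_top).ne
  have hi := h.integrableOn_levelEnergy (α := α) (κ := κ) hm hε hVW.contDiff_potential ht htT
  rw [← ENNReal.ofReal_toReal hSf]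
  refine ENNReal.ofReal_le_ofReal ?_
  rw [le_div_iff₀ hc0]
  calc (volume S).toReal * c = ∫ _ in S, c := by
        rw [setIntegral_const, smul_eq_mul, Measure.real]
    _ ≤ ∫ x in S, levelEnergy m ε α κ (W x) (u x t) := by
        refine setIntegral_mono_on (integrableOn_const hSf) (hi.mono_set hSr) hSm fun x hx => ?_
        exact le_levelEnergy hm hε hα hα1 (hVW.abs_potential_le x) hκ hθ hθ1 hx.2
    _ ≤ _ := by
        refine setIntegral_mono_set hi ?_ (LE.le.eventuallyLE hSr)
        filter_upwards [ae_restrict_mem measurableSet_ball] with x hx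
        exact levelEnergy_nonneg (h.nonneg x (ball_subset_closedBall hx) t ht htT)

theorem integral_levelEnergy_le (hm : 1 < m) (hε : 0 < ε)
    (hVW : IsDriftDecomposition q K Ω V W) (hκ : Ω + 1 ≤ κ) (hα : 0 < α) (hα1 : α ≤ 1)
    (ht : 0 < t) (htT : (t : EReal) < T) :
    ∫ x in ball 0 r, levelEnergy m ε α κ (W x) (u x t) ≤
      exp Ω * exp ((m - 1) * (1 + Ω)) * (2 / α) *
        ∫ x in {x ∈ ball (0 : EuclideanSpace ℝ (Fin d)) r | κ < levelTau m ε (W x) (u x t)},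
          levelRoot α κ (levelTau m ε (W x) (u x t)) ^ 2 := by
  have hΩκ : Ω ≤ κ := by linarith
  have hw1 := h.contDiffOn_levelRoot hm hε hVW hκ hα ht htT
  set w := fun y => levelRoot α κ (levelTau m ε (W y) (u y t)) with hw
  have hw2 : IntegrableOn (fun x => w x ^ 2) (ball 0 r) :=
    integrableOn_of_continuousOn (hw1.continuousOn.pow 2)
  have hZ : ∫ x in ball 0 r, w x ^ 2 =
      ∫ x in {x ∈ ball (0 : EuclideanSpace ℝ (Fin d)) r | κ < levelTau m ε (W x) (u x t)},
        w x ^ 2 := by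
    refine setIntegral_eq_of_subset_of_forall_sdiff_eq_zero measurableSet_ball
      (fun x hx => hx.1) fun x hx => ?_
    have : w x = 0 := levelRoot_eq_zero hα (not_lt.1 fun hc => hx.2 ⟨hx.1, hc⟩)
    rw [this]
    exact zero_pow two_ne_zero
  rw [← hZ, ← integral_const_mul]
  exact setIntegral_mono_on (h.integrableOn_levelEnergy hm hε hVW.contDiff_potential ht htT)
    (hw2.const_mul _) measurableSet_ball fun x hx => levelEnergy_le hm hε hα hα1
      (hVW.abs_potential_le x) hΩκ (h.nonneg x (ball_subset_closedBall hx) t ht htT)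

end IsSmoothNoFluxSolution

/-- The step of the iteration: if the superlevel sets at the level `κ` have measure at most `a` at
all times, those at the level `κ + θ` have measure at most a multiple of a higher power of `a`. -/
theorem exists_level_step {d : ℕ} (hd : 1 ≤ d) {m : ℝ} (hm : 1 < m) {q : ℝ} (hdq : d < q)
    (h2q : 2 < q) {K : ℝ} (hK : 0 ≤ K) (Ω : ℝ) :
    ∃ a₀ C : ℝ, 0 < a₀ ∧ a₀ ≤ 1 ∧ 0 ≤ C ∧ ∀ {ε r : ℝ} {T : EReal}
      {V : EuclideanSpace ℝ (Fin d) → EuclideanSpace ℝ (Fin d)}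
      {W u₀ : EuclideanSpace ℝ (Fin d) → ℝ} {u : EuclideanSpace ℝ (Fin d) → ℝ → ℝ},
      0 < ε → 0 < r → 0 < T → IsDriftDecomposition q K Ω V W →
      IsSmoothNoFluxSolution m ε r T V u₀ u → ∀ κ a θ : ℝ, Ω + 1 ≤ κ →
      (∀ᵐ x ∂(volume.restrict (ball (0 : EuclideanSpace ℝ (Fin d)) r)), u₀ x ≤ exp (κ - Ω)) →
      0 < a → a ≤ a₀ → 0 < θ → θ ≤ 1 →
      (∀ t : ℝ, 0 < t → (t : EReal) < T →
        volume {x ∈ ball (0 : EuclideanSpace ℝ (Fin d)) r | κ < levelTau m ε (W x) (u x t)} ≤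
            ENNReal.ofReal a ∧
          2 * volume {x ∈ ball (0 : EuclideanSpace ℝ (Fin d)) r |
            κ < levelTau m ε (W x) (u x t)} ≤ volume (ball (0 : EuclideanSpace ℝ (Fin d)) r)) →
      ∀ t : ℝ, 0 < t → (t : EReal) < T →
        volume {x ∈ ball (0 : EuclideanSpace ℝ (Fin d)) r | κ + θ < levelTau m ε (W x) (u x t)} ≤
          ENNReal.ofReal (C / θ ^ 4 * a ^ (1 + (2 / d - 2 / q))) := by
  obtain ⟨CP, hCP, hP⟩ := exists_weighted_poincare_real hd hdq h2q
  have hd0 : (0 : ℝ) < d := by exact_mod_cast hd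
  have hq0 : 0 < q := by linarith
  set β := 2 / d - 2 / q with hβ
  have hβ0 : 0 < β := by
    rw [hβ, sub_pos]; exact div_lt_div_of_pos_left two_pos hd0 hdq
  set α := min (m - 1) 1 with hαdef
  have hα : 0 < α := lt_min (by linarith) one_pos
  have hα1 : α ≤ 1 := min_le_right _ _
  have hαm : α ≤ m - 1 := min_le_left _ _
  set c₀ := 3 * α / 8 * exp (-Ω) with hc₀
  have hc₀0 : 0 < c₀ := by positivity
  set C₁ := 6 * exp Ω * exp (1 / α) with hC₁
  have hC₁0 : 0 < C₁ := by positivity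
  set C₂ := exp Ω * exp ((m - 1) * (1 + Ω)) * (2 / α) with hC₂
  have hC₂0 : 0 < C₂ := by positivity
  set c₃ := exp (-Ω) * exp (-((m - 1) * (1 + Ω))) / 2 * (α / 4) ^ 3 with hc₃
  have hc₃0 : 0 < c₃ := by positivity
  -- Below `a₀` the drift term which is quadratic in the test function is absorbed.
  obtain ⟨a₀, ha₀, ha₀1, hab⟩ : ∃ a₀ : ℝ, 0 < a₀ ∧ a₀ ≤ 1 ∧
      ∀ a, 0 ≤ a → a ≤ a₀ → C₁ * (CP * a ^ β * K ^ 2) ≤ c₀ / 2 := by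
    have hlim : Tendsto (fun a : ℝ => C₁ * (CP * a ^ β * K ^ 2)) (𝓝 0) (𝓝 0) := by
      have hcont : Continuous fun a : ℝ => C₁ * (CP * a ^ β * K ^ 2) :=
        continuous_const.mul ((continuous_const.mul
          (Real.continuous_rpow_const hβ0.le)).mul continuous_const)
      have := hcont.tendsto 0
      rwa [Real.zero_rpow hβ0.ne', mul_zero, zero_mul, mul_zero] at this
    obtain ⟨δ, hδ, hball⟩ := Metric.eventually_nhds_iff.1
      (hlim.eventually (eventually_lt_nhds (half_pos hc₀0)))
    refine ⟨min (δ / 2) 1, by positivity, min_le_right _ _, fun a ha haδ => (hball ?_).le⟩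
    rw [Real.dist_eq, sub_zero, abs_of_nonneg ha]
    exact (haδ.trans (min_le_left _ _)).trans_lt (half_lt_self hδ)
  refine ⟨a₀, 2 * C₁ * K ^ 2 * C₂ * CP / c₀ / c₃, ha₀, ha₀1, by positivity, ?_⟩
  intro ε r T V W u₀ u hε hr hT hVW h κ a θ hκ hu₀ ha haa hθ hθ1 hvol
  -- The rate `k` in `E' ≤ - k E + R` comes from the Poincaré inequality without weight, whose
  -- constant is of the size of `a ^ (2 / d)`.
  set R := C₁ * (exp κ * (K ^ 2 * a ^ (1 - 2 / q))) with hR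
  set k := c₀ / 2 / (C₂ * (CP * a ^ (2 / (d : ℝ)))) with hk
  have hR0 : 0 ≤ R := by positivity
  have hk0 : 0 < k := by positivity
  have hΩκ : Ω ≤ κ := by linarith
  have hE : ∀ t : ℝ, 0 < t → (t : EReal) < T →
      ∫ x in ball 0 r, levelEnergy m ε α κ (W x) (u x t) ≤ R / k := by
    intro t ht htT
    refine le_div_of_deriv_le_neg_mul_add (T := T) hk0 hR0
      (fun s hs hsT => h.hasDerivAt_levelEnergy hm hε hr hVW hκ hα hs hsT) (fun s hs hsT => ?_)
      (h.tendsto_levelEnergy hT hm hε hVW hκ hα hu₀) ht htT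
    obtain ⟨hv1, hv2⟩ := hvol s hs hsT
    have hdiss := h.energyDeriv_le hm hε hr hVW hκ hα hα1 hαm hs hsT
    have hen := h.integral_levelEnergy_le hm hε hVW hκ hα hα1 hs hsT
    have hw1 := h.contDiffOn_levelRoot hm hε hVW hκ hα hs hsT
    have hZm := (h.isOpen_superlevel hm hε hVW.contDiff_potential hs hsT κ).measurableSet
    set Z := {x ∈ ball (0 : EuclideanSpace ℝ (Fin d)) r | κ < levelTau m ε (W x) (u x s)} with hZ
    set w := fun y => levelRoot α κ (levelTau m ε (W y) (u y s)) with hw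
    set D := ∫ x in ball 0 r, ‖fderiv ℝ w x‖ ^ 2 with hD
    have hD0 : 0 ≤ D := integral_nonneg fun x => by positivity
    have hZr : Z ⊆ ball 0 r := fun x hx => hx.1
    have hwn : ∀ x ∈ ball 0 r, 0 ≤ w x := fun x _ => by
      simp only [hw, levelRoot]
      positivity
    have hw0 : ∀ x ∈ ball 0 r, x ∉ Z → w x = 0 := fun x hx hxZ =>
      levelRoot_eq_zero hα (not_lt.1 fun hc => hxZ ⟨hx, hc⟩)
    have hZ1 : volume Z ≤ 1 := hv1.trans (ENNReal.ofReal_le_one.2 (haa.trans ha₀1))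
    have hbc : Continuous fun x => ‖V x - gradient W x‖ := hVW.continuous_remainder.norm
    have hbL := hVW.lintegral_le Z hZm hZ1
    have hbL' : ∫⁻ x in Z, ‖‖V x - gradient W x‖‖ₑ ^ q ≤ ENNReal.ofReal (K ^ q) := by
      simpa only [enorm_norm] using hbL
    have p1 := hP r w (fun x => ‖V x - gradient W x‖) Z K a hr hw1 hwn hZm hZr hw0 hv2 hbc hK
      ha.le hv1 hbL'
    have p2 := hP r w (fun _ => 1) Z (a ^ (1 / q)) a hr hw1 hwn hZm hZr hw0 hv2 continuous_const
      (by positivity) ha.le hv1 (by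
        rw [← Real.rpow_mul ha.le, one_div_mul_cancel hq0.ne', Real.rpow_one]
        simpa using hv1)
    have hbi : IntegrableOn (fun x => ‖V x - gradient W x‖ ^ 2) Z :=
      (IsSmoothNoFluxSolution.integrableOn_of_continuousOn (hbc.pow 2).continuousOn).mono_set hZr
    have p3 := integral_sq_le_of_lintegral_rpow_le h2q hbc hbi hK ha.le hv1 hbL'
    have e2 : a ^ β * (a ^ (1 / q)) ^ 2 = a ^ (2 / (d : ℝ)) := by
      rw [← Real.rpow_natCast, ← Real.rpow_mul ha.le, ← Real.rpow_add ha]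
      congr 1
      rw [hβ]; push_cast; ring
    simp only [one_pow, mul_one] at p2
    rw [mul_assoc CP, e2] at p2
    have q1 := hab a ha.le haa
    have q2 : C₁ * (∫ x in Z, w x ^ 2 * ‖V x - gradient W x‖ ^ 2) ≤ c₀ / 2 * D := by
      calc _ ≤ C₁ * (CP * a ^ β * K ^ 2 * D) := by gcongr
        _ = C₁ * (CP * a ^ β * K ^ 2) * D := by ring
        _ ≤ _ := by gcongr
    have q3 : k * (∫ x in ball 0 r, levelEnergy m ε α κ (W x) (u x s)) ≤ c₀ / 2 * D := by
      calc _ ≤ k * (C₂ * (CP * a ^ (2 / (d : ℝ)) * D)) := by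
            gcongr
            exact hen.trans (by gcongr)
        _ = _ := by rw [hk]; field_simp
    have q4 : C₁ * (exp κ * ∫ x in Z, ‖V x - gradient W x‖ ^ 2) ≤ R := by
      rw [hR]; gcongr
    refine hdiss.trans ?_
    change - (c₀ * D) + C₁ * ((∫ x in Z, w x ^ 2 * ‖V x - gradient W x‖ ^ 2) +
      exp κ * ∫ x in Z, ‖V x - gradient W x‖ ^ 2) ≤ _
    rw [mul_add]
    linarith
  intro t ht htT
  refine (h.volume_superlevel_add_le hm hε hVW hΩκ hα hα1 hθ hθ1 ht htT).trans
    (ENNReal.ofReal_le_ofReal ?_)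
  have e1 : a ^ (1 + β) = a ^ (1 - 2 / q) * a ^ (2 / (d : ℝ)) := by
    rw [← Real.rpow_add ha]; congr 1; rw [hβ]; ring
  calc _ ≤ R / k / (c₃ * exp κ * θ ^ 4) := by
        gcongr
        exact hE t ht htT
    _ = _ := by
        rw [e1, hR, hk]
        field_simp

end DriftDiffusion

/-! ### The iteration over the levels -/

namespace DriftDiffusion

open Real (exp log)

namespace IsSmoothNoFluxSolution

variable {d : ℕ} {m ε r t q K Ω κ : ℝ} {T : EReal}
  {V : EuclideanSpace ℝ (Fin d) → EuclideanSpace ℝ (Fin d)} {W : EuclideanSpace ℝ (Fin d) → ℝ}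
  {u₀ : EuclideanSpace ℝ (Fin d) → ℝ} {u : EuclideanSpace ℝ (Fin d) → ℝ → ℝ}
  (h : IsSmoothNoFluxSolution m ε r T V u₀ u)

include h

/-- Chebyshev's inequality for the first superlevel set, by conservation of mass. -/
theorem volume_superlevel_mul_exp_le (hm : 1 < m) (hε : 0 < ε) (hr : 0 < r)
    (hVW : IsDriftDecomposition q K Ω V W) (hκ : Ω ≤ κ) (hu₀ : IntegrableOn u₀ (ball 0 r))
    (hu₀n : ∀ᵐ x, 0 ≤ u₀ x) (ht : 0 < t) (htT : (t : EReal) < T) :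
    volume.real {x ∈ ball (0 : EuclideanSpace ℝ (Fin d)) r | κ < levelTau m ε (W x) (u x t)} *
      exp (κ - Ω) ≤ ∫ x in ball 0 r, u₀ x := by
  set S := {x ∈ ball (0 : EuclideanSpace ℝ (Fin d)) r | κ < levelTau m ε (W x) (u x t)} with hS
  have hSm : MeasurableSet S :=
    (h.isOpen_superlevel hm hε hVW.contDiff_potential ht htT _).measurableSet
  have hSr : S ⊆ ball 0 r := fun x hx => hx.1
  have hSf : volume S ≠ ⊤ := ((measure_mono hSr).trans_lt measure_ball_lt_top).ne
  have hi := integrableOn_of_continuousOn (h.contDiffOn_slice ht htT).continuousOn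
  calc volume.real S * exp (κ - Ω) = ∫ _ in S, exp (κ - Ω) := by
        rw [setIntegral_const, smul_eq_mul]
    _ ≤ ∫ x in S, u x t := by
        refine setIntegral_mono_on (integrableOn_const hSf) (hi.mono_set hSr) hSm fun x hx => ?_
        exact (exp_sub_lt_of_lt_levelTau hm hε (hVW.abs_potential_le x) hκ hx.2).le
    _ ≤ ∫ x in ball 0 r, u x t := by
        refine setIntegral_mono_set hi ?_ (LE.le.eventuallyLE hSr)
        filter_upwards [ae_restrict_mem measurableSet_ball] with x hx
        exact h.nonneg x (ball_subset_closedBall hx) t ht htT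
    _ ≤ _ := h.integral_le hm hε hr hVW.contDiff_drift hu₀ hu₀n ht htT

/-- The superlevel sets are open, so a null one is empty. -/
theorem le_exp_of_volume_superlevel_eq_zero (hm : 1 < m) (hε : 0 < ε) (hr : 0 < r)
    (hVW : IsDriftDecomposition q K Ω V W) (hκ : 0 ≤ κ) (ht : 0 < t) (htT : (t : EReal) < T)
    (hvol : volume {x ∈ ball (0 : EuclideanSpace ℝ (Fin d)) r |
      κ < levelTau m ε (W x) (u x t)} = 0) {x : EuclideanSpace ℝ (Fin d)}
    (hx : x ∈ closedBall 0 r) : u x t ≤ exp (κ + Ω) := by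
  have hempty := (h.isOpen_superlevel hm hε hVW.contDiff_potential ht htT κ).eq_empty_of_measure_zero
    hvol
  have hball : ∀ y ∈ ball (0 : EuclideanSpace ℝ (Fin d)) r, u y t ≤ exp (κ + Ω) := by
    intro y hy
    by_contra! hcon
    have hpos : 0 < u y t := (Real.exp_pos _).trans hcon
    have hlog : κ + Ω < log (u y t) := (Real.lt_log_iff_exp_lt hpos).2 hcon
    have hΩ : 0 ≤ Ω := (abs_nonneg _).trans (hVW.abs_potential_le y)
    have := lt_logShift_of_add_lt hm hε (hVW.abs_potential_le y) hκ hlog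
    rw [← levelTau_exp (by linarith), Real.exp_log hpos] at this
    exact (hempty ▸ (⟨hy, this⟩ : y ∈ {x ∈ ball (0 : EuclideanSpace ℝ (Fin d)) r |
      κ < levelTau m ε (W x) (u x t)}) : y ∈ (∅ : Set _))
  have hcl : closure (ball (0 : EuclideanSpace ℝ (Fin d)) r) = closedBall 0 r :=
    closure_ball _ hr.ne'
  refine le_on_closure (s := ball (0 : EuclideanSpace ℝ (Fin d)) r) (f := fun x => u x t)
    (g := fun _ => exp (κ + Ω)) hball ?_ continuousOn_const (hcl ▸ hx)
  rw [hcl]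
  exact (h.contDiffOn_slice ht htT).continuousOn

end IsSmoothNoFluxSolution

/-- The uniform bound for a drift with a bounded potential and a remainder in `L ^ q`. -/
theorem exists_bound_of_isDriftDecomposition {d : ℕ} (hd : 1 ≤ d) {m : ℝ} (hm : 1 < m) {q : ℝ}
    (hdq : d < q) (h2q : 2 < q) {K L₁ L₂ : ℝ} (hK : 0 ≤ K) (hL₁ : 0 ≤ L₁) (hL₂ : 0 ≤ L₂) (Ω : ℝ) :
    ∃ M : ℝ, ∀ {ε r : ℝ} {T : EReal}
      {V : EuclideanSpace ℝ (Fin d) → EuclideanSpace ℝ (Fin d)}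
      {W u₀ : EuclideanSpace ℝ (Fin d) → ℝ} {u : EuclideanSpace ℝ (Fin d) → ℝ → ℝ},
      0 < ε → 0 < r → 0 < T → IsDriftDecomposition q K Ω V W →
      IsSmoothNoFluxSolution m ε r T V u₀ u → IntegrableOn u₀ (ball 0 r) → (∀ᵐ x, 0 ≤ u₀ x) →
      ∫ x in ball 0 r, u₀ x ≤ L₁ →
      (∀ᵐ x ∂(volume.restrict (ball (0 : EuclideanSpace ℝ (Fin d)) r)), u₀ x ≤ L₂) →
      ∀ x ∈ closedBall 0 r, ∀ t : ℝ, 0 < t → (t : EReal) < T → u x t ≤ M := by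
  obtain ⟨a₀, C, ha₀, -, hC, hstep⟩ := exists_level_step hd hm hdq h2q hK Ω
  have hd0 : (0 : ℝ) < d := by exact_mod_cast hd
  set β := 2 / d - 2 / q with hβ
  have hβ0 : 0 < β := by
    rw [hβ, sub_pos]; exact div_lt_div_of_pos_left two_pos hd0 hdq
  -- The ratio `l` of the measures of consecutive superlevel sets makes up for the factor `16`
  -- which the step loses when the distance of the levels is halved.
  set l := (1 / 16 : ℝ) ^ (1 / β) with hl
  have hl0 : 0 < l := by positivity
  have hl1 : l < 1 := Real.rpow_lt_one (by norm_num) (by norm_num) (by positivity)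
  have hlβ : l ^ β = 1 / 16 := by
    rw [hl, ← Real.rpow_mul (by norm_num), one_div_mul_cancel hβ0.ne', Real.rpow_one]
  obtain ⟨a₁, ha₁, ha₁₀, ha₁C⟩ : ∃ a₁ : ℝ, 0 < a₁ ∧ a₁ ≤ a₀ ∧ 16 * C * a₁ ^ β ≤ l := by
    have hlim : Tendsto (fun a : ℝ => 16 * C * a ^ β) (𝓝 0) (𝓝 0) := by
      have hcont : Continuous fun a : ℝ => 16 * C * a ^ β :=
        continuous_const.mul (Real.continuous_rpow_const hβ0.le)
      have := hcont.tendsto 0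
      rwa [Real.zero_rpow hβ0.ne', mul_zero] at this
    have hev := (hlim.eventually (eventually_lt_nhds hl0)).filter_mono
      (nhdsWithin_le_nhds (s := Ioi 0))
    obtain ⟨a, ha, ha'⟩ := (hev.and (Ioc_mem_nhdsGT ha₀)).exists
    exact ⟨a, ha'.1, ha'.2, ha.le⟩
  -- From `exp x ≥ x + 1` the first level is so high that the mass of `u` makes its superlevel set
  -- smaller than `a₁` and than half of the ball.
  set κ₀ := |Ω| + 1 + (2 * L₂ + L₁ / a₁) with hκ₀
  have hB : 0 ≤ 2 * L₂ + L₁ / a₁ := by positivity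
  have hκ₀Ω : Ω + 1 ≤ κ₀ := by linarith [le_abs_self Ω]
  have hκ₀0 : 0 ≤ κ₀ := by linarith [abs_nonneg Ω]
  have hexp : 2 * L₂ + L₁ / a₁ ≤ exp (κ₀ - Ω) := by
    linarith [Real.add_one_le_exp (κ₀ - Ω), le_abs_self Ω]
  have hexpL₂ : 2 * L₂ ≤ exp (κ₀ - Ω) := le_trans (by linarith [div_nonneg hL₁ ha₁.le]) hexp
  have hexpL₁ : L₁ ≤ a₁ * exp (κ₀ - Ω) := by
    rw [← div_le_iff₀' ha₁]; linarith
  refine ⟨exp (κ₀ + 1 + Ω), ?_⟩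
  intro ε r T V W u₀ u hε hr hT hVW h hi hu₀n hmass hu₀L x hx t ht htT
  have hbf : volume (ball (0 : EuclideanSpace ℝ (Fin d)) r) ≠ ⊤ := measure_ball_lt_top.ne
  have hmass2 : ∫ x in ball 0 r, u₀ x ≤ L₂ * volume.real (ball (0 : EuclideanSpace ℝ (Fin d)) r) := by
    calc _ ≤ ∫ _ in ball (0 : EuclideanSpace ℝ (Fin d)) r, L₂ :=
          setIntegral_mono_ae_restrict hi (integrableOn_const hbf) hu₀L
      _ = _ := by rw [setIntegral_const, smul_eq_mul, mul_comm]
  set S : ℝ → ℝ → Set (EuclideanSpace ℝ (Fin d)) := fun κ s =>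
    {x ∈ ball (0 : EuclideanSpace ℝ (Fin d)) r | κ < levelTau m ε (W x) (u x s)} with hS
  have hSf : ∀ κ s, volume (S κ s) ≠ ⊤ := fun κ s =>
    ((measure_mono fun x hx => hx.1).trans_lt measure_ball_lt_top).ne
  have hSmono : ∀ {κ κ' : ℝ} (s : ℝ), κ ≤ κ' → volume (S κ' s) ≤ volume (S κ s) :=
    fun s hk => measure_mono fun x hx => ⟨hx.1, hk.trans_lt hx.2⟩
  have hstart : ∀ s : ℝ, 0 < s → (s : EReal) < T → volume (S κ₀ s) ≤ ENNReal.ofReal a₁ ∧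
      2 * volume (S κ₀ s) ≤ volume (ball (0 : EuclideanSpace ℝ (Fin d)) r) := by
    intro s hs hsT
    have hch := h.volume_superlevel_mul_exp_le hm hε hr hVW (by linarith : Ω ≤ κ₀) hi hu₀n hs hsT
    have he := Real.exp_pos (κ₀ - Ω)
    constructor
    · rw [← ENNReal.ofReal_toReal (hSf κ₀ s)]
      refine ENNReal.ofReal_le_ofReal (le_of_mul_le_mul_right ?_ he)
      exact hch.trans (hmass.trans hexpL₁)
    · rw [← ENNReal.ofReal_toReal (hSf κ₀ s), ← ENNReal.ofReal_toReal hbf,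
        show (2 : ℝ≥0∞) * ENNReal.ofReal (volume (S κ₀ s)).toReal =
          ENNReal.ofReal (2 * (volume (S κ₀ s)).toReal) by
            rw [ENNReal.ofReal_mul zero_le_two, ENNReal.ofReal_ofNat]]
      refine ENNReal.ofReal_le_ofReal (le_of_mul_le_mul_right ?_ he)
      have hb0 : 0 ≤ volume.real (ball (0 : EuclideanSpace ℝ (Fin d)) r) := measureReal_nonneg
      calc 2 * volume.real (S κ₀ s) * exp (κ₀ - Ω)
          = 2 * (volume.real (S κ₀ s) * exp (κ₀ - Ω)) := by ring
        _ ≤ 2 * (L₂ * volume.real (ball (0 : EuclideanSpace ℝ (Fin d)) r)) := by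
            exact mul_le_mul_of_nonneg_left (hch.trans hmass2) zero_le_two
        _ = volume.real (ball (0 : EuclideanSpace ℝ (Fin d)) r) * (2 * L₂) := by ring
        _ ≤ _ := by gcongr; exact le_rfl
  have hiter : ∀ n : ℕ, ∀ s : ℝ, 0 < s → (s : EReal) < T →
      volume (S (κ₀ + 1 - (1 / 2) ^ n) s) ≤ ENNReal.ofReal (a₁ * l ^ n) := by
    intro n
    induction n with
    | zero =>
      intro s hs hsT
      simpa using (hstart s hs hsT).1
    | succ n ih =>
      intro s hs hsT
      have hp0 : (0 : ℝ) < (1 / 2) ^ n := by positivity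
      have hp1 : (1 / 2 : ℝ) ^ n ≤ 1 := pow_le_one₀ (by norm_num) (by norm_num)
      have hκn : κ₀ ≤ κ₀ + 1 - (1 / 2) ^ n := by linarith
      have hln : l ^ n ≤ 1 := pow_le_one₀ hl0.le hl1.le
      have hθ : (1 / 2 : ℝ) ^ (n + 1) = (1 / 2) ^ n / 2 := by rw [pow_succ]; ring
      have hu₀κ : ∀ᵐ x ∂(volume.restrict (ball (0 : EuclideanSpace ℝ (Fin d)) r)),
          u₀ x ≤ exp (κ₀ + 1 - (1 / 2) ^ n - Ω) := by
        filter_upwards [hu₀L] with x hx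
        calc u₀ x ≤ 2 * L₂ := by linarith
          _ ≤ exp (κ₀ - Ω) := hexpL₂
          _ ≤ _ := Real.exp_le_exp.2 (by linarith)
      have := hstep hε hr hT hVW h (κ₀ + 1 - (1 / 2) ^ n) (a₁ * l ^ n) ((1 / 2) ^ (n + 1))
        (by linarith) hu₀κ (by positivity)
        ((mul_le_of_le_one_right ha₁.le hln).trans ha₁₀) (by positivity)
        (pow_le_one₀ (by norm_num) (by norm_num))
        (fun s hs hsT => ⟨ih s hs hsT, (mul_le_mul_right (hSmono s hκn) 2).trans
          (hstart s hs hsT).2⟩) s hs hsT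
      rw [show κ₀ + 1 - (1 / 2 : ℝ) ^ (n + 1) = κ₀ + 1 - (1 / 2) ^ n + (1 / 2) ^ (n + 1) by
        rw [hθ]; ring]
      refine this.trans (ENNReal.ofReal_le_ofReal ?_)
      have e1 : (a₁ * l ^ n) ^ (1 + β) = a₁ * l ^ n * (a₁ ^ β * (1 / 16) ^ n) := by
        rw [Real.rpow_add (by positivity), Real.rpow_one, Real.mul_rpow ha₁.le (by positivity),
          ← hlβ, ← Real.rpow_natCast, ← Real.rpow_natCast, ← Real.rpow_mul hl0.le,
          ← Real.rpow_mul hl0.le, mul_comm β]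
      have e2 : ((1 / 2 : ℝ) ^ (n + 1)) ^ 4 = (1 / 16) ^ n / 16 := by
        rw [← pow_mul, mul_comm, pow_mul, pow_succ]; norm_num; ring
      rw [e1, e2]
      calc _ = 16 * C * a₁ ^ β * (a₁ * l ^ n) := by field_simp
        _ ≤ l * (a₁ * l ^ n) := by gcongr
        _ = _ := by ring
  refine h.le_exp_of_volume_superlevel_eq_zero hm hε hr hVW (by linarith) ht htT ?_ hx
  have hlim : Tendsto (fun n : ℕ => ENNReal.ofReal (a₁ * l ^ n)) atTop (𝓝 0) := by
    have := ((tendsto_pow_atTop_nhds_zero_of_lt_one hl0.le hl1).const_mul a₁)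
    rw [mul_zero] at this
    simpa using ENNReal.tendsto_ofReal this
  refine le_antisymm (ge_of_tendsto' hlim fun n => ?_) bot_le
  exact (hSmono t (by linarith [show (0 : ℝ) < (1 / 2) ^ n by positivity])).trans
    (hiter n t ht htT)

end DriftDiffusion

/-! ### Decompositions of the drift -/

namespace DriftDiffusion

/-- On a set of measure at most one the `L ^ p` norms increase with `p`. -/
theorem eLpNorm_restrict_le_of_volume_le_one {d : ℕ} {F : Type*} [NormedAddCommGroup F]
    {f : EuclideanSpace ℝ (Fin d) → F} (hf : Continuous f) {p s : ℝ≥0∞} (hps : p ≤ s)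
    {A : Set (EuclideanSpace ℝ (Fin d))} (hA : volume A ≤ 1) :
    eLpNorm f p (volume.restrict A) ≤ eLpNorm f s volume := by
  rcases eq_or_ne p 0 with rfl | hp
  · simp
  refine (eLpNorm_le_eLpNorm_mul_rpow_measure_univ hps hf.aestronglyMeasurable).trans ?_
  have h1 : eLpNorm f s (volume.restrict A) ≤ eLpNorm f s volume :=
    eLpNorm_mono_measure _ Measure.restrict_le_self
  have h2 : (volume.restrict A) univ ^ (1 / p.toReal - 1 / s.toReal) ≤ 1 := by
    refine ENNReal.rpow_le_one (by rwa [Measure.restrict_apply_univ]) (sub_nonneg.2 ?_)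
    rcases eq_or_ne s ⊤ with rfl | hs
    · simp
    · have hp' : p ≠ ⊤ := (hps.trans_lt hs.lt_top).ne
      exact one_div_le_one_div_of_le (ENNReal.toReal_pos hp hp') (ENNReal.toReal_mono hs hps)
  calc _ ≤ eLpNorm f s volume * 1 := by gcongr
    _ = _ := mul_one _

theorem lintegral_enorm_rpow_le_of_eLpNorm_le {α F : Type*} [MeasurableSpace α]
    [NormedAddCommGroup F] {μ : Measure α} {f : α → F} {q K : ℝ} (hq : 0 < q) (hK : 0 ≤ K)
    (h : eLpNorm f (ENNReal.ofReal q) μ ≤ ENNReal.ofReal K) :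
    ∫⁻ x, ‖f x‖ₑ ^ q ∂μ ≤ ENNReal.ofReal (K ^ q) := by
  rw [eLpNorm_eq_lintegral_rpow_enorm_toReal (by simpa using hq) ENNReal.ofReal_ne_top,
    ENNReal.toReal_ofReal hq.le, one_div, ENNReal.rpow_inv_le_iff hq,
    ENNReal.ofReal_rpow_of_nonneg hK hq.le] at h
  exact h

/-- A sum of two fields with known integrability is a remainder in the sense of
`IsDriftDecomposition`, for any lower exponent. -/
theorem lintegral_add_rpow_le {d : ℕ} {F : Type*} [NormedAddCommGroup F]
    {f g : EuclideanSpace ℝ (Fin d) → F} (hf : Continuous f) (hg : Continuous g) {q : ℝ}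
    (hq : 1 ≤ q) {s s' : ℝ≥0∞} (hs : ENNReal.ofReal q ≤ s) (hs' : ENNReal.ofReal q ≤ s')
    {K K' : ℝ≥0} (hfK : eLpNorm f s volume ≤ K) (hgK : eLpNorm g s' volume ≤ K')
    {A : Set (EuclideanSpace ℝ (Fin d))} (hA : volume A ≤ 1) :
    ∫⁻ x in A, ‖f x + g x‖ₑ ^ q ≤ ENNReal.ofReal ((K + K' : ℝ) ^ q) := by
  refine lintegral_enorm_rpow_le_of_eLpNorm_le (by linarith) (by positivity) ?_
  refine (eLpNorm_add_le (f := f) (g := g) hf.aestronglyMeasurable hg.aestronglyMeasurable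
    (by simpa using hq)).trans ?_
  rw [ENNReal.ofReal_add (by positivity) (by positivity), ENNReal.ofReal_coe_nnreal,
    ENNReal.ofReal_coe_nnreal]
  exact add_le_add ((eLpNorm_restrict_le_of_volume_le_one hf hs hA).trans hfK)
    ((eLpNorm_restrict_le_of_volume_le_one hg hs' hA).trans hgK)

/-- If the exponent is larger than two, no potential is needed. -/
theorem isDriftDecomposition_zero {d : ℕ} {q : ℝ} (hq : 1 ≤ q) {p : ℝ≥0∞}
    (hqp : ENNReal.ofReal q ≤ p) {K₁ K₂ : ℝ≥0}
    {V₁ V₂ : EuclideanSpace ℝ (Fin d) → EuclideanSpace ℝ (Fin d)} (hV₁ : ContDiff ℝ ∞ V₁)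
    (hV₂ : ContDiff ℝ ∞ V₂) (h₁ : eLpNorm V₁ ⊤ volume ≤ K₁) (h₂ : eLpNorm V₂ p volume ≤ K₂) :
    IsDriftDecomposition q (K₁ + K₂) 0 (fun x => V₁ x + V₂ x) fun _ => 0 where
  contDiff_drift := (hV₁.add hV₂).of_le (by exact_mod_cast le_top)
  contDiff_potential := contDiff_const
  abs_potential_le x := by simp
  lintegral_le A _ hA := by
    simp only [gradient_fun_const, sub_zero]
    exact lintegral_add_rpow_le hV₁.continuous hV₂.continuous hq le_top hqp h₁ h₂ hA

theorem abs_cube_div_le_rpow {p : ℝ} (hp1 : 1 ≤ p) (hp3 : p ≤ 3) (v : ℝ) :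
    |v ^ 3 / (1 + v ^ 2)| ≤ |v| ^ p := by
  have h0 : 0 < 1 + v ^ 2 := by positivity
  rw [abs_div, abs_of_pos h0, abs_pow]
  rcases le_total |v| 1 with hv | hv
  · calc |v| ^ 3 / (1 + v ^ 2) ≤ |v| ^ 3 := div_le_self (by positivity) (by nlinarith [sq_nonneg v])
      _ = |v| ^ (3 : ℝ) := by norm_cast
      _ ≤ |v| ^ p := Real.rpow_le_rpow_of_exponent_ge' (abs_nonneg v) hv (by linarith) hp3
  · calc |v| ^ 3 / (1 + v ^ 2) ≤ |v| := by
          rw [div_le_iff₀ h0, ← sq_abs v]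
          nlinarith [abs_nonneg v]
      _ = |v| ^ (1 : ℝ) := (Real.rpow_one _).symm
      _ ≤ |v| ^ p := Real.rpow_le_rpow_of_exponent_le hv hp1

theorem abs_sub_cube_div_le_one (v : ℝ) : |v - v ^ 3 / (1 + v ^ 2)| ≤ 1 := by
  have h0 : 0 < 1 + v ^ 2 := by positivity
  have : v - v ^ 3 / (1 + v ^ 2) = v / (1 + v ^ 2) := by field_simp; ring
  rw [this, abs_div, abs_of_pos h0, div_le_one h0, ← sq_abs]
  nlinarith [sq_nonneg (|v| - 1), abs_nonneg v]

theorem measurePreserving_apply_zero :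
    MeasurePreserving (fun x : EuclideanSpace ℝ (Fin 1) => x 0) := by
  have h := (volume_preserving_funUnique (Fin 1) ℝ).comp (PiLp.volume_preserving_ofLp (Fin 1))
  exact h

/-- In dimension one every field is a gradient. With `V₂ = V₂ / (1 + V₂ ^ 2) + V₂ ^ 3 / (1 + V₂ ^ 2)`
the first part is bounded, and the second is integrable because it is dominated by `|V₂| ^ p`, so
that it has a bounded primitive even if `p` is smaller than two. -/
theorem exists_isDriftDecomposition_of_dim_one {p : ℝ} (hp1 : 1 ≤ p) (hp3 : p ≤ 3) {K₁ K₂ : ℝ≥0}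
    {V₁ V₂ : EuclideanSpace ℝ (Fin 1) → EuclideanSpace ℝ (Fin 1)} (hV₁ : ContDiff ℝ ∞ V₁)
    (hV₂ : ContDiff ℝ ∞ V₂) (h₁ : eLpNorm V₁ ⊤ volume ≤ K₁)
    (h₂ : eLpNorm V₂ (ENNReal.ofReal p) volume ≤ K₂) :
    ∃ W, IsDriftDecomposition 3 (K₁ + 1) ((K₂ : ℝ) ^ p) (fun x => V₁ x + V₂ x) W := by
  have hp0 : 0 < p := by linarith
  set e : EuclideanSpace ℝ (Fin 1) := EuclideanSpace.single 0 1 with he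
  have hxe : ∀ x : EuclideanSpace ℝ (Fin 1), x 0 • e = x := fun x => by
    ext i; fin_cases i; simp [he]
  set g : ℝ → ℝ := fun s => V₂ (s • e) 0 ^ 3 / (1 + V₂ (s • e) 0 ^ 2) with hg
  have hgc : Continuous g := by
    have hc : Continuous fun s : ℝ => V₂ (s • e) 0 :=
      (EuclideanSpace.proj (𝕜 := ℝ) (0 : Fin 1)).continuous.comp
        (hV₂.continuous.comp (by fun_prop : Continuous fun s : ℝ => s • e))
    exact (hc.pow 3).div (by fun_prop) fun s => by positivity
  set G : ℝ → ℝ := fun y => ∫ s in (0 : ℝ)..y, g s with hG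
  have hGd : ∀ y, HasDerivAt G (g y) y := fun y =>
    intervalIntegral.integral_hasDerivAt_right (hgc.intervalIntegrable _ _)
      (hgc.stronglyMeasurableAtFilter _ _) hgc.continuousAt
  have hGc : ContDiff ℝ 1 G := by
    rw [contDiff_one_iff_deriv]
    refine ⟨fun y => (hGd y).differentiableAt, ?_⟩
    rw [show deriv G = g from funext fun y => (hGd y).deriv]
    exact hgc
  have hgrad : ∀ x : EuclideanSpace ℝ (Fin 1), gradient (fun x => G (x 0)) x = g (x 0) • e := by
    intro x
    have h1 : HasFDerivAt (fun x : EuclideanSpace ℝ (Fin 1) => G (x 0))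
        (g (x 0) • EuclideanSpace.proj (𝕜 := ℝ) (0 : Fin 1) :
          EuclideanSpace ℝ (Fin 1) →L[ℝ] ℝ) x :=
      HasDerivAt.comp_hasFDerivAt (h₂ := G) x (hGd (x 0))
        (EuclideanSpace.proj (𝕜 := ℝ) (0 : Fin 1)).hasFDerivAt
    refine HasGradientAt.gradient (hasGradientAt_iff_hasFDerivAt.2 ?_)
    have h2 : InnerProductSpace.toDual ℝ (EuclideanSpace ℝ (Fin 1)) (g (x 0) • e) =
        g (x 0) • EuclideanSpace.proj (𝕜 := ℝ) (0 : Fin 1) := by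
      ext y
      have h3 : inner ℝ e y = y 0 := by
        rw [he, EuclideanSpace.inner_single_left]; simp
      simp [h3]
    rw [h2]
    exact h1
  have hV₂e : ∀ x : EuclideanSpace ℝ (Fin 1), g (x 0) = V₂ x 0 ^ 3 / (1 + V₂ x 0 ^ 2) := fun x => by
    rw [hg]; beta_reduce; rw [hxe]
  have hnorm : ∀ x : EuclideanSpace ℝ (Fin 1), ‖x‖ = |x 0| := fun x => by
    rw [EuclideanSpace.norm_eq, Fin.sum_univ_one, Real.norm_eq_abs, sq_abs, Real.sqrt_sq_eq_abs]
  have hW1 : ContDiff ℝ 1 fun x : EuclideanSpace ℝ (Fin 1) => G (x 0) :=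
    hGc.comp (EuclideanSpace.proj (𝕜 := ℝ) (0 : Fin 1)).contDiff
  refine ⟨fun x => G (x 0), (hV₁.add hV₂).of_le (by exact_mod_cast le_top), hW1, fun x => ?_,
    fun A _ hA => ?_⟩
  · have hle : ‖G (x 0)‖ₑ ≤ ENNReal.ofReal ((K₂ : ℝ) ^ p) := by
      calc ‖G (x 0)‖ₑ = ‖∫ s in uIoc 0 (x 0), g s‖ₑ := by
            rw [← ofReal_norm, ← ofReal_norm, hG, intervalIntegral.norm_intervalIntegral_eq]
        _ ≤ ∫⁻ s in uIoc 0 (x 0), ‖g s‖ₑ := enorm_integral_le_lintegral_enorm _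
        _ ≤ ∫⁻ s, ‖g s‖ₑ := setLIntegral_le_lintegral _ _
        _ = ∫⁻ y : EuclideanSpace ℝ (Fin 1), ‖g (y 0)‖ₑ :=
            (measurePreserving_apply_zero.lintegral_comp hgc.measurable.enorm).symm
        _ ≤ ∫⁻ y, ‖V₂ y‖ₑ ^ p := by
            refine lintegral_mono fun y => ?_
            rw [← ofReal_norm (V₂ y), ENNReal.ofReal_rpow_of_nonneg (norm_nonneg _) hp0.le,
              Real.enorm_eq_ofReal_abs, hV₂e, hnorm]
            exact ENNReal.ofReal_le_ofReal (abs_cube_div_le_rpow hp1 hp3 _)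
        _ ≤ _ := lintegral_enorm_rpow_le_of_eLpNorm_le hp0 K₂.coe_nonneg
            (by rwa [ENNReal.ofReal_coe_nnreal])
    rw [Real.enorm_eq_ofReal_abs] at hle
    exact (ENNReal.ofReal_le_ofReal_iff (by positivity)).1 hle
  · have hrest : eLpNorm (fun x => V₂ x - gradient (fun x => G (x 0)) x) ⊤ volume ≤ (1 : ℝ≥0) := by
      rw [eLpNorm_exponent_top]
      refine eLpNormEssSup_le_of_ae_enorm_bound (ae_of_all _ fun x => ?_)
      rw [← ofReal_norm, hnorm, hgrad, hV₂e]
      have := abs_sub_cube_div_le_one (V₂ x 0)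
      simpa [he] using this
    have hcont : Continuous fun x => V₂ x - gradient (fun x => G (x 0)) x :=
      hV₂.continuous.sub ((InnerProductSpace.toDual ℝ (EuclideanSpace ℝ (Fin 1))).symm.continuous.comp
        (hW1.continuous_fderiv one_ne_zero))
    have := lintegral_add_rpow_le hV₁.continuous hcont (q := 3) (by norm_num) le_top le_top h₁ hrest
      hA
    simpa only [add_sub_assoc, NNReal.coe_one] using this

end DriftDiffusion

/-! ### The uniform bound -/

namespace DriftDiffusion

/-- In all dimensions and for all exponents above the dimension, the drifts under consideration
have decompositions with uniform constants. -/
theorem exists_isDriftDecomposition {d : ℕ} (hd : 1 ≤ d) {p : ℝ≥0∞} (hp : (d : ℝ≥0∞) < p)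
    (K₁ K₂ : ℝ≥0) :
    ∃ q K Ω : ℝ, d < q ∧ 2 < q ∧ 0 ≤ K ∧
      ∀ V₁ V₂ : EuclideanSpace ℝ (Fin d) → EuclideanSpace ℝ (Fin d), ContDiff ℝ ∞ V₁ →
        ContDiff ℝ ∞ V₂ → eLpNorm V₁ ⊤ volume ≤ K₁ → eLpNorm V₂ p volume ≤ K₂ →
        ∃ W, IsDriftDecomposition q K Ω (fun x => V₁ x + V₂ x) W := by
  rcases lt_or_ge 2 p with h2p | hp2
  · obtain ⟨q, hq, hqp⟩ := ENNReal.lt_iff_exists_nnreal_btwn.1 (max_lt hp h2p)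
    obtain ⟨hdq, h2q⟩ := max_lt_iff.1 hq
    have hdq' : (d : ℝ) < q := by exact_mod_cast hdq
    have h2q' : (2 : ℝ) < q := by exact_mod_cast h2q
    exact ⟨q, K₁ + K₂, 0, hdq', h2q', by positivity, fun V₁ V₂ hV₁ hV₂ h₁ h₂ =>
      ⟨_, isDriftDecomposition_zero (by linarith) (by rw [ENNReal.ofReal_coe_nnreal]; exact hqp.le)
        hV₁ hV₂ h₁ h₂⟩⟩
  · have hptop : p ≠ ⊤ := (hp2.trans_lt ENNReal.ofNat_lt_top).ne
    obtain rfl : d = 1 := by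
      have : (d : ℝ≥0∞) < 2 := hp.trans_le hp2
      have : d < 2 := by exact_mod_cast this
      omega
    have hp1 : 1 ≤ p.toReal := by
      rw [← ENNReal.toReal_one]
      exact ENNReal.toReal_mono hptop (by exact_mod_cast hp.le)
    have hp3 : p.toReal ≤ 3 := by
      have := ENNReal.toReal_mono ENNReal.ofNat_ne_top hp2
      rw [ENNReal.toReal_ofNat] at this
      linarith
    exact ⟨3, K₁ + 1, (K₂ : ℝ) ^ p.toReal, by norm_num, by norm_num, by positivity,
      fun V₁ V₂ hV₁ hV₂ h₁ h₂ => exists_isDriftDecomposition_of_dim_one hp1 hp3 hV₁ hV₂ h₁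
        (by rwa [ENNReal.ofReal_toReal hptop])⟩

end DriftDiffusion

theorem theorem3p1 (d : ℕ) (hd : 1 ≤ d) (m : ℝ) (hm : 1 < m) (p : ℝ≥0∞) (hp : (d : ℝ≥0∞) < p)
    (K₁ K₂ L₁ L₂ : ℝ≥0) :
    ∃ M : ℝ, ∀ (V₁ V₂ : EuclideanSpace ℝ (Fin d) → EuclideanSpace ℝ (Fin d))
      (u₀ : EuclideanSpace ℝ (Fin d) → ℝ) (ε r : ℝ) (T : EReal)
      (u : EuclideanSpace ℝ (Fin d) → ℝ → ℝ),
      ContDiff ℝ ∞ V₁ → ContDiff ℝ ∞ V₂ →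
      eLpNorm V₁ ⊤ volume ≤ K₁ → eLpNorm V₂ p volume ≤ K₂ →
      MemLp u₀ 1 volume → MemLp u₀ ⊤ volume → (∀ᵐ x, 0 ≤ u₀ x) →
      eLpNorm u₀ 1 volume ≤ L₁ → eLpNorm u₀ ⊤ volume ≤ L₂ →
      0 < ε → 0 < r → 0 < T →
      DriftDiffusion.IsSmoothNoFluxSolution m ε r T (fun x => V₁ x + V₂ x) u₀ u →
      (∀ x ∈ closedBall 0 r, ∀ t : ℝ, 0 < t → (t : EReal) < T → |u x t| ≤ M) ∧
        ∀ᵐ x ∂(volume.restrict (ball 0 r)), |u x 0| ≤ M := by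
  obtain ⟨q, K, Ω, hdq, h2q, hK, hV⟩ := DriftDiffusion.exists_isDriftDecomposition hd hp K₁ K₂
  obtain ⟨M, hM⟩ := DriftDiffusion.exists_bound_of_isDriftDecomposition hd hm hdq h2q hK
    L₁.coe_nonneg L₂.coe_nonneg Ω
  refine ⟨max M L₂, ?_⟩
  intro V₁ V₂ u₀ ε r T u hV₁ hV₂ h₁ h₂ hu₀1 _ hu₀n hL₁ hL₂ hε hr hT h
  obtain ⟨W, hW⟩ := hV V₁ V₂ hV₁ hV₂ h₁ h₂
  have hu₀L : ∀ᵐ x, |u₀ x| ≤ L₂ := by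
    rw [eLpNorm_exponent_top] at hL₂
    filter_upwards [enorm_ae_le_eLpNormEssSup u₀ volume] with x hx
    have := hx.trans hL₂
    rw [Real.enorm_eq_ofReal_abs, ← ENNReal.ofReal_coe_nnreal] at this
    exact (ENNReal.ofReal_le_ofReal_iff L₂.coe_nonneg).1 this
  have hi : Integrable u₀ := memLp_one_iff_integrable.1 hu₀1
  have hmass : ∫ x in ball 0 r, u₀ x ≤ L₁ := by
    rw [eLpNorm_one_eq_lintegral_enorm, ← ofReal_integral_norm_eq_lintegral_enorm hi,
      ← ENNReal.ofReal_coe_nnreal, ENNReal.ofReal_le_ofReal_iff L₁.coe_nonneg] at hL₁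
    calc ∫ x in ball 0 r, u₀ x ≤ ∫ x, u₀ x := setIntegral_le_integral hi hu₀n
      _ ≤ ∫ x, ‖u₀ x‖ := integral_mono hi hi.norm fun x => Real.le_norm_self _
      _ ≤ L₁ := hL₁
  constructor
  · intro x hx t ht htT
    rw [abs_of_nonneg (h.nonneg x hx t ht htT)]
    refine (hM hε hr hT hW h hi.integrableOn hu₀n hmass ?_ x hx t ht htT).trans (le_max_left _ _)
    exact (ae_restrict_of_ae hu₀L).mono fun x hx => (le_abs_self _).trans hx
  · filter_upwards [h.initial, ae_restrict_of_ae hu₀L] with x hx hxL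
    rw [hx]
    exact hxL.trans (le_max_right _ _)
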